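/- Let $d\ge 1$, let $\Gamma\subset\mathbb R^d$ be a compact orientable submanifold of class $C^2$ and codimension one (with or without boundary), let $\sigma_\Gamma(G)=s_{d-1}(G\cap\Gamma)$ where $s_{d-1}$ is the $(d-1)$-dimensional surface measure, and let $\alpha>0$. Let $I\colon W^{1,2}(\mathbb R^d)\to L^2(\sigma_\Gamma)$ be the trace map (the continuous extension of the restriction of test functions to $\Gamma$). For complex-valued $f,g\in W^{1,2}(\mathbb R^d)$ put $$\mathcal E(f,g)=\int_{\mathbb R^d}\nabla f\cdot\nabla\overline g\,dx-\alpha\int (If)\,\overline{(Ig)}\,d\sigma_\Gamma ,$$ and let $H$ be the self-adjoint operator in $L^2(\mathbb R^d)$ associated with the closed form $\mathcal E$; that is, $u\in D(H)$ and $Hu=w$ if and only if $u\in W^{1,2}(\mathbb R^d)$, $w\in L^2(\mathbb R^d)$ and $\mathcal E(u,g)=(w,g)$ for all $g\in W^{1,2}(\mathbb R^d)$, where $(f,g)=\int f\overline g\,dx$. Assume that $\psi_0$ is an eigenfunction of $H$ with eigenvalue $E_0\in\mathbb R$ and that $\psi_0>0$ almost everywhere. Then $Uf=\psi_0^{-1}f$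 defines a unitary map $U\colon L^2(\mathbb R^d)\to L^2(\mathbb R^d,\psi_0^2\,dx)$. Let $W^{1,2}(\mathbb R^d,\psi_0^2dx)$ be the space of all $\psi\in L^2(\mathbb R^d,\psi_0^2dx)$ that are locally integrable and have a locally integrable weak gradient $\nabla\psi$ with $\int|\nabla\psi|^2\psi_0^2\,dx<\infty$. Then, for $\psi\in L^2(\mathbb R^d,\psi_0^2dx)$, one has $\psi\in W^{1,2}(\mathbb R^d,\psi_0^2dx)$ if and only if $U^{-1}\psi\in W^{1,2}(\mathbb R^d)$, and for all $\psi,\varphi\in W^{1,2}(\mathbb R^d,\psi_0^2dx)$ $$\mathcal E(U^{-1}\psi,U^{-1}\varphi)-E_0\,(U^{-1}\psi,U^{-1}\varphi)=\int_{\mathbb R^d}\nabla\psi\cdot\nabla\overline\varphi\;\psi_0^2\,dx .$$ -/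

import Mathlib

open MeasureTheory Filter Topology
open scoped ContDiff ENNReal ComplexConjugate

namespace SingularSchrodinger

/-- Euclidean space `ℝ^d`. -/
abbrev Space (d : ℕ) : Type := EuclideanSpace ℝ (Fin d)

/-- `Γ ⊆ ℝ^d` is a compact orientable embedded submanifold of class `C²` and codimension one,
possibly with boundary. Around each of its points there is a `C²` diffeomorphism `e` between open
subsets of `ℝ^d` which maps `Γ` to a coordinate hyperplane `{y i = 0}` (interior points) or to a
half hyperplane `{y i = 0, 0 ≤ y j}` (near boundary points); and there is a global continuous
field `n` of unit normal vectors. (The tangent cone over `ℝ` of such a set at a point, including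
a boundary point, is the whole tangent space.) -/
structure IsCompactHypersurface {d : ℕ} (Γ : Set (Space d)) : Prop where
  isCompact : IsCompact Γ
  chart : ∀ p ∈ Γ, ∃ e : OpenPartialHomeomorph (Space d) (Space d), p ∈ e.source ∧
    ContDiffOn ℝ 2 e e.source ∧ ContDiffOn ℝ 2 e.symm e.target ∧
    ((∃ i, e '' (Γ ∩ e.source) = {y | y ∈ e.target ∧ y i = 0}) ∨
      (∃ i j, i ≠ j ∧ e '' (Γ ∩ e.source) = {y | y ∈ e.target ∧ y i = 0 ∧ 0 ≤ y j}))
  orientable : ∃ n : Space d → Space d, ContinuousOn n Γ ∧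
    ∀ p ∈ Γ, ‖n p‖ = 1 ∧ ∀ v ∈ tangentConeAt ℝ Γ p, inner ℝ (n p) v = 0

/-- The measure `σ_Γ(G) = s_{d-1}(G ∩ Γ)`, with `s_{d-1}` the `(d-1)`-dimensional surface measure
(the Hausdorff measure, normalized to agree with Lebesgue measure on `ℝ^{d-1}`). -/
noncomputable def surfaceMeasure {d : ℕ} (Γ : Set (Space d)) : Measure (Space d) :=
  (Measure.euclideanHausdorffMeasure (d - 1)).restrict Γ

/-- `G` is the weak (distributional) gradient of `f` on `ℝ^d`. -/
structure HasWeakGradient {d : ℕ} (f : Space d → ℂ) (G : Space d → EuclideanSpace ℂ (Fin d)) :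
    Prop where
  locallyIntegrable : LocallyIntegrable f volume
  locallyIntegrable_grad : LocallyIntegrable G volume
  integral_eq : ∀ η : Space d → ℝ, ContDiff ℝ ∞ η → HasCompactSupport η → ∀ i : Fin d,
    ∫ x, f x * (fderiv ℝ η x (EuclideanSpace.single i 1) : ℂ) = - ∫ x, G x i * (η x : ℂ)

/-- The Sobolev space `W^{1,2}(ℝ^d, μ)`: `f` has a weak gradient, and `f` and its weak gradient
are square integrable with respect to `μ`. -/
def MemW12 {d : ℕ} (μ : Measure (Space d)) (f : Space d → ℂ) : Prop :=
  MemLp f 2 μ ∧ ∃ G, HasWeakGradient f G ∧ MemLp G 2 μ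

open Classical in
/-- The weak gradient `∇f` (almost everywhere unique; zero if there is none). -/
noncomputable def weakGrad {d : ℕ} (f : Space d → ℂ) : Space d → EuclideanSpace ℂ (Fin d) :=
  if h : ∃ G, HasWeakGradient f G then h.choose else 0

/-- `g ∈ L²(σ_Γ)` is the trace on `Γ` of `f ∈ W^{1,2}(ℝ^d)`: it is the limit in `L²(σ_Γ)` of the
restrictions of test functions that converge to `f` in `W^{1,2}(ℝ^d)`. That is, `f ↦ g` is the
continuous extension to `W^{1,2}(ℝ^d)` of the restriction map on test functions. -/
def IsTrace {d : ℕ} (Γ : Set (Space d)) (f g : Space d → ℂ) : Prop :=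
  MemLp g 2 (surfaceMeasure Γ) ∧
  ∃ η : ℕ → Space d → ℂ, (∀ n, ContDiff ℝ ∞ (η n) ∧ HasCompactSupport (η n)) ∧
    Tendsto (fun n => eLpNorm (η n - f) 2 volume + eLpNorm (weakGrad (η n - f)) 2 volume)
      atTop (𝓝 0) ∧
    Tendsto (fun n => eLpNorm (η n - g) 2 (surfaceMeasure Γ)) atTop (𝓝 0)

open Classical in
/-- The trace map `I_{σ_Γ} : W^{1,2}(ℝ^d) → L²(σ_Γ)`. -/
noncomputable def trace {d : ℕ} (Γ : Set (Space d)) (f : Space d → ℂ) : Space d → ℂ :=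
  if h : ∃ g, IsTrace Γ f g then h.choose else 0

/-- The scalar product `(f, g) = ∫ f conj(g) dx` of `L²(ℝ^d)`. -/
noncomputable def scalarProduct {d : ℕ} (f g : Space d → ℂ) : ℂ :=
  ∫ x, f x * conj (g x)

/-- The sesquilinear form
`ℰ(f, g) = ∫ ∇f · conj(∇g) dx - α ∫ (I f) conj(I g) dσ_Γ` on `W^{1,2}(ℝ^d)`.
(Mathlib's inner product is conjugate linear in its first argument, so that
`inner ℂ (∇g) (∇f) = ∑ i, ∂ᵢf conj(∂ᵢg)`.) -/
noncomputable def singularForm {d : ℕ} (Γ : Set (Space d)) (α : ℝ) (f g : Space d → ℂ) : ℂ :=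
  (∫ x, inner ℂ (weakGrad g x) (weakGrad f x)) -
    (α : ℂ) * ∫ x, trace Γ f x * conj (trace Γ g x) ∂(surfaceMeasure Γ)

/-- The graph of the operator `H` associated with the form: `u ∈ D(H)` and `H u = w`. -/
def IsHamiltonianValue {d : ℕ} (Γ : Set (Space d)) (α : ℝ) (u w : Space d → ℂ) : Prop :=
  MemW12 volume u ∧ MemLp w 2 volume ∧
    ∀ g, MemW12 volume g → singularForm Γ α u g = scalarProduct w g

/-- `u` is an eigenfunction of `H` with eigenvalue `E`. -/
def IsEigenfunction {d : ℕ} (Γ : Set (Space d)) (α : ℝ) (u : Space d → ℂ) (E : ℝ) : Prop :=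
  ¬ (u =ᵐ[volume] 0) ∧ IsHamiltonianValue Γ α u (fun x => (E : ℂ) * u x)

/-- The weighted measure `ψ₀² dx`. -/
noncomputable def weightedMeasure {d : ℕ} (ψ₀ : Space d → ℝ) : Measure (Space d) :=
  volume.withDensity (fun x => ENNReal.ofReal (ψ₀ x ^ 2))

end SingularSchrodinger

/-! Write `w` for the positive eigenfunction `ψ₀` and `E` for its eigenvalue. The result is the
ground state transformation. Let `f`, `g` be bounded with weak gradients `F`, `G` such that `w F`
and `w G` are in `L²`. Then `w f`, `w g` and `w (conj f * g)` lie in `W^{1,2}`, and the last is an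
admissible test function in the eigenvalue equation of `w`. Since `(w f) * conj (w g) = w * conj (w
(conj f * g))`, that equation has the same scalar product term and the same surface term as the form
of `w f` and `w g`. Subtracting leaves pointwise algebra of gradients; the cross terms cancel
because `∇w` is real, and `w² F · conj G` remains (`IsHamiltonianValue.form_mul_of_bounded`). The
surface terms agree because the integral over `Γ` of a product of traces depends only on the
product, an element of `W^{1,1}` (`integral_trace_mul_conj_congr`); this rests on the trace
inequality from `W^{1,1}` to `L¹(σ_Γ)`, proved in charts
(`IsCompactHypersurface.exists_lintegral_le`).

From the weighted space to `W^{1,2}`: an unbounded `ψ` is truncated smoothly. The `W^{1,1}`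
inequality applied to squares gives a trace inequality with an arbitrarily small gradient
coefficient, so the form controls `‖∇f‖²` up to a multiple of `‖f‖²`
(`exists_integral_weakGrad_sq_le`). With the identity for bounded functions this bounds the
gradients of `w * truncate n ψ` uniformly in `L²`; Fatou's lemma shows that `ψ ∇w` is in `L²`, and
then the truncations converge in `W^{1,2}` and the identity passes to the limit.

From `W^{1,2}` to the weighted space: `w⁻¹ u` must be locally integrable with a weak gradient, for
which `w` should be locally bounded below. The surface term has a favourable sign, so `-Δw + |E| w ≥
0` as a distribution. Weighted averages of such a supersolution over shrinking balls increase up to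
a factor and tend to a multiple of `w` almost everywhere, while the average at scale one is
continuous and positive (`IsSupersolution.exists_pos_le`). For a test function `u` the quotient `u /
w` is then bounded, and the identity bounds `‖w ∇(u / w)‖²` by `‖∇u‖² + |E| ‖u‖²`. Density of test
functions and Fatou's lemma give the general case (`IsHamiltonianValue.memLp_div`). -/

open scoped Convolution NNReal

namespace SingularSchrodinger

variable {d : ℕ} {F : Type} [NormedAddCommGroup F] [NormedSpace ℝ F]

/-! ### Mollification -/

/-- A sequence of bump functions whose supports shrink to the origin. -/
noncomputable def mollifier (d n : ℕ) : ContDiffBump (0 : Space d) where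
  rIn := 1 / ((n : ℝ) + 2)
  -- The ratio of the radii is 2 for every `n`; a bounded ratio is what convergence at Lebesgue
  -- points needs. The offset 2 keeps the outer radius at most one, even for `n = 0`.
  rOut := 2 / ((n : ℝ) + 2)
  rIn_pos := by positivity
  rIn_lt_rOut := by
    have : (0 : ℝ) < (n : ℝ) + 2 := by positivity
    gcongr
    norm_num

lemma mollifier_rOut_le_one (n : ℕ) : (mollifier d n).rOut ≤ 1 := by
  have : (0 : ℝ) < (n : ℝ) + 2 := by positivity
  change 2 / ((n : ℝ) + 2) ≤ 1
  rw [div_le_one this]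
  linarith [(Nat.cast_nonneg n : (0 : ℝ) ≤ n)]

lemma tendsto_mollifier_rOut : Tendsto (fun n => (mollifier d n).rOut) atTop (𝓝 0) := by
  change Tendsto (fun n : ℕ => 2 / ((n : ℝ) + 2)) atTop (𝓝 0)
  exact tendsto_const_nhds.div_atTop
    (tendsto_atTop_add_const_right _ _ tendsto_natCast_atTop_atTop)

/-- The convolution of `f` with the `n`-th mollifier. -/
noncomputable def mollify (n : ℕ) (f : Space d → F) : Space d → F :=
  (mollifier d n).normed volume ⋆[ContinuousLinearMap.lsmul ℝ ℝ, volume] f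

lemma mollify_apply (n : ℕ) (f : Space d → F) (x : Space d) :
    mollify n f x = ∫ y, (mollifier d n).normed volume (x - y) • f y := by
  simp [mollify, convolution_eq_swap]

lemma contDiff_mollify (n : ℕ) {f : Space d → F} (hf : LocallyIntegrable f volume) :
    ContDiff ℝ ∞ (mollify n f) :=
  (mollifier d n).hasCompactSupport_normed.contDiff_convolution_left _
    (mollifier d n).contDiff_normed hf

lemma ae_tendsto_mollify [CompleteSpace F] {f : Space d → F} (hf : LocallyIntegrable f volume) :
    ∀ᵐ x, Tendsto (fun n => mollify n f x) atTop (𝓝 (f x)) := by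
  refine ContDiffBump.ae_convolution_tendsto_right_of_locallyIntegrable (K := 2)
    tendsto_mollifier_rOut (Eventually.of_forall fun n => ?_) hf
  change 2 / ((n : ℝ) + 2) ≤ 2 * (1 / ((n : ℝ) + 2))
  rw [mul_one_div]

lemma hasCompactSupport_mollify (n : ℕ) {f : Space d → F} (hf : HasCompactSupport f) :
    HasCompactSupport (mollify n f) :=
  (mollifier d n).hasCompactSupport_normed.convolution _ hf

lemma contDiff_normed_sub (n : ℕ) (x : Space d) :
    ContDiff ℝ ∞ (fun y => (mollifier d n).normed volume (x - y)) :=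
  (mollifier d n).contDiff_normed.comp (contDiff_const.sub contDiff_id)

lemma hasCompactSupport_normed_sub (n : ℕ) (x : Space d) :
    HasCompactSupport (fun y => (mollifier d n).normed volume (x - y)) :=
  (mollifier d n).hasCompactSupport_normed.comp_homeomorph (Homeomorph.subLeft x)

lemma lintegral_enorm_normed (n : ℕ) :
    ∫⁻ y, ‖(mollifier d n).normed volume y‖ₑ = 1 := by
  have h := ofReal_integral_eq_lintegral_ofReal (μ := volume) (mollifier d n).integrable_normed
    (Eventually.of_forall fun x => (mollifier d n).nonneg_normed x)
  rw [(mollifier d n).integral_normed] at h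
  simp only [ENNReal.ofReal_one] at h
  rw [h]
  exact lintegral_congr fun x => Real.enorm_of_nonneg ((mollifier d n).nonneg_normed x)

lemma lintegral_enorm_normed_sub (n : ℕ) (x : Space d) :
    ∫⁻ y, ‖(mollifier d n).normed volume (x - y)‖ₑ = 1 := by
  rw [lintegral_sub_left_eq_self (fun y => ‖(mollifier d n).normed volume y‖ₑ) x]
  exact lintegral_enorm_normed n

/-- The kernels are supported in balls of radius at most one, so mollification is local. This
reduces locally integrable functions to integrable ones. -/
lemma mollify_congr (n : ℕ) {f g : Space d → F} {x : Space d}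
    (h : ∀ᵐ y, y ∈ Metric.ball x 1 → f y = g y) : mollify n f x = mollify n g x := by
  rw [mollify_apply, mollify_apply]
  refine integral_congr_ae ?_
  filter_upwards [h] with y hy
  by_cases hxy : y ∈ Metric.ball x 1
  · simp only [hy hxy]
  · have : (mollifier d n).normed volume (x - y) = 0 := by
      by_contra h0
      have h1 : x - y ∈ Function.support ((mollifier d n).normed volume) := h0
      rw [(mollifier d n).support_normed_eq] at h1
      apply hxy
      rw [Metric.mem_ball, dist_comm, dist_eq_norm]
      exact (mem_ball_zero_iff.1 h1).trans_le (mollifier_rOut_le_one n)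
    simp only [this, zero_smul]

lemma norm_mollify_le (n : ℕ) {f : Space d → F} {C : ℝ} (h : ∀ᵐ x, ‖f x‖ ≤ C) (x : Space d) :
    ‖mollify n f x‖ ≤ C := by
  rw [mollify_apply]
  have hint : Integrable (fun y => (mollifier d n).normed volume (x - y) * C) volume :=
    (((contDiff_normed_sub n x).continuous).integrable_of_hasCompactSupport
      (hasCompactSupport_normed_sub n x)).mul_const C
  calc ‖∫ y, (mollifier d n).normed volume (x - y) • f y‖
      ≤ ∫ y, (mollifier d n).normed volume (x - y) * C := by
        refine norm_integral_le_of_norm_le hint ?_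
        filter_upwards [h] with y hy
        rw [norm_smul, Real.norm_of_nonneg ((mollifier d n).nonneg_normed _)]
        exact mul_le_mul_of_nonneg_left hy ((mollifier d n).nonneg_normed _)
    _ = C := by
        rw [integral_mul_const,
          integral_sub_left_eq_self (fun y => (mollifier d n).normed volume y) volume x,
          (mollifier d n).integral_normed, one_mul]

/-- Jensen's inequality for the probability density `y ↦ φ (x - y)`, in extended reals so that the
right-hand side may be infinite. -/
lemma enorm_mollify_rpow_le (n : ℕ) {p : ℝ} (hp : 1 ≤ p) {f : Space d → F}
    (hf : AEStronglyMeasurable f volume) (x : Space d) :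
    ‖mollify n f x‖ₑ ^ p
      ≤ ∫⁻ y, ‖(mollifier d n).normed volume (x - y)‖ₑ * ‖f y‖ₑ ^ p := by
  have hp0 : 0 < p := lt_of_lt_of_le one_pos hp
  have hφm : AEMeasurable (fun y => ‖(mollifier d n).normed volume (x - y)‖ₑ) volume :=
    (contDiff_normed_sub n x).continuous.measurable.enorm.aemeasurable
  have h1 : ‖mollify n f x‖ₑ
      ≤ ∫⁻ y, ‖(mollifier d n).normed volume (x - y)‖ₑ * ‖f y‖ₑ := by
    rw [mollify_apply]
    refine (enorm_integral_le_lintegral_enorm _).trans (le_of_eq ?_)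
    exact lintegral_congr fun y => enorm_smul _ _
  -- Hölder's inequality for `φ ^ (1 - 1 / p) * (φ * ‖f‖ ^ p) ^ (1 / p)`; the first factor
  -- contributes only the total mass one of `φ`.
  have h2 := ENNReal.lintegral_mul_norm_pow_le (μ := volume) hφm
    (hφm.mul (hf.enorm.pow_const p)) (p := 1 - 1 / p) (q := 1 / p)
    (by rw [sub_nonneg, div_le_one hp0]; exact hp) (by positivity) (by ring)
  rw [lintegral_enorm_normed_sub, ENNReal.one_rpow, one_mul] at h2
  have h3 : ∫⁻ y, ‖(mollifier d n).normed volume (x - y)‖ₑ * ‖f y‖ₑ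
      ≤ (∫⁻ y, ‖(mollifier d n).normed volume (x - y)‖ₑ * ‖f y‖ₑ ^ p) ^ (1 / p) := by
    refine le_trans (le_of_eq (lintegral_congr fun y => ?_)) h2
    simp only [Pi.mul_apply]
    rw [ENNReal.mul_rpow_of_nonneg _ _ (by positivity), ← mul_assoc,
      ← ENNReal.rpow_add_of_nonneg _ _ (by rw [sub_nonneg, div_le_one hp0]; exact hp)
        (by positivity), ← ENNReal.rpow_mul, mul_one_div_cancel hp0.ne']
    simp
  calc ‖mollify n f x‖ₑ ^ p ≤ _ := ENNReal.rpow_le_rpow (h1.trans h3) hp0.le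
    _ = _ := by rw [← ENNReal.rpow_mul, one_div_mul_cancel hp0.ne', ENNReal.rpow_one]

lemma lintegral_lintegral_normed_mul (n : ℕ) {h : Space d → ℝ≥0∞} (hh : AEMeasurable h volume) :
    ∫⁻ x, ∫⁻ y, ‖(mollifier d n).normed volume (x - y)‖ₑ * h y = ∫⁻ y, h y := by
  rw [lintegral_lintegral_swap]
  · refine lintegral_congr fun y => ?_
    rw [lintegral_mul_const'' _ (by
      exact (((mollifier d n).contDiff_normed (n := 0)).continuous.comp
        (continuous_id.sub continuous_const)).measurable.enorm.aemeasurable),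
      lintegral_sub_right_eq_self (fun x => ‖(mollifier d n).normed volume x‖ₑ) y,
      lintegral_enorm_normed, one_mul]
  · refine AEMeasurable.mul ?_ (hh.comp_snd)
    exact (((mollifier d n).contDiff_normed (n := 0)).continuous.comp
        (continuous_fst.sub continuous_snd)).measurable.enorm.aemeasurable

/-- Fatou's lemma in the form of the generalized dominated convergence theorem. -/
lemma tendsto_lintegral_zero_of_le_of_tendsto {α : Type*} [MeasurableSpace α] {μ : Measure α}
    {a b : ℕ → α → ℝ≥0∞} {c : α → ℝ≥0∞} (ha : ∀ n, AEMeasurable (a n) μ)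
    (hb : ∀ n, AEMeasurable (b n) μ)
    (hab : ∀ n, ∀ᵐ x ∂μ, a n x ≤ b n x) (hint : ∀ n, ∫⁻ x, b n x ∂μ = ∫⁻ x, c x ∂μ)
    (hfin : ∫⁻ x, c x ∂μ ≠ ⊤)
    (ha0 : ∀ᵐ x ∂μ, Tendsto (fun n => a n x) atTop (𝓝 0))
    (hbc : ∀ᵐ x ∂μ, Tendsto (fun n => b n x) atTop (𝓝 (c x))) :
    Tendsto (fun n => ∫⁻ x, a n x ∂μ) atTop (𝓝 0) := by
  set S := ∫⁻ x, c x ∂μ with hS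
  have haS : ∀ n, ∫⁻ x, a n x ∂μ ≤ S := fun n =>
    (lintegral_mono_ae (hab n)).trans (hint n).le
  have hsub : ∀ n, ∫⁻ x, (b n x - a n x) ∂μ = S - ∫⁻ x, a n x ∂μ := fun n => by
    rw [lintegral_sub' (ha n) (ne_top_of_le_ne_top hfin (haS n)) (hab n), hint n]
  -- Fatou's lemma for `b n - a n`, whose pointwise limit is `c`. Truncated subtraction does no harm
  -- since `a n ≤ b n` and all integrals are at most `S < ⊤`.
  have hF : S ≤ liminf (fun n => S - ∫⁻ x, a n x ∂μ) atTop := by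
    have h1 := lintegral_liminf_le' (μ := μ) (u := atTop) (f := fun n x => b n x - a n x)
      (fun n => (hb n).sub (ha n))
    simp only [hsub] at h1
    refine le_trans (le_of_eq ?_) h1
    rw [hS]
    refine lintegral_congr_ae ?_
    filter_upwards [ha0, hbc] with x hx1 hx2
    have h2 := ENNReal.Tendsto.sub hx2 hx1 (Or.inr ENNReal.zero_ne_top)
    rw [tsub_zero] at h2
    exact h2.liminf_eq.symm
  rw [ENNReal.tendsto_atTop_zero]
  intro ε hε
  by_cases hS0 : S = 0
  · exact ⟨0, fun n _ => ((haS n).trans hS0.le).trans zero_le⟩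
  have h1 : S - ε < liminf (fun n => S - ∫⁻ x, a n x ∂μ) atTop :=
    (ENNReal.sub_lt_self hfin hS0 hε.ne').trans_le hF
  obtain ⟨N, hN⟩ := eventually_atTop.1 (eventually_lt_of_lt_liminf h1)
  refine ⟨N, fun n hn => ?_⟩
  by_contra hlt
  exact absurd (hN n hn) (not_lt.2 (tsub_le_tsub_left (not_le.1 hlt).le S))

/-- By Jensen, `‖mollify n f - f‖ ^ p` is at most `2 ^ (p - 1)` times the sum of the mollification
of `‖f‖ ^ p` and `‖f‖ ^ p`. This majorant varies with `n`, but its integral does not, and it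
converges almost everywhere because `‖f‖ ^ p` is integrable; so the generalized dominated
convergence theorem applies. -/
lemma tendsto_lintegral_enorm_mollify_sub [CompleteSpace F] {p : ℝ} (hp : 1 ≤ p)
    {f : Space d → F} (hloc : LocallyIntegrable f volume) (hfin : ∫⁻ x, ‖f x‖ₑ ^ p ≠ ⊤) :
    Tendsto (fun n => ∫⁻ x, ‖mollify n f x - f x‖ₑ ^ p) atTop (𝓝 0) := by
  have hp0 : 0 < p := lt_of_lt_of_le one_pos hp
  have hf := hloc.aestronglyMeasurable
  have hfp : AEMeasurable (fun x => ‖f x‖ₑ ^ p) volume := hf.enorm.pow_const p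
  have hmeas : ∀ n, AEStronglyMeasurable (mollify n f) volume := fun n =>
    (contDiff_mollify n hloc).continuous.aestronglyMeasurable
  set M : ℕ → Space d → ℝ≥0∞ := fun n x =>
    ∫⁻ y, ‖(mollifier d n).normed volume (x - y)‖ₑ * ‖f y‖ₑ ^ p with hM
  have hMm : ∀ n, AEMeasurable (M n) volume := fun n => by
    refine AEMeasurable.lintegral_prod_right'
      (f := fun z : Space d × Space d =>
        ‖(mollifier d n).normed volume (z.1 - z.2)‖ₑ * ‖f z.2‖ₑ ^ p) ?_
    refine AEMeasurable.mul ?_ (hfp.comp_snd)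
    exact (((mollifier d n).contDiff_normed (n := 0)).continuous.comp
        (continuous_fst.sub continuous_snd)).measurable.enorm.aemeasurable
  have hMint : ∀ n, ∫⁻ x, M n x = ∫⁻ x, ‖f x‖ₑ ^ p := fun n =>
    lintegral_lintegral_normed_mul n hfp
  have hrint : Integrable (fun x => ‖f x‖ ^ p) volume := by
    refine ⟨(hf.norm.aemeasurable.pow_const p).aestronglyMeasurable, ?_⟩
    rw [hasFiniteIntegral_iff_enorm]
    refine lt_of_le_of_lt (le_of_eq (lintegral_congr fun x => ?_)) (lt_top_iff_ne_top.2 hfin)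
    rw [Real.enorm_of_nonneg (by positivity), ← ENNReal.ofReal_rpow_of_nonneg (norm_nonneg _) hp0.le,
      ofReal_norm]
  have hMeq : ∀ n x, M n x = ENNReal.ofReal (mollify n (fun x => ‖f x‖ ^ p) x) := by
    intro n x
    rw [mollify_apply, ofReal_integral_eq_lintegral_ofReal]
    · refine lintegral_congr fun y => ?_
      rw [smul_eq_mul, ENNReal.ofReal_mul ((mollifier d n).nonneg_normed _),
        Real.enorm_of_nonneg ((mollifier d n).nonneg_normed _),
        ← ENNReal.ofReal_rpow_of_nonneg (norm_nonneg _) hp0.le, ofReal_norm]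
    · exact hrint.locallyIntegrable.integrable_smul_left_of_hasCompactSupport
        (contDiff_normed_sub n x).continuous (hasCompactSupport_normed_sub n x)
    · exact Eventually.of_forall fun y =>
        mul_nonneg ((mollifier d n).nonneg_normed _) (by positivity)
  have h2p : (2 : ℝ≥0∞) ^ (p - 1) ≠ ⊤ := ENNReal.rpow_ne_top_of_nonneg (by linarith) (by simp)
  have hsum : ∀ n, ∫⁻ x, (2 : ℝ≥0∞) ^ (p - 1) * (M n x + ‖f x‖ₑ ^ p)
      = ∫⁻ x, (2 : ℝ≥0∞) ^ (p - 1) * (‖f x‖ₑ ^ p + ‖f x‖ₑ ^ p) := by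
    intro n
    rw [lintegral_const_mul' _ _ h2p, lintegral_const_mul' _ _ h2p,
      lintegral_add_left' (hMm n), lintegral_add_left' hfp, hMint]
  refine tendsto_lintegral_zero_of_le_of_tendsto
    (b := fun n x => (2 : ℝ≥0∞) ^ (p - 1) * (M n x + ‖f x‖ₑ ^ p))
    (c := fun x => (2 : ℝ≥0∞) ^ (p - 1) * (‖f x‖ₑ ^ p + ‖f x‖ₑ ^ p)) (fun n => ?_) (fun n => ?_)
    (fun n => Eventually.of_forall fun x => ?_) hsum ?_ ?_ ?_
  · exact ((hmeas n).sub hf).enorm.pow_const p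
  · exact ((hMm n).add hfp).const_mul _
  · calc ‖mollify n f x - f x‖ₑ ^ p ≤ (‖mollify n f x‖ₑ + ‖f x‖ₑ) ^ p :=
          ENNReal.rpow_le_rpow (enorm_sub_le) hp0.le
      _ ≤ 2 ^ (p - 1) * (‖mollify n f x‖ₑ ^ p + ‖f x‖ₑ ^ p) :=
          ENNReal.rpow_add_le_mul_rpow_add_rpow _ _ hp
      _ ≤ _ := by gcongr; exact enorm_mollify_rpow_le n hp hf x
  · rw [lintegral_const_mul' _ _ h2p, lintegral_add_left' hfp]
    exact ENNReal.mul_ne_top h2p (ENNReal.add_ne_top.2 ⟨hfin, hfin⟩)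
  · filter_upwards [ae_tendsto_mollify hloc] with x hx
    have h1 : Tendsto (fun n => ‖mollify n f x - f x‖ₑ) atTop (𝓝 0) := by
      have := (hx.sub_const (f x)).enorm
      simpa using this
    have := h1.ennrpow_const p
    rwa [ENNReal.zero_rpow_of_pos hp0] at this
  · filter_upwards [ae_tendsto_mollify hrint.locallyIntegrable] with x hx
    refine ENNReal.Tendsto.const_mul (Tendsto.add ?_ tendsto_const_nhds) (Or.inr h2p)
    have := ENNReal.tendsto_ofReal hx
    rw [← ENNReal.ofReal_rpow_of_nonneg (norm_nonneg _) hp0.le, ofReal_norm] at this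
    simpa only [hMeq] using this

end SingularSchrodinger

namespace SingularSchrodinger

variable {d : ℕ} {F : Type} [NormedAddCommGroup F] [NormedSpace ℝ F]
  {F' : Type} [NormedAddCommGroup F'] [NormedSpace ℝ F']

/-! ### Convergence in `L¹_loc` -/

/-- Convergence in `L¹` of every ball around the origin. -/
def TendstoL1loc (f : ℕ → Space d → F) (f' : Space d → F) : Prop :=
  ∀ R : ℝ, Tendsto (fun n => ∫⁻ x in Metric.ball 0 R, ‖f n x - f' x‖ₑ) atTop (𝓝 0)

lemma TendstoL1loc.add {f g : ℕ → Space d → F} {f' g' : Space d → F}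
    (hf : TendstoL1loc f f') (hg : TendstoL1loc g g')
    (hfm : ∀ n, AEStronglyMeasurable (f n) volume) (hfm' : AEStronglyMeasurable f' volume) :
    TendstoL1loc (fun n x => f n x + g n x) (fun x => f' x + g' x) := by
  intro R
  have h := (hf R).add (hg R)
  rw [add_zero] at h
  refine tendsto_of_tendsto_of_tendsto_of_le_of_le tendsto_const_nhds h (fun _ => zero_le)
    (fun n => ?_)
  dsimp only
  rw [← lintegral_add_left' (f := fun x => ‖f n x - f' x‖ₑ) ((hfm n).sub hfm').enorm.restrict]
  refine lintegral_mono fun x => ?_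
  rw [add_sub_add_comm]
  exact enorm_add_le _ _

lemma TendstoL1loc.of_le {f : ℕ → Space d → F} {f' : Space d → F}
    {g : ℕ → Space d → F'} {g' : Space d → F'} (hg : TendstoL1loc g g') (C : ℝ)
    (hle : ∀ n, ∀ᵐ x, ‖f n x - f' x‖ ≤ C * ‖g n x - g' x‖) : TendstoL1loc f f' := by
  intro R
  have h := ENNReal.Tendsto.const_mul (a := ENNReal.ofReal C) (hg R) (Or.inr ENNReal.ofReal_ne_top)
  rw [mul_zero] at h
  refine tendsto_of_tendsto_of_tendsto_of_le_of_le tendsto_const_nhds h (fun _ => zero_le)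
    (fun n => ?_)
  dsimp only
  rw [← lintegral_const_mul' _ _ ENNReal.ofReal_ne_top]
  refine lintegral_mono_ae (ae_restrict_of_ae ?_)
  filter_upwards [hle n] with x hx
  rw [← ofReal_norm, ← ofReal_norm, ← ENNReal.ofReal_mul' (norm_nonneg _)]
  exact ENNReal.ofReal_le_ofReal hx

lemma _root_.MeasureTheory.LocallyIntegrable.norm {f : Space d → F}
    (hf : LocallyIntegrable f volume) : LocallyIntegrable (fun x => ‖f x‖) volume := fun x => by
  obtain ⟨U, hU, hint⟩ := hf x
  exact ⟨U, hU, hint.norm⟩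

lemma _root_.MeasureTheory.LocallyIntegrable.setLIntegral_ball_ne_top {f : Space d → F}
    (hf : LocallyIntegrable f volume) (R : ℝ) : ∫⁻ x in Metric.ball 0 R, ‖f x‖ₑ ≠ ⊤ := by
  have h : IntegrableOn f (Metric.ball 0 R) volume :=
    (hf.integrableOn_isCompact (isCompact_closedBall 0 R)).mono_set Metric.ball_subset_closedBall
  exact h.2.ne

lemma tendstoL1loc_of_dominated {f : ℕ → Space d → F} {f' : Space d → F} {b : Space d → ℝ}
    (hfm : ∀ n, AEStronglyMeasurable (f n) volume) (hfm' : AEStronglyMeasurable f' volume)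
    (hb : LocallyIntegrable b volume) (hle : ∀ n, ∀ᵐ x, ‖f n x - f' x‖ ≤ b x)
    (hlim : ∀ᵐ x, Tendsto (fun n => f n x) atTop (𝓝 (f' x))) : TendstoL1loc f f' := by
  intro R
  have h := tendsto_lintegral_of_dominated_convergence' (μ := volume.restrict (Metric.ball 0 R))
    (F := fun n x => ‖f n x - f' x‖ₑ) (f := fun _ => 0) (fun x => ‖b x‖ₑ)
    (fun n => ((hfm n).sub hfm').enorm.restrict) (fun n => ae_restrict_of_ae ?_)
    (hb.setLIntegral_ball_ne_top R) (ae_restrict_of_ae ?_)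
  · simpa using h
  · filter_upwards [hle n] with x hx
    rw [enorm_le_iff_norm_le]
    exact hx.trans (le_abs_self _)
  · filter_upwards [hlim] with x hx
    have := (hx.sub_const (f' x)).enorm
    simpa using this

/-- On `ball 0 R` the mollification sees only the values of `f` on `ball 0 (R + 1)`; the restriction
of `f` to that ball is integrable, and the global result with `p = 1` applies to it. -/
lemma tendstoL1loc_mollify [CompleteSpace F] {f : Space d → F} (hf : LocallyIntegrable f volume) :
    TendstoL1loc (fun n => mollify n f) f := by
  intro R
  have hball : MeasurableSet (Metric.ball (0 : Space d) (R + 1)) := measurableSet_ball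
  set g : Space d → F := (Metric.ball 0 (R + 1)).indicator f with hg
  have hgint : Integrable g volume := by
    rw [hg, integrable_indicator_iff hball]
    exact (hf.integrableOn_isCompact (isCompact_closedBall 0 (R + 1))).mono_set
      Metric.ball_subset_closedBall
  have hfin : ∫⁻ x, ‖g x‖ₑ ^ (1 : ℝ) ≠ ⊤ := by
    simpa using hgint.2.ne
  have h := tendsto_lintegral_enorm_mollify_sub le_rfl hgint.locallyIntegrable hfin
  simp only [ENNReal.rpow_one] at h
  refine tendsto_of_tendsto_of_tendsto_of_le_of_le tendsto_const_nhds h (fun _ => zero_le)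
    (fun n => ?_)
  refine le_trans (le_of_eq ?_) (setLIntegral_le_lintegral (Metric.ball 0 R) _)
  refine setLIntegral_congr_fun measurableSet_ball fun x hx => ?_
  have hx' : ‖x‖ < R := by simpa using hx
  have h1 : mollify n f x = mollify n g x := by
    refine mollify_congr n (Eventually.of_forall fun y hy => ?_)
    rw [hg, Set.indicator_of_mem]
    have h2 : ‖y - x‖ < 1 := by simpa [dist_eq_norm] using hy
    rw [mem_ball_zero_iff]
    calc ‖y‖ = ‖x + (y - x)‖ := by congr 1; abel
      _ ≤ ‖x‖ + ‖y - x‖ := norm_add_le _ _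
      _ < R + 1 := add_lt_add hx' h2
  have h2 : f x = g x := by
    rw [hg, Set.indicator_of_mem]
    rw [mem_ball_zero_iff]; linarith
  simp only [h1, h2]

/-! ### Weak directional derivatives -/

/-- `g` is the weak derivative of `f` in the direction `v`. -/
structure HasWeakDeriv (v : Space d) (f g : Space d → F) : Prop where
  locallyIntegrable : LocallyIntegrable f volume
  locallyIntegrable_deriv : LocallyIntegrable g volume
  integral_eq : ∀ η : Space d → ℝ, ContDiff ℝ ∞ η → HasCompactSupport η →
    ∫ x, fderiv ℝ η x v • f x = - ∫ x, η x • g x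

lemma contDiff_fderiv_apply {f : Space d → F} (hf : ContDiff ℝ ∞ f) (v : Space d) :
    ContDiff ℝ ∞ (fun x => fderiv ℝ f x v) :=
  (hf.fderiv_right (m := ∞) (by simp)).clm_apply contDiff_const

lemma hasCompactSupport_fderiv_apply {f : Space d → F} (hf : HasCompactSupport f) (v : Space d) :
    HasCompactSupport (fun x => fderiv ℝ f x v) :=
  (hf.fderiv ℝ).comp_left (g := fun L : Space d →L[ℝ] F => L v) rfl

lemma continuous_fderiv_apply {f : Space d → F} (hf : ContDiff ℝ 1 f) (v : Space d) :
    Continuous (fun x => fderiv ℝ f x v) :=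
  (hf.continuous_fderiv (by simp)).clm_apply continuous_const

lemma _root_.ContDiff.hasWeakDeriv {f : Space d → F} (hf : ContDiff ℝ 1 f) (v : Space d) :
    HasWeakDeriv v f (fun x => fderiv ℝ f x v) where
  locallyIntegrable := hf.continuous.locallyIntegrable
  locallyIntegrable_deriv := (continuous_fderiv_apply hf v).locallyIntegrable
  integral_eq η hη hηc := by
    have h1 := hf.continuous.locallyIntegrable (μ := volume)
    have h2 := (continuous_fderiv_apply hf v).locallyIntegrable (μ := volume)
    rw [integral_smul_fderiv_eq_neg_fderiv_smul_of_integrable, neg_neg]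
    · exact h1.integrable_smul_left_of_hasCompactSupport
        (contDiff_fderiv_apply hη v).continuous (hasCompactSupport_fderiv_apply hηc v)
    · exact h2.integrable_smul_left_of_hasCompactSupport hη.continuous hηc
    · exact h1.integrable_smul_left_of_hasCompactSupport hη.continuous hηc
    · exact fun x _ => hη.differentiable (by simp) x
    · exact fun x _ => hf.differentiable (by simp) x

namespace HasWeakDeriv

variable {v : Space d} {f g : Space d → F}

lemma congr (h : HasWeakDeriv v f g) {f₁ g₁ : Space d → F} (hf : f =ᵐ[volume] f₁)
    (hg : g =ᵐ[volume] g₁) : HasWeakDeriv v f₁ g₁ where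
  locallyIntegrable := h.locallyIntegrable.congr hf
  locallyIntegrable_deriv := h.locallyIntegrable_deriv.congr hg
  integral_eq η hη hηc := by
    have h1 := h.integral_eq η hη hηc
    rw [integral_congr_ae (g := fun x => fderiv ℝ η x v • f₁ x)
        (by filter_upwards [hf] with x hx; rw [hx]),
      integral_congr_ae (f := fun x => η x • g x) (g := fun x => η x • g₁ x)
        (by filter_upwards [hg] with x hx; rw [hx])] at h1
    exact h1

lemma unique [CompleteSpace F] {g₁ : Space d → F} (h : HasWeakDeriv v f g)
    (h₁ : HasWeakDeriv v f g₁) : g =ᵐ[volume] g₁ := by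
  refine ae_eq_of_integral_contDiff_smul_eq h.locallyIntegrable_deriv h₁.locallyIntegrable_deriv
    fun η hη hηc => ?_
  have := (h.integral_eq η hη hηc).symm.trans (h₁.integral_eq η hη hηc)
  exact neg_injective this

lemma clm_comp [CompleteSpace F] [CompleteSpace F'] (h : HasWeakDeriv v f g) (L : F →L[ℝ] F') :
    HasWeakDeriv v (fun x => L (f x)) (fun x => L (g x)) where
  locallyIntegrable := fun x => by
    obtain ⟨U, hU, hint⟩ := h.locallyIntegrable x
    exact ⟨U, hU, L.integrable_comp hint⟩
  locallyIntegrable_deriv := fun x => by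
    obtain ⟨U, hU, hint⟩ := h.locallyIntegrable_deriv x
    exact ⟨U, hU, L.integrable_comp hint⟩
  integral_eq η hη hηc := by
    simp only [← map_smul]
    rw [L.integral_comp_comm (h.locallyIntegrable.integrable_smul_left_of_hasCompactSupport
        (contDiff_fderiv_apply hη v).continuous (hasCompactSupport_fderiv_apply hηc v)),
      L.integral_comp_comm (h.locallyIntegrable_deriv.integrable_smul_left_of_hasCompactSupport
        hη.continuous hηc), h.integral_eq η hη hηc, map_neg]

lemma add {f₁ g₁ : Space d → F} (h : HasWeakDeriv v f g) (h₁ : HasWeakDeriv v f₁ g₁) :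
    HasWeakDeriv v (fun x => f x + f₁ x) (fun x => g x + g₁ x) where
  locallyIntegrable := h.locallyIntegrable.add h₁.locallyIntegrable
  locallyIntegrable_deriv := h.locallyIntegrable_deriv.add h₁.locallyIntegrable_deriv
  integral_eq η hη hηc := by
    have hη1 := (contDiff_fderiv_apply hη v).continuous
    have hη2 := hasCompactSupport_fderiv_apply hηc v
    simp only [smul_add]
    rw [integral_add, integral_add, h.integral_eq η hη hηc, h₁.integral_eq η hη hηc, neg_add]
    · exact h.locallyIntegrable_deriv.integrable_smul_left_of_hasCompactSupport hη.continuous hηc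
    · exact h₁.locallyIntegrable_deriv.integrable_smul_left_of_hasCompactSupport hη.continuous hηc
    · exact h.locallyIntegrable.integrable_smul_left_of_hasCompactSupport hη1 hη2
    · exact h₁.locallyIntegrable.integrable_smul_left_of_hasCompactSupport hη1 hη2

/-- The derivative falls on the kernel, and `y ↦ φ (x - y)` is an admissible test function. Its
derivative in `y` carries a sign that cancels the one in the definition of the weak derivative. -/
lemma fderiv_mollify (h : HasWeakDeriv v f g) (n : ℕ) (x : Space d) :
    fderiv ℝ (mollify n f) x v = mollify n g x := by
  have hη := contDiff_normed_sub n x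
  have hηc := hasCompactSupport_normed_sub n x
  have h1 := (mollifier d n).hasCompactSupport_normed (μ := volume).hasFDerivAt_convolution_left
    (ContinuousLinearMap.lsmul ℝ ℝ) ((mollifier d n).contDiff_normed (n := 1))
    h.locallyIntegrable x
  have h1' : fderiv ℝ (mollify n f) x = _ := h1.fderiv
  rw [h1', convolution_eq_swap, mollify_apply, ← neg_neg (∫ y, _ • g y),
    ← h.integral_eq _ hη hηc, ContinuousLinearMap.integral_apply, ← integral_neg]
  · refine integral_congr_ae (Eventually.of_forall fun y => ?_)
    have h2 : fderiv ℝ (fun y => (mollifier d n).normed volume (x - y)) y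
        = -(fderiv ℝ ((mollifier d n).normed volume) (x - y)) := by
      have h3 := ((mollifier d n).contDiff_normed (n := 1) (μ := volume)).differentiable (by simp)
        (x - y)
      have h4 : HasFDerivAt (fun y => (mollifier d n).normed volume (x - y))
          ((fderiv ℝ ((mollifier d n).normed volume) (x - y)).comp
            (0 - ContinuousLinearMap.id ℝ (Space d))) y :=
        h3.hasFDerivAt.comp y ((hasFDerivAt_const x y).sub (hasFDerivAt_id y))
      rw [h4.fderiv]
      ext; simp
    simp [h2]
  · have h7 := (mollifier d n).hasCompactSupport_normed.fderiv ℝ |>.convolutionExists_left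
      ((ContinuousLinearMap.lsmul ℝ ℝ).precompL (Space d))
      (((mollifier d n).contDiff_normed (n := 1) (μ := volume)).continuous_fderiv (by simp))
      h.locallyIntegrable x
    exact h7.integrable_swap

/-- Weak differentiability is stable under convergence in `L¹_loc` of functions and derivatives. -/
lemma of_tendsto {fn gn : ℕ → Space d → F} (h : ∀ n, HasWeakDeriv v (fn n) (gn n))
    (hf : LocallyIntegrable f volume) (hg : LocallyIntegrable g volume)
    (hfn : TendstoL1loc fn f) (hgn : TendstoL1loc gn g) : HasWeakDeriv v f g where
  locallyIntegrable := hf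
  locallyIntegrable_deriv := hg
  integral_eq η hη hηc := by
    have key : ∀ (ζ : Space d → ℝ), Continuous ζ → HasCompactSupport ζ →
        ∀ (un : ℕ → Space d → F) (u : Space d → F), (∀ n, LocallyIntegrable (un n) volume) →
        LocallyIntegrable u volume → TendstoL1loc un u →
        Tendsto (fun n => ∫ x, ζ x • un n x) atTop (𝓝 (∫ x, ζ x • u x)) := by
      intro ζ hζ hζc un u hun hu hlim
      obtain ⟨C, hC⟩ := hζc.exists_bound_of_continuous hζ
      obtain ⟨R, hR⟩ := hζc.isCompact.isBounded.subset_ball (0 : Space d)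
      refine tendsto_integral_of_L1 _
        (hu.integrable_smul_left_of_hasCompactSupport hζ hζc).aestronglyMeasurable
        (Eventually.of_forall fun n =>
          (hun n).integrable_smul_left_of_hasCompactSupport hζ hζc) ?_
      have h := ENNReal.Tendsto.const_mul (a := ENNReal.ofReal C) (hlim R)
        (Or.inr ENNReal.ofReal_ne_top)
      rw [mul_zero] at h
      refine tendsto_of_tendsto_of_tendsto_of_le_of_le tendsto_const_nhds h (fun _ => zero_le)
        (fun n => ?_)
      dsimp only
      rw [← lintegral_const_mul' _ _ ENNReal.ofReal_ne_top, ← lintegral_indicator measurableSet_ball]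
      refine lintegral_mono fun x => ?_
      rw [← smul_sub, enorm_smul]
      by_cases hx : x ∈ Metric.ball 0 R
      · rw [Set.indicator_of_mem hx]
        gcongr
        rw [← ofReal_norm]
        exact ENNReal.ofReal_le_ofReal (hC x)
      · have : ζ x = 0 := by
          by_contra h0
          exact hx (hR (subset_tsupport _ h0))
        simp [this]
    have h1 := key _ (contDiff_fderiv_apply hη v).continuous (hasCompactSupport_fderiv_apply hηc v)
      fn f (fun n => (h n).locallyIntegrable) hf hfn
    have h2 := key η hη.continuous hηc gn g (fun n => (h n).locallyIntegrable_deriv) hg hgn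
    have h3 : ∀ n, ∫ x, fderiv ℝ η x v • fn n x = - ∫ x, η x • gn n x :=
      fun n => (h n).integral_eq η hη hηc
    simp only [h3] at h1
    exact tendsto_nhds_unique h1 h2.neg

/-- Chain rule for `C¹` functions with bounded derivative. -/
lemma comp [CompleteSpace F] [CompleteSpace F'] (h : HasWeakDeriv v f g) {Φ : F → F'}
    (hΦ : ContDiff ℝ 1 Φ) {C : ℝ} (hC : ∀ z, ‖fderiv ℝ Φ z‖ ≤ C) :
    HasWeakDeriv v (fun x => Φ (f x)) (fun x => fderiv ℝ Φ (f x) (g x)) := by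
  have hC0 : 0 ≤ C := (norm_nonneg _).trans (hC 0)
  have hfm := h.locallyIntegrable.aestronglyMeasurable
  have hgm := h.locallyIntegrable_deriv.aestronglyMeasurable
  have hlip : ∀ a b, ‖Φ a - Φ b‖ ≤ C * ‖a - b‖ := fun a b =>
    convex_univ.norm_image_sub_le_of_norm_fderiv_le (𝕜 := ℝ)
      (fun x _ => hΦ.differentiable (by simp) x) (fun x _ => hC x) (Set.mem_univ b) (Set.mem_univ a)
  have hDc : Continuous (fderiv ℝ Φ) := hΦ.continuous_fderiv (by simp)
  have hDm : ∀ {u : Space d → F} {w : Space d → F}, AEStronglyMeasurable u volume →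
      AEStronglyMeasurable w volume →
      AEStronglyMeasurable (fun x => fderiv ℝ Φ (u x) (w x)) volume := fun hu hw =>
    ((ContinuousLinearMap.id ℝ (F →L[ℝ] F')).aestronglyMeasurable_comp₂
      (hDc.comp_aestronglyMeasurable hu) hw)
  have hm : ∀ n, ContDiff ℝ ∞ (mollify n f) := fun n => contDiff_mollify n h.locallyIntegrable
  have hmg : ∀ n, Continuous (mollify n g) := fun n =>
    (contDiff_mollify n h.locallyIntegrable_deriv).continuous
  have hloc1 : LocallyIntegrable (fun x => Φ (f x)) volume := by
    have h1 : LocallyIntegrable (fun x => ‖Φ 0‖ + C * ‖f x‖) volume :=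
      (locallyIntegrable_const _).add (h.locallyIntegrable.norm.smul C)
    refine h1.mono (hΦ.continuous.comp_aestronglyMeasurable hfm) (Eventually.of_forall fun x => ?_)
    refine le_trans ?_ (le_abs_self _)
    have := hlip (f x) 0
    rw [sub_zero] at this
    calc ‖Φ (f x)‖ = ‖Φ 0 + (Φ (f x) - Φ 0)‖ := by congr 1; abel
      _ ≤ _ := (norm_add_le _ _).trans (by gcongr)
  have hle : ∀ (u w : F), ‖fderiv ℝ Φ u w‖ ≤ C * ‖w‖ := fun u w =>
    (fderiv ℝ Φ u).le_of_opNorm_le (hC u) w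
  have hloc2 : LocallyIntegrable (fun x => fderiv ℝ Φ (f x) (g x)) volume := by
    refine (h.locallyIntegrable_deriv.norm.smul C).mono (hDm hfm hgm)
      (Eventually.of_forall fun x => ?_)
    exact (hle _ _).trans (le_abs_self _)
  refine of_tendsto (fn := fun n x => Φ (mollify n f x))
    (gn := fun n x => fderiv ℝ Φ (mollify n f x) (mollify n g x)) (fun n => ?_) hloc1 hloc2 ?_ ?_
  · have h1 : ContDiff ℝ 1 (fun x => Φ (mollify n f x)) :=
      hΦ.comp ((hm n).of_le (by exact_mod_cast le_top))
    convert h1.hasWeakDeriv v using 2 with x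
    have h2 : HasFDerivAt (fun x => Φ (mollify n f x)) _ x :=
      (hΦ.differentiable (by simp) (mollify n f x)).hasFDerivAt.comp x
        ((hm n).differentiable (by simp) x).hasFDerivAt
    rw [h2.fderiv, ContinuousLinearMap.comp_apply, h.fderiv_mollify]
  · exact (tendstoL1loc_mollify h.locallyIntegrable).of_le C
      (fun n => Eventually.of_forall fun x => hlip _ _)
  -- The derivative is split as `DΦ(fₙ)(gₙ - g) + DΦ(fₙ) g`. The first term is small because `DΦ` is
  -- bounded; the second converges by domination, since `fₙ → f` almost everywhere and `DΦ` is
  -- continuous.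
  · have h1 : TendstoL1loc (fun n x => fderiv ℝ Φ (mollify n f x) (mollify n g x - g x))
        (fun _ => (0 : F')) :=
      (tendstoL1loc_mollify h.locallyIntegrable_deriv).of_le C (fun n =>
        Eventually.of_forall fun x => by rw [sub_zero]; exact hle _ _)
    have h2 : TendstoL1loc (fun n x => fderiv ℝ Φ (mollify n f x) (g x))
        (fun x => fderiv ℝ Φ (f x) (g x)) := by
      refine tendstoL1loc_of_dominated (b := fun x => (2 * C) * ‖g x‖)
        (fun n => hDm (hm n).continuous.aestronglyMeasurable hgm) (hDm hfm hgm)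
        (h.locallyIntegrable_deriv.norm.smul (2 * C)) (fun n => Eventually.of_forall fun x => ?_) ?_
      · calc _ ≤ C * ‖g x‖ + C * ‖g x‖ := (norm_sub_le _ _).trans (add_le_add (hle _ _) (hle _ _))
          _ = _ := by ring
      · filter_upwards [ae_tendsto_mollify h.locallyIntegrable] with x hx
        exact ((hDc.clm_apply continuous_const).tendsto (f x)).comp hx
    have h3 := h1.add h2 (fun n => hDm (hm n).continuous.aestronglyMeasurable
      ((hmg n).aestronglyMeasurable.sub hgm)) aestronglyMeasurable_const
    simpa using h3

/-- Mollification preserves the bound `C`. A factor converging in `L¹_loc` times a factor that is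
bounded and converges almost everywhere converges in `L¹_loc`, so the classical product rule for the
mollified functions passes to the limit. -/
lemma mul_of_bounded {f g f' g' : Space d → ℂ} (hf : HasWeakDeriv v f f')
    (hg : HasWeakDeriv v g g') {C : ℝ} (hfC : ∀ᵐ x, ‖f x‖ ≤ C) (hgC : ∀ᵐ x, ‖g x‖ ≤ C) :
    HasWeakDeriv v (fun x => f x * g x) (fun x => f' x * g x + f x * g' x) := by
  have hfm := hf.locallyIntegrable.aestronglyMeasurable
  have hgm := hg.locallyIntegrable.aestronglyMeasurable
  have hfm' := hf.locallyIntegrable_deriv.aestronglyMeasurable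
  have hgm' := hg.locallyIntegrable_deriv.aestronglyMeasurable
  have hmf : ∀ n, ContDiff ℝ ∞ (mollify n f) := fun n => contDiff_mollify n hf.locallyIntegrable
  have hmg : ∀ n, ContDiff ℝ ∞ (mollify n g) := fun n => contDiff_mollify n hg.locallyIntegrable
  have hmf' : ∀ n, Continuous (mollify n f') := fun n =>
    (contDiff_mollify n hf.locallyIntegrable_deriv).continuous
  have hmg' : ∀ n, Continuous (mollify n g') := fun n =>
    (contDiff_mollify n hg.locallyIntegrable_deriv).continuous
  have hmul : ∀ {a b : Space d → ℂ}, LocallyIntegrable a volume →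
      AEStronglyMeasurable b volume → (∀ᵐ x, ‖b x‖ ≤ C) →
      LocallyIntegrable (fun x => a x * b x) volume := by
    intro a b ha hb hbC
    refine (ha.norm.smul C).mono (ha.aestronglyMeasurable.mul hb) ?_
    filter_upwards [hbC] with x hx
    rw [norm_mul, mul_comm]
    exact (mul_le_mul_of_nonneg_right hx (norm_nonneg _)).trans (le_abs_self _)
  have main : ∀ {a' b : Space d → ℂ}, LocallyIntegrable a' volume → LocallyIntegrable b volume →
      (∀ᵐ x, ‖b x‖ ≤ C) →
      TendstoL1loc (fun n x => mollify n a' x * mollify n b x) (fun x => a' x * b x) := by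
    intro a' b ha hb hbC
    have hcb : ∀ n, Continuous (mollify n b) := fun n => (contDiff_mollify n hb).continuous
    have hca : ∀ n, Continuous (mollify n a') := fun n => (contDiff_mollify n ha).continuous
    have h1 : TendstoL1loc (fun n x => (mollify n a' x - a' x) * mollify n b x)
        (fun _ => (0 : ℂ)) :=
      (tendstoL1loc_mollify ha).of_le C (fun n => Eventually.of_forall fun x => by
        rw [sub_zero, norm_mul, mul_comm]
        exact mul_le_mul_of_nonneg_right (norm_mollify_le n hbC x) (norm_nonneg _))
    have h2 : TendstoL1loc (fun n x => a' x * mollify n b x) (fun x => a' x * b x) := by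
      refine tendstoL1loc_of_dominated (b := fun x => (2 * C) * ‖a' x‖)
        (fun n => ha.aestronglyMeasurable.mul (hcb n).aestronglyMeasurable)
        (ha.aestronglyMeasurable.mul hb.aestronglyMeasurable)
        (ha.norm.smul (2 * C)) (fun n => ?_) ?_
      · filter_upwards [hbC] with x hx
        rw [← mul_sub, norm_mul, mul_comm]
        refine mul_le_mul_of_nonneg_right ?_ (norm_nonneg _)
        calc _ ≤ C + C := (norm_sub_le _ _).trans (add_le_add (norm_mollify_le n hbC x) hx)
          _ = _ := by ring
      · filter_upwards [ae_tendsto_mollify hb] with x hx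
        exact hx.const_mul _
    have h3 := h1.add h2 (fun n => ((hca n).aestronglyMeasurable.sub ha.aestronglyMeasurable).mul
      (hcb n).aestronglyMeasurable) aestronglyMeasurable_const
    simpa [sub_mul] using h3
  have hl1 := hmul hf.locallyIntegrable_deriv hgm hgC
  have hl2 := hmul hg.locallyIntegrable_deriv hfm hfC
  have hl2' : LocallyIntegrable (fun x => f x * g' x) volume := by
    simpa only [mul_comm] using hl2
  refine of_tendsto (fn := fun n x => mollify n f x * mollify n g x)
    (gn := fun n x => mollify n f' x * mollify n g x + mollify n f x * mollify n g' x)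
    (fun n => ?_) (hmul hf.locallyIntegrable hgm hgC) (hl1.add hl2') ?_ ?_
  · have h1 : ContDiff ℝ 1 (fun x => mollify n f x * mollify n g x) :=
      ((hmf n).mul (hmg n)).of_le (by exact_mod_cast le_top)
    convert h1.hasWeakDeriv v using 2 with x
    have h2 := ((hmf n).differentiable (by simp) x).hasFDerivAt.mul
      ((hmg n).differentiable (by simp) x).hasFDerivAt
    have h3 : fderiv ℝ (fun x => mollify n f x * mollify n g x) x = _ := h2.fderiv
    rw [h3]
    simp [hf.fderiv_mollify, hg.fderiv_mollify]
    ring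
  · exact main hf.locallyIntegrable hg.locallyIntegrable hgC
  · refine (main hf.locallyIntegrable_deriv hg.locallyIntegrable hgC).add ?_
      (fun n => ((hmf' n).mul (hmg n).continuous).aestronglyMeasurable) hl1.aestronglyMeasurable
    have := main hg.locallyIntegrable_deriv hf.locallyIntegrable hfC
    simpa only [mul_comm] using this

end HasWeakDeriv

/-! ### Smooth truncation of complex numbers -/

/-- A bump function on `ℂ`, equal to one on the unit ball. -/
noncomputable def complexBump : ContDiffBump (0 : ℂ) := ⟨1, 2, one_pos, one_lt_two⟩

/-- A smooth truncation which is the identity on the ball of radius `n + 1`. -/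
noncomputable def truncate (n : ℕ) (z : ℂ) : ℂ := complexBump (((n : ℝ) + 1)⁻¹ • z) • z

lemma contDiff_truncate (n : ℕ) : ContDiff ℝ ∞ (truncate n) :=
  (complexBump.contDiff.comp (contDiff_id.const_smul (((n : ℝ) + 1)⁻¹))).smul contDiff_id

lemma norm_truncate_le (n : ℕ) (z : ℂ) : ‖truncate n z‖ ≤ ‖z‖ := by
  rw [truncate, norm_smul, Real.norm_of_nonneg complexBump.nonneg]
  exact mul_le_of_le_one_left (norm_nonneg _) complexBump.le_one

lemma norm_truncate_le_const (n : ℕ) (z : ℂ) : ‖truncate n z‖ ≤ 2 * ((n : ℝ) + 1) := by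
  have hn : (0 : ℝ) < (n : ℝ) + 1 := by positivity
  by_cases hz : ‖z‖ ≤ 2 * ((n : ℝ) + 1)
  · exact (norm_truncate_le n z).trans hz
  · have : complexBump (((n : ℝ) + 1)⁻¹ • z) = 0 := by
      apply complexBump.zero_of_le_dist
      rw [dist_zero_right, norm_smul, norm_inv, Real.norm_of_nonneg hn.le, inv_mul_eq_div,
        le_div_iff₀ hn]
      exact (not_le.1 hz).le
    rw [truncate, this, zero_smul, norm_zero]
    positivity

/-- All truncations are rescalings, `truncate n z = (n + 1) • truncate 0 ((n + 1)⁻¹ • z)`, and the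
two factors cancel in the derivative. Hence one bound for `n = 0` serves every `n`. -/
lemma fderiv_truncate (n : ℕ) (z : ℂ) :
    fderiv ℝ (truncate n) z = fderiv ℝ (truncate 0) (((n : ℝ) + 1)⁻¹ • z) := by
  have hn : ((n : ℝ) + 1) ≠ 0 := by positivity
  have h0 : truncate n = fun z => ((n : ℝ) + 1) • truncate 0 (((n : ℝ) + 1)⁻¹ • z) := by
    ext w
    simp only [truncate, Nat.cast_zero, zero_add, inv_one, one_smul]
    rw [smul_comm, smul_inv_smul₀ hn]
  have h1 : HasFDerivAt (truncate n) (((n : ℝ) + 1) • (fderiv ℝ (truncate 0)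
      (((n : ℝ) + 1)⁻¹ • z)).comp (((n : ℝ) + 1)⁻¹ • ContinuousLinearMap.id ℝ ℂ)) z := by
    rw [h0]
    have h2 := ((contDiff_truncate 0).differentiable (by simp) (((n : ℝ) + 1)⁻¹ • z)).hasFDerivAt
    exact (h2.comp z ((hasFDerivAt_id (𝕜 := ℝ) z).const_smul (((n : ℝ) + 1)⁻¹))).const_smul
      ((n : ℝ) + 1)
  rw [h1.fderiv]
  ext w
  simp only [smul_apply, ContinuousLinearMap.comp_apply,
    ContinuousLinearMap.id_apply, map_smul]
  rw [smul_inv_smul₀ hn]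

lemma exists_norm_fderiv_truncate_le :
    ∃ C : ℝ, 0 ≤ C ∧ ∀ n z, ‖fderiv ℝ (truncate n) z‖ ≤ C := by
  have hc : HasCompactSupport (truncate 0) := by
    have : truncate 0 = fun z => complexBump z • z := by
      ext z; simp [truncate]
    rw [this]
    exact complexBump.hasCompactSupport.smul_right
  obtain ⟨C, hC⟩ := (hc.fderiv ℝ).exists_bound_of_continuous
    ((contDiff_truncate 0).continuous_fderiv (by simp))
  exact ⟨C, (norm_nonneg _).trans (hC 0), fun n z => by rw [fderiv_truncate]; exact hC _⟩

lemma eventually_inv_smul_mem_ball (z : ℂ) :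
    ∀ᶠ n : ℕ in atTop, ((n : ℝ) + 1)⁻¹ • z ∈ Metric.ball (0 : ℂ) 1 := by
  have h : Tendsto (fun n : ℕ => ((n : ℝ) + 1)⁻¹ • z) atTop (𝓝 ((0 : ℝ) • z)) :=
    (tendsto_inv_atTop_zero.comp
      (tendsto_atTop_add_const_right _ 1 tendsto_natCast_atTop_atTop)).smul_const z
  rw [zero_smul] at h
  exact h (Metric.ball_mem_nhds _ one_pos)

lemma eventually_truncate_eq (z : ℂ) : ∀ᶠ n : ℕ in atTop, truncate n z = z := by
  filter_upwards [eventually_inv_smul_mem_ball z] with n hn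
  rw [truncate, complexBump.one_of_mem_closedBall (Metric.ball_subset_closedBall hn), one_smul]

lemma eventually_fderiv_truncate_eq (z : ℂ) :
    ∀ᶠ n : ℕ in atTop, fderiv ℝ (truncate n) z = ContinuousLinearMap.id ℝ ℂ := by
  filter_upwards [eventually_inv_smul_mem_ball z] with n hn
  rw [fderiv_truncate]
  have : truncate 0 =ᶠ[𝓝 (((n : ℝ) + 1)⁻¹ • z)] id := by
    filter_upwards [Metric.isOpen_ball.mem_nhds hn] with w hw
    have h1 := complexBump.one_of_mem_closedBall (Metric.ball_subset_closedBall hw)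
    simp [truncate, h1]
  rw [this.fderiv_eq, fderiv_id]

lemma HasWeakDeriv.comp_truncate {v : Space d} {f g : Space d → ℂ} (h : HasWeakDeriv v f g) (n : ℕ) :
    HasWeakDeriv v (fun x => truncate n (f x)) (fun x => fderiv ℝ (truncate n) (f x) (g x)) := by
  obtain ⟨C, -, hC⟩ := exists_norm_fderiv_truncate_le
  exact h.comp ((contDiff_truncate n).of_le (by exact_mod_cast le_top)) (hC n)

/-- Product rule: it suffices that all the products involved are locally integrable. -/
lemma HasWeakDeriv.mul {v : Space d} {f g f' g' : Space d → ℂ} (hf : HasWeakDeriv v f f')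
    (hg : HasWeakDeriv v g g') (h0 : LocallyIntegrable (fun x => f x * g x) volume)
    (h1 : LocallyIntegrable (fun x => f' x * g x) volume)
    (h2 : LocallyIntegrable (fun x => f x * g' x) volume) :
    HasWeakDeriv v (fun x => f x * g x) (fun x => f' x * g x + f x * g' x) := by
  obtain ⟨C, hC0, hC⟩ := exists_norm_fderiv_truncate_le
  have hT : ∀ n, HasWeakDeriv v (fun x => truncate n (f x) *
      truncate n (g x)) _ := fun n =>
    (hf.comp_truncate n).mul_of_bounded (hg.comp_truncate n) (C := 2 * ((n : ℝ) + 1))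
      (Eventually.of_forall fun x => norm_truncate_le_const n _)
      (Eventually.of_forall fun x => norm_truncate_le_const n _)
  have hle : ∀ n (z w : ℂ), ‖fderiv ℝ (truncate n) z w‖ ≤ C * ‖w‖ :=
    fun n z w => ContinuousLinearMap.le_of_opNorm_le _ (hC n z) w
  have hlim : ∀ z : ℂ, Tendsto (fun n => truncate n z) atTop (𝓝 z) := fun z =>
    tendsto_const_nhds.congr' ((eventually_truncate_eq z).mono fun n hn => hn.symm)
  have hlim' : ∀ z w : ℂ, Tendsto (fun n => fderiv ℝ (truncate n) z w) atTop
      (𝓝 w) := fun z w =>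
    tendsto_const_nhds.congr' ((eventually_fderiv_truncate_eq z).mono fun n hn => by
      simp only [hn]; rfl)
  refine HasWeakDeriv.of_tendsto hT h0 (h1.add h2) ?_ ?_
  · refine tendstoL1loc_of_dominated (b := fun x => (2 : ℝ) * ‖f x * g x‖)
      (fun n => (hT n).locallyIntegrable.aestronglyMeasurable) h0.aestronglyMeasurable
      (h0.norm.smul (2 : ℝ)) (fun n => Eventually.of_forall fun x => ?_)
      (Eventually.of_forall fun x => (hlim _).mul (hlim _))
    have : ‖truncate n (f x) * truncate n (g x)‖
        ≤ ‖f x * g x‖ := by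
      rw [norm_mul, norm_mul]
      exact mul_le_mul (norm_truncate_le _ _) (norm_truncate_le _ _) (norm_nonneg _) (norm_nonneg _)
    calc _ ≤ _ := norm_sub_le _ _
      _ ≤ ‖f x * g x‖ + ‖f x * g x‖ := by gcongr
      _ = _ := by ring
  -- The majorant is locally integrable and independent of `n`, because the derivatives of the
  -- truncations are bounded by `C` uniformly and `‖truncate n z‖ ≤ ‖z‖`.
  · refine tendstoL1loc_of_dominated
      (b := fun x => (C + 1) * (‖f' x * g x‖ + ‖f x * g' x‖))
      (fun n => (hT n).locallyIntegrable_deriv.aestronglyMeasurable)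
      (h1.add h2).aestronglyMeasurable
      ((h1.norm.add h2.norm).smul (C + 1)) (fun n => Eventually.of_forall fun x => ?_)
      (Eventually.of_forall fun x =>
        ((hlim' _ _).mul (hlim _)).add ((hlim _).mul (hlim' _ _)))
    calc _ ≤ _ := norm_sub_le _ _
      _ ≤ (C * ‖f' x‖ * ‖g x‖ + ‖f x‖ * (C * ‖g' x‖)) + (‖f' x * g x‖ + ‖f x * g' x‖) := by
        refine add_le_add ((norm_add_le _ _).trans ?_) (norm_add_le _ _)
        rw [norm_mul, norm_mul]
        gcongr
        · exact hle _ _ _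
        · exact norm_truncate_le _ _
        · exact norm_truncate_le _ _
        · exact hle _ _ _
      _ = _ := by rw [norm_mul, norm_mul]; ring

end SingularSchrodinger

namespace SingularSchrodinger

variable {d : ℕ}

/-! ### Convergence in `L²` -/

lemma eLpNorm_two_eq {α E : Type*} [MeasurableSpace α] {μ : Measure α} [NormedAddCommGroup E]
    (f : α → E) : eLpNorm f 2 μ = (∫⁻ x, ‖f x‖ₑ ^ (2 : ℝ) ∂μ) ^ (1 / 2 : ℝ) := by
  rw [eLpNorm_eq_lintegral_rpow_enorm_toReal (by simp) (by simp)]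
  simp

lemma eLpNorm_two_rpow_two {α E : Type*} [MeasurableSpace α] {μ : Measure α}
    [NormedAddCommGroup E] (f : α → E) :
    eLpNorm f 2 μ ^ (2 : ℝ) = ∫⁻ x, ‖f x‖ₑ ^ (2 : ℝ) ∂μ := by
  rw [eLpNorm_two_eq, ← ENNReal.rpow_mul]
  simp

lemma tendsto_eLpNorm_two_of_lintegral {α E : Type*} [MeasurableSpace α] {μ : Measure α}
    [NormedAddCommGroup E] {f : ℕ → α → E}
    (h : Tendsto (fun n => ∫⁻ x, ‖f n x‖ₑ ^ (2 : ℝ) ∂μ) atTop (𝓝 0)) :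
    Tendsto (fun n => eLpNorm (f n) 2 μ) atTop (𝓝 0) := by
  simp only [eLpNorm_two_eq]
  have := h.ennrpow_const (1 / 2)
  rwa [ENNReal.zero_rpow_of_pos (by norm_num)] at this

lemma tendsto_eLpNorm_two_of_dominated {α E : Type*} [MeasurableSpace α] {μ : Measure α}
    [NormedAddCommGroup E] {f : ℕ → α → E} {b : α → ℝ}
    (hf : ∀ n, AEStronglyMeasurable (f n) μ) (hb : MemLp b 2 μ)
    (hle : ∀ n, ∀ᵐ x ∂μ, ‖f n x‖ ≤ b x)
    (hlim : ∀ᵐ x ∂μ, Tendsto (fun n => f n x) atTop (𝓝 0)) :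
    Tendsto (fun n => eLpNorm (f n) 2 μ) atTop (𝓝 0) := by
  refine tendsto_eLpNorm_two_of_lintegral ?_
  have h := tendsto_lintegral_of_dominated_convergence' (μ := μ)
    (F := fun n x => ‖f n x‖ₑ ^ (2 : ℝ)) (f := fun _ => 0) (fun x => ‖b x‖ₑ ^ (2 : ℝ))
    (fun n => (hf n).enorm.pow_const _) (fun n => ?_) ?_ ?_
  · simpa using h
  · filter_upwards [hle n] with x hx
    refine ENNReal.rpow_le_rpow ?_ (by norm_num)
    rw [enorm_le_iff_norm_le]
    exact hx.trans (le_abs_self _)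
  · rw [← eLpNorm_two_rpow_two]
    exact ENNReal.rpow_ne_top_of_nonneg (by norm_num) hb.2.ne
  · filter_upwards [hlim] with x hx
    have := hx.enorm.ennrpow_const 2
    simpa using this

lemma tendsto_integral_inner {α E : Type*} [MeasurableSpace α] {μ : Measure α}
    [NormedAddCommGroup E] [InnerProductSpace ℂ E] {f g : α → E} {fn gn : ℕ → α → E}
    (hf : MemLp f 2 μ) (hg : MemLp g 2 μ) (hfn : ∀ n, MemLp (fn n) 2 μ)
    (hgn : ∀ n, MemLp (gn n) 2 μ)
    (hflim : Tendsto (fun n => eLpNorm (fn n - f) 2 μ) atTop (𝓝 0))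
    (hglim : Tendsto (fun n => eLpNorm (gn n - g) 2 μ) atTop (𝓝 0)) :
    Tendsto (fun n => ∫ x, inner ℂ (gn n x) (fn n x) ∂μ) atTop
      (𝓝 (∫ x, inner ℂ (g x) (f x) ∂μ)) := by
  have h1 : ∀ {a b : α → E} (ha : MemLp a 2 μ) (hb : MemLp b 2 μ),
      ∫ x, inner ℂ (a x) (b x) ∂μ = inner ℂ (ha.toLp a) (hb.toLp b) := by
    intro a b ha hb
    rw [L2.inner_def]
    refine integral_congr_ae ?_
    filter_upwards [ha.coeFn_toLp, hb.coeFn_toLp] with x hx1 hx2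
    rw [hx1, hx2]
  have hf' : Tendsto (fun n => (hfn n).toLp (fn n)) atTop (𝓝 (hf.toLp f)) :=
    (Lp.tendsto_Lp_iff_tendsto_eLpNorm'' _ _ _ _).2 hflim
  have hg' : Tendsto (fun n => (hgn n).toLp (gn n)) atTop (𝓝 (hg.toLp g)) :=
    (Lp.tendsto_Lp_iff_tendsto_eLpNorm'' _ _ _ _).2 hglim
  rw [h1 hg hf]
  simp only [fun n => h1 (hgn n) (hfn n)]
  exact hg'.inner hf'

lemma integrable_inner_of_memLp {α E : Type*} [MeasurableSpace α] {μ : Measure α}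
    [NormedAddCommGroup E] [InnerProductSpace ℂ E] {f g : α → E}
    (hf : MemLp f 2 μ) (hg : MemLp g 2 μ) : Integrable (fun x => inner ℂ (f x) (g x)) μ := by
  refine (L2.integrable_inner (𝕜 := ℂ) (hf.toLp f) (hg.toLp g)).congr ?_
  filter_upwards [hf.coeFn_toLp, hg.coeFn_toLp] with x hx1 hx2
  rw [hx1, hx2]

lemma integrable_smul_of_memLp {α E : Type*} [MeasurableSpace α] {μ : Measure α}
    [NormedAddCommGroup E] [NormedSpace ℂ E] {f : α → ℂ} {g : α → E}
    (hf : MemLp f 2 μ) (hg : MemLp g 2 μ) : Integrable (fun x => f x • g x) μ :=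
  memLp_one_iff_integrable.1 (hg.smul hf)

/-! ### The weak gradient -/

lemma locallyIntegrable_of_memLp_two {E : Type*} [NormedAddCommGroup E] {f : Space d → E}
    (hf : MemLp f 2 volume) : LocallyIntegrable f volume :=
  hf.locallyIntegrable one_le_two

lemma HasWeakGradient.hasWeakDeriv {f : Space d → ℂ} {G : Space d → EuclideanSpace ℂ (Fin d)}
    (h : HasWeakGradient f G) (i : Fin d) :
    HasWeakDeriv (EuclideanSpace.single i 1) f (fun x => G x i) where
  locallyIntegrable := h.locallyIntegrable
  locallyIntegrable_deriv := fun x => by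
    obtain ⟨U, hU, hint⟩ := h.locallyIntegrable_grad x
    exact ⟨U, hU, (EuclideanSpace.proj (𝕜 := ℂ) i).integrable_comp hint⟩
  integral_eq η hη hηc := by
    simpa only [Complex.real_smul, mul_comm] using h.integral_eq η hη hηc i

lemma HasWeakGradient.of_hasWeakDeriv {f : Space d → ℂ} {G : Space d → EuclideanSpace ℂ (Fin d)}
    (hf : LocallyIntegrable f volume) (hG : LocallyIntegrable G volume)
    (h : ∀ i, HasWeakDeriv (EuclideanSpace.single i 1) f (fun x => G x i)) :
    HasWeakGradient f G where
  locallyIntegrable := hf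
  locallyIntegrable_grad := hG
  integral_eq η hη hηc i := by
    simpa only [Complex.real_smul, mul_comm] using (h i).integral_eq η hη hηc

lemma ae_eq_of_forall_coord {G K : Space d → EuclideanSpace ℂ (Fin d)}
    (h : ∀ i, (fun x => G x i) =ᵐ[volume] fun x => K x i) : G =ᵐ[volume] K := by
  filter_upwards [ae_all_iff.2 h] with x hx
  ext i
  exact hx i

namespace HasWeakGradient

variable {f g : Space d → ℂ} {G K : Space d → EuclideanSpace ℂ (Fin d)}

lemma unique (h : HasWeakGradient f G) (h' : HasWeakGradient f K) : G =ᵐ[volume] K :=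
  ae_eq_of_forall_coord fun i => (h.hasWeakDeriv i).unique (h'.hasWeakDeriv i)

lemma congr {f₁ : Space d → ℂ} {G₁ : Space d → EuclideanSpace ℂ (Fin d)} (h : HasWeakGradient f G)
    (hf : f =ᵐ[volume] f₁) (hG : G =ᵐ[volume] G₁) : HasWeakGradient f₁ G₁ :=
  of_hasWeakDeriv (h.locallyIntegrable.congr hf) (h.locallyIntegrable_grad.congr hG) fun i =>
    (h.hasWeakDeriv i).congr hf (by filter_upwards [hG] with x hx; rw [hx])

lemma weakGrad_ae_eq (h : HasWeakGradient f G) : weakGrad f =ᵐ[volume] G := by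
  have hex : ∃ G, HasWeakGradient f G := ⟨G, h⟩
  rw [weakGrad, dif_pos hex]
  exact hex.choose_spec.unique h

lemma hasWeakGradient_weakGrad (h : HasWeakGradient f G) : HasWeakGradient f (weakGrad f) :=
  h.congr ae_eq_rfl h.weakGrad_ae_eq.symm

lemma add (hf : HasWeakGradient f G) (hg : HasWeakGradient g K) :
    HasWeakGradient (fun x => f x + g x) (fun x => G x + K x) :=
  of_hasWeakDeriv (hf.locallyIntegrable.add hg.locallyIntegrable)
    (hf.locallyIntegrable_grad.add hg.locallyIntegrable_grad) fun i =>
    (hf.hasWeakDeriv i).add (hg.hasWeakDeriv i)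

lemma const_smul (hf : HasWeakGradient f G) (c : ℂ) :
    HasWeakGradient (fun x => c * f x) (fun x => c • G x) :=
  of_hasWeakDeriv (hf.locallyIntegrable.smul c) (hf.locallyIntegrable_grad.smul c) fun i =>
    (hf.hasWeakDeriv i).clm_comp (ContinuousLinearMap.mul ℝ ℂ c)

lemma sub (hf : HasWeakGradient f G) (hg : HasWeakGradient g K) :
    HasWeakGradient (fun x => f x - g x) (fun x => G x - K x) := by
  have := hf.add (hg.const_smul (-1))
  simpa [sub_eq_add_neg] using this

lemma mul (hf : HasWeakGradient f G) (hg : HasWeakGradient g K)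
    (h0 : LocallyIntegrable (fun x => f x * g x) volume)
    (h1 : LocallyIntegrable (fun x => g x • G x) volume)
    (h2 : LocallyIntegrable (fun x => f x • K x) volume) :
    HasWeakGradient (fun x => f x * g x) (fun x => g x • G x + f x • K x) := by
  have hproj : ∀ {L : Space d → EuclideanSpace ℂ (Fin d)} (i : Fin d),
      LocallyIntegrable L volume → LocallyIntegrable (fun x => L x i) volume := by
    intro L i hL x
    obtain ⟨U, hU, hint⟩ := hL x
    exact ⟨U, hU, (EuclideanSpace.proj (𝕜 := ℂ) i).integrable_comp hint⟩
  refine of_hasWeakDeriv h0 (h1.add h2) fun i => ?_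
  have h := (hf.hasWeakDeriv i).mul (hg.hasWeakDeriv i) h0
    (by simpa [mul_comm] using hproj i h1) (by simpa using hproj i h2)
  simpa [mul_comm] using h

end HasWeakGradient

/-- Coordinatewise complex conjugation. -/
noncomputable def conjVec (z : EuclideanSpace ℂ (Fin d)) : EuclideanSpace ℂ (Fin d) :=
  WithLp.toLp 2 fun i => conj (z i)

@[simp] lemma conjVec_apply (z : EuclideanSpace ℂ (Fin d)) (i : Fin d) :
    conjVec z i = conj (z i) := rfl

@[simp] lemma norm_conjVec (z : EuclideanSpace ℂ (Fin d)) : ‖conjVec z‖ = ‖z‖ := by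
  simp [EuclideanSpace.norm_eq]

lemma continuous_conjVec : Continuous (conjVec (d := d)) := by
  unfold conjVec
  fun_prop

lemma HasWeakGradient.conj {f : Space d → ℂ} {G : Space d → EuclideanSpace ℂ (Fin d)}
    (h : HasWeakGradient f G) :
    HasWeakGradient (fun x => conj (f x)) (fun x => conjVec (G x)) := by
  refine of_hasWeakDeriv ?_ ?_ fun i =>
    (h.hasWeakDeriv i).clm_comp (Complex.conjCLE : ℂ →L[ℝ] ℂ)
  · exact h.locallyIntegrable.mono
      (Complex.continuous_conj.comp_aestronglyMeasurable h.locallyIntegrable.aestronglyMeasurable)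
      (Eventually.of_forall fun x => by simp)
  · exact h.locallyIntegrable_grad.mono
      (continuous_conjVec.comp_aestronglyMeasurable h.locallyIntegrable_grad.aestronglyMeasurable)
      (Eventually.of_forall fun x => by simp)

/-- The predicates `HasWeakGradient f` and `HasWeakGradient g` are equal, so the choice made in
`weakGrad` is the same. The equality therefore holds everywhere, not just almost everywhere. -/
lemma weakGrad_congr {f g : Space d → ℂ} (h : f =ᵐ[volume] g) : weakGrad f = weakGrad g := by
  have : HasWeakGradient f = HasWeakGradient g := by
    ext G
    exact ⟨fun hf => hf.congr h ae_eq_rfl, fun hg => hg.congr h.symm ae_eq_rfl⟩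
  have key : ∀ P Q : (Space d → EuclideanSpace ℂ (Fin d)) → Prop, P = Q →
      (open Classical in if h : ∃ G, P G then h.choose else 0)
        = (open Classical in if h : ∃ G, Q G then h.choose else 0) := by
    rintro P _ rfl; rfl
  exact key _ _ this

/-- The gradient of a differentiable function. -/
noncomputable def grad (f : Space d → ℂ) (x : Space d) : EuclideanSpace ℂ (Fin d) :=
  WithLp.toLp 2 fun i => fderiv ℝ f x (EuclideanSpace.single i 1)

@[simp] lemma grad_apply (f : Space d → ℂ) (x : Space d) (i : Fin d) :
    grad f x i = fderiv ℝ f x (EuclideanSpace.single i 1) := rfl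

lemma continuous_grad {f : Space d → ℂ} (hf : ContDiff ℝ 1 f) : Continuous (grad f) := by
  have h : ∀ i, Continuous fun x => fderiv ℝ f x (EuclideanSpace.single i 1) := fun i =>
    continuous_fderiv_apply hf _
  unfold grad
  fun_prop

lemma hasCompactSupport_grad {f : Space d → ℂ} (hf : HasCompactSupport f) :
    HasCompactSupport (grad f) := by
  have : grad f = (fun L : Space d →L[ℝ] ℂ =>
      (WithLp.toLp 2 fun i => L (EuclideanSpace.single i 1) : EuclideanSpace ℂ (Fin d)))
        ∘ fderiv ℝ f := rfl
  rw [this]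
  refine (hf.fderiv ℝ).comp_left ?_
  ext i; simp

lemma _root_.ContDiff.hasWeakGradient {f : Space d → ℂ} (hf : ContDiff ℝ 1 f) :
    HasWeakGradient f (grad f) :=
  .of_hasWeakDeriv hf.continuous.locallyIntegrable (continuous_grad hf).locallyIntegrable fun _ =>
    hf.hasWeakDeriv _

lemma norm_fderiv_le_sum (f : Space d → ℂ) (x : Space d) :
    ‖fderiv ℝ f x‖ ≤ ∑ i, ‖grad f x i‖ := by
  refine ContinuousLinearMap.opNorm_le_bound _ (Finset.sum_nonneg fun _ _ => norm_nonneg _)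
    fun v => ?_
  have hv : v = ∑ i, v i • EuclideanSpace.single i (1 : ℝ) := by
    ext j
    simp [Finset.sum_apply, Pi.single_apply]
  conv_lhs => rw [hv]
  rw [map_sum, Finset.sum_mul]
  refine (norm_sum_le _ _).trans (Finset.sum_le_sum fun i _ => ?_)
  rw [map_smul, norm_smul, mul_comm, grad_apply]
  exact mul_le_mul_of_nonneg_left (PiLp.norm_apply_le v i) (norm_nonneg _)

/-! ### The space `W^{1,2}` -/

section W12

variable {f g : Space d → ℂ}

lemma MemW12.memLp {μ : Measure (Space d)} (h : MemW12 μ f) : MemLp f 2 μ := h.1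

lemma MemW12.hasWeakGradient {μ : Measure (Space d)} (h : MemW12 μ f) :
    HasWeakGradient f (weakGrad f) :=
  h.2.choose_spec.1.hasWeakGradient_weakGrad

lemma MemW12.memLp_weakGrad {μ : Measure (Space d)} (h : MemW12 μ f) (hμ : μ ≪ volume) :
    MemLp (weakGrad f) 2 μ :=
  (memLp_congr_ae (hμ.ae_le h.2.choose_spec.1.weakGrad_ae_eq)).2 h.2.choose_spec.2

lemma MemW12.memLp_weakGrad_volume (h : MemW12 volume f) : MemLp (weakGrad f) 2 volume :=
  h.memLp_weakGrad Measure.AbsolutelyContinuous.rfl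

lemma MemW12.congr {μ : Measure (Space d)} (h : MemW12 μ f) (hμ : μ ≪ volume)
    (hfg : f =ᵐ[volume] g) : MemW12 μ g :=
  ⟨(memLp_congr_ae (hμ.ae_le hfg)).1 h.1, weakGrad f, h.hasWeakGradient.congr hfg ae_eq_rfl,
    h.memLp_weakGrad hμ⟩

lemma MemW12.sub (hf : MemW12 volume f) (hg : MemW12 volume g) : MemW12 volume (f - g) :=
  ⟨hf.1.sub hg.1, _, hf.hasWeakGradient.sub hg.hasWeakGradient,
    hf.memLp_weakGrad_volume.sub hg.memLp_weakGrad_volume⟩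

lemma MemW12.weakGrad_sub (hf : MemW12 volume f) (hg : MemW12 volume g) :
    weakGrad (f - g) =ᵐ[volume] weakGrad f - weakGrad g :=
  (hf.hasWeakGradient.sub hg.hasWeakGradient).weakGrad_ae_eq

lemma memW12_of_contDiff {η : Space d → ℂ} (hη : ContDiff ℝ 1 η) (hc : HasCompactSupport η) :
    MemW12 volume η :=
  ⟨hη.continuous.memLp_of_hasCompactSupport hc, grad η, hη.hasWeakGradient,
    (continuous_grad hη).memLp_of_hasCompactSupport (hasCompactSupport_grad hc)⟩

/-- Convergence in `W^{1,2}(ℝ^d)`. -/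
def TendstoW12 (η : ℕ → Space d → ℂ) (f : Space d → ℂ) : Prop :=
  Tendsto (fun n => eLpNorm (η n - f) 2 volume + eLpNorm (weakGrad (η n - f)) 2 volume)
    atTop (𝓝 0)

lemma tendsto_of_add_left {a b : ℕ → ℝ≥0∞} (h : Tendsto (fun n => a n + b n) atTop (𝓝 0)) :
    Tendsto a atTop (𝓝 0) :=
  tendsto_of_tendsto_of_tendsto_of_le_of_le tendsto_const_nhds h (fun _ => zero_le)
    fun _ => le_self_add

lemma TendstoW12.tendsto_eLpNorm {η : ℕ → Space d → ℂ} (h : TendstoW12 η f) :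
    Tendsto (fun n => eLpNorm (η n - f) 2 volume) atTop (𝓝 0) :=
  tendsto_of_add_left h

lemma TendstoW12.tendsto_eLpNorm_weakGrad {η : ℕ → Space d → ℂ} (h : TendstoW12 η f)
    (hη : ∀ n, MemW12 volume (η n)) (hf : MemW12 volume f) :
    Tendsto (fun n => eLpNorm (weakGrad (η n) - weakGrad f) 2 volume) atTop (𝓝 0) := by
  have h1 : Tendsto (fun n => eLpNorm (weakGrad (η n - f)) 2 volume) atTop (𝓝 0) := by
    refine tendsto_of_add_left (b := fun n => eLpNorm (η n - f) 2 volume) ?_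
    unfold TendstoW12 at h
    simpa only [add_comm] using h
  refine h1.congr fun n => eLpNorm_congr_ae ((hη n).weakGrad_sub hf)

lemma tendstoW12_of_tendsto {η : ℕ → Space d → ℂ} {K : ℕ → Space d → EuclideanSpace ℂ (Fin d)}
    {G : Space d → EuclideanSpace ℂ (Fin d)}
    (hη : ∀ n, HasWeakGradient (η n) (K n)) (hf : HasWeakGradient f G)
    (h1 : Tendsto (fun n => eLpNorm (η n - f) 2 volume) atTop (𝓝 0))
    (h2 : Tendsto (fun n => eLpNorm (K n - G) 2 volume) atTop (𝓝 0)) : TendstoW12 η f := by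
  have h := h1.add h2
  rw [add_zero] at h
  refine h.congr fun n => ?_
  have h3 : weakGrad (η n - f) =ᵐ[volume] K n - G := ((hη n).sub hf).weakGrad_ae_eq
  rw [eLpNorm_congr_ae h3]

end W12

/-! ### Density of test functions -/

/-- A bump function on `ℝ^d`, equal to one on the unit ball. -/
noncomputable def spaceBump (d : ℕ) : ContDiffBump (0 : Space d) := ⟨1, 2, one_pos, one_lt_two⟩

/-- Smooth cutoff functions that exhaust `ℝ^d`. -/
noncomputable def cutoff (n : ℕ) (x : Space d) : ℝ := spaceBump d (((n : ℝ) + 1)⁻¹ • x)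

lemma contDiff_cutoff (n : ℕ) : ContDiff ℝ ∞ (cutoff (d := d) n) :=
  (spaceBump d).contDiff.comp (contDiff_id.const_smul (((n : ℝ) + 1)⁻¹))

lemma cutoff_nonneg (n : ℕ) (x : Space d) : 0 ≤ cutoff n x := (spaceBump d).nonneg

lemma cutoff_le_one (n : ℕ) (x : Space d) : cutoff n x ≤ 1 := (spaceBump d).le_one

lemma hasCompactSupport_cutoff (n : ℕ) : HasCompactSupport (cutoff (d := d) n) :=
  (spaceBump d).hasCompactSupport.comp_homeomorph
    (Homeomorph.smulOfNeZero (((n : ℝ) + 1)⁻¹) (by positivity))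

lemma eventually_cutoff_eventuallyEq (x : Space d) :
    ∀ᶠ n : ℕ in atTop, cutoff n =ᶠ[𝓝 x] fun _ => (1 : ℝ) := by
  have h : Tendsto (fun n : ℕ => ((n : ℝ) + 1)⁻¹ • x) atTop (𝓝 ((0 : ℝ) • x)) :=
    (tendsto_inv_atTop_zero.comp
      (tendsto_atTop_add_const_right _ 1 tendsto_natCast_atTop_atTop)).smul_const x
  rw [zero_smul] at h
  filter_upwards [h (Metric.ball_mem_nhds _ one_pos)] with n hn
  have hcont : Continuous fun y : Space d => ((n : ℝ) + 1)⁻¹ • y := continuous_const_smul _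
  filter_upwards [hcont.continuousAt.preimage_mem_nhds (Metric.isOpen_ball.mem_nhds hn)] with y hy
  exact (spaceBump d).one_of_mem_closedBall (Metric.ball_subset_closedBall hy)

/-- The cutoff functions as complex valued functions. -/
noncomputable def cutoffC (n : ℕ) (x : Space d) : ℂ := (cutoff n x : ℂ)

lemma contDiff_cutoffC (n : ℕ) : ContDiff ℝ ∞ (cutoffC (d := d) n) :=
  Complex.ofRealCLM.contDiff.comp (contDiff_cutoff n)

lemma norm_cutoffC_le (n : ℕ) (x : Space d) : ‖cutoffC n x‖ ≤ 1 := by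
  rw [cutoffC, Complex.norm_real, Real.norm_of_nonneg (cutoff_nonneg n x)]
  exact cutoff_le_one n x

/-- Dilation multiplies the gradient of `cutoffC 0` by `(n + 1)⁻¹ ≤ 1`. -/
lemma exists_norm_grad_cutoffC_le : ∃ C : ℝ, 0 ≤ C ∧ ∀ n (x : Space d),
    ‖grad (cutoffC n) x‖ ≤ C := by
  have hc0 : HasCompactSupport (cutoffC (d := d) 0) :=
    (hasCompactSupport_cutoff 0).comp_left (g := fun t : ℝ => (t : ℂ)) rfl
  obtain ⟨C, hC⟩ := (hasCompactSupport_grad hc0).exists_bound_of_continuous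
    (continuous_grad ((contDiff_cutoffC 0).of_le (by exact_mod_cast le_top)))
  have hC0 : 0 ≤ C := (norm_nonneg _).trans (hC 0)
  refine ⟨C, hC0, fun n x => ?_⟩
  have h1 : cutoffC (d := d) n = fun x => cutoffC 0 (((n : ℝ) + 1)⁻¹ • x) := by
    ext y; simp [cutoffC, cutoff]
  have h2 : HasFDerivAt (cutoffC (d := d) n) ((fderiv ℝ (cutoffC 0) (((n : ℝ) + 1)⁻¹ • x)).comp
      (((n : ℝ) + 1)⁻¹ • ContinuousLinearMap.id ℝ (Space d))) x := by
    rw [h1]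
    have h3 := ((contDiff_cutoffC (d := d) 0).differentiable (by simp)
      (((n : ℝ) + 1)⁻¹ • x)).hasFDerivAt
    exact h3.comp x ((hasFDerivAt_id (𝕜 := ℝ) x).const_smul (((n : ℝ) + 1)⁻¹))
  have h4 : grad (cutoffC n) x = ((n : ℝ) + 1)⁻¹ • grad (cutoffC 0) (((n : ℝ) + 1)⁻¹ • x) := by
    ext i
    simp [h2.fderiv]
  rw [h4, norm_smul]
  have h5 : ‖((n : ℝ) + 1)⁻¹‖ ≤ 1 := by
    rw [Real.norm_of_nonneg (by positivity)]
    exact inv_le_one_of_one_le₀ (by linarith [(Nat.cast_nonneg n : (0 : ℝ) ≤ n)])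
  calc _ ≤ 1 * C := mul_le_mul h5 (hC _) (norm_nonneg _) zero_le_one
    _ = C := one_mul C

lemma mollify_ofReal (n : ℕ) (w : Space d → ℝ) (x : Space d) :
    mollify n (fun x => (w x : ℂ)) x = ((mollify n w x : ℝ) : ℂ) := by
  rw [mollify_apply, mollify_apply, ← integral_complex_ofReal]
  simp

lemma HasWeakGradient.mollify {f : Space d → ℂ} {G : Space d → EuclideanSpace ℂ (Fin d)}
    (h : HasWeakGradient f G) (n : ℕ) : grad (mollify n f) = mollify n G := by
  ext x i
  rw [grad_apply, (h.hasWeakDeriv i).fderiv_mollify, mollify_apply, mollify_apply]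
  have h1 := (EuclideanSpace.proj (𝕜 := ℂ) (ι := Fin d) i).integral_comp_comm
    (h.locallyIntegrable_grad.integrable_smul_left_of_hasCompactSupport
      (contDiff_normed_sub n x).continuous (hasCompactSupport_normed_sub n x))
  have h2 : (EuclideanSpace.proj (𝕜 := ℂ) (ι := Fin d) i)
    (∫ y, (mollifier d n).normed volume (x - y) • G y) =
    (∫ y, (mollifier d n).normed volume (x - y) • G y) i := rfl
  rw [← h2, ← h1]
  refine integral_congr_ae (Eventually.of_forall fun y => ?_)
  simp

lemma tendsto_eLpNorm_mollify_sub {F : Type} [NormedAddCommGroup F] [NormedSpace ℝ F]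
    [CompleteSpace F] {f : Space d → F} (hf : MemLp f 2 volume) :
    Tendsto (fun n => eLpNorm (mollify n f - f) 2 volume) atTop (𝓝 0) := by
  refine tendsto_eLpNorm_two_of_lintegral (tendsto_lintegral_enorm_mollify_sub one_le_two
    (locallyIntegrable_of_memLp_two hf) ?_)
  rw [← eLpNorm_two_rpow_two]
  exact ENNReal.rpow_ne_top_of_nonneg (by norm_num) hf.2.ne

/-- Test functions are dense in `W^{1,2}(ℝ^d)`; the approximation preserves positivity. -/
theorem MemW12.exists_tendstoW12 {f : Space d → ℂ} (hf : MemW12 volume f) :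
    ∃ η : ℕ → Space d → ℂ, (∀ n, ContDiff ℝ ∞ (η n) ∧ HasCompactSupport (η n)) ∧
      TendstoW12 η f ∧
      ((∃ w : Space d → ℝ, (∀ᵐ x, 0 ≤ w x) ∧ f =ᵐ[volume] fun x => (w x : ℂ)) →
        ∀ n x, ∃ r : ℝ, 0 ≤ r ∧ η n x = (r : ℂ)) := by
  obtain ⟨C, hC0, hC⟩ := exists_norm_grad_cutoffC_le (d := d)
  set G := weakGrad f with hGdef
  have hG : MemLp G 2 volume := hf.memLp_weakGrad_volume
  have hfm := hf.memLp.aestronglyMeasurable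
  have hGm := hG.aestronglyMeasurable
  have hχ1 : ∀ n, ContDiff ℝ 1 (cutoffC (d := d) n) := fun n =>
    (contDiff_cutoffC n).of_le (by exact_mod_cast le_top)
  have hχm : ∀ n, AEStronglyMeasurable (cutoffC (d := d) n) volume := fun n =>
    (hχ1 n).continuous.aestronglyMeasurable
  have hχGm : ∀ n, AEStronglyMeasurable (grad (cutoffC (d := d) n)) volume := fun n =>
    (continuous_grad (hχ1 n)).aestronglyMeasurable
  have hm1 : ∀ n, MemLp (fun x => cutoffC n x * f x) 2 volume := fun n =>
    hf.memLp.of_le ((hχm n).mul hfm) (Eventually.of_forall fun x => by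
      rw [norm_mul]; exact mul_le_of_le_one_left (norm_nonneg _) (norm_cutoffC_le n x))
  have hm2 : ∀ n, MemLp (fun x => cutoffC n x • G x) 2 volume := fun n =>
    hG.of_le ((hχm n).smul hGm) (Eventually.of_forall fun x => by
      rw [norm_smul]; exact mul_le_of_le_one_left (norm_nonneg _) (norm_cutoffC_le n x))
  have hm3 : ∀ n, MemLp (fun x => f x • grad (cutoffC n) x) 2 volume := fun n =>
    (hf.memLp.const_mul (C : ℂ)).of_le (hfm.smul (hχGm n)) (Eventually.of_forall fun x => by
      rw [norm_smul, norm_mul, mul_comm, Complex.norm_real, Real.norm_of_nonneg hC0]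
      exact mul_le_mul_of_nonneg_right (hC n x) (norm_nonneg _))
  set fn : ℕ → Space d → ℂ := fun n x => cutoffC n x * f x with hfn
  set Gn : ℕ → Space d → EuclideanSpace ℂ (Fin d) :=
    fun n x => f x • grad (cutoffC n) x + cutoffC n x • G x with hGn
  have hw : ∀ n, HasWeakGradient (fn n) (Gn n) := fun n =>
    (hχ1 n).hasWeakGradient.mul hf.hasWeakGradient (locallyIntegrable_of_memLp_two (hm1 n))
      (locallyIntegrable_of_memLp_two (hm3 n)) (locallyIntegrable_of_memLp_two (hm2 n))
  have hGn2 : ∀ n, MemLp (Gn n) 2 volume := fun n => (hm3 n).add (hm2 n)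
  have hχlim : ∀ x : Space d, ∀ᶠ n in atTop, cutoffC n x = 1 ∧ grad (cutoffC n) x = 0 := by
    intro x
    filter_upwards [eventually_cutoff_eventuallyEq x] with n hn
    have h1 : cutoffC n =ᶠ[𝓝 x] fun _ => (1 : ℂ) := hn.mono fun y hy => by simp [cutoffC, hy]
    refine ⟨h1.eq_of_nhds, ?_⟩
    ext i
    simp [h1.fderiv_eq]
  have hL1 : Tendsto (fun n => eLpNorm (fn n - f) 2 volume) atTop (𝓝 0) := by
    refine tendsto_eLpNorm_two_of_dominated (b := fun x => 2 * ‖f x‖)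
      (fun n => (hm1 n).aestronglyMeasurable.sub hfm) (hf.memLp.norm.const_mul 2)
      (fun n => Eventually.of_forall fun x => ?_) (Eventually.of_forall fun x => ?_)
    · calc ‖cutoffC n x * f x - f x‖ ≤ ‖cutoffC n x‖ * ‖f x‖ + ‖f x‖ := by
            rw [← norm_mul]; exact norm_sub_le _ _
        _ ≤ 1 * ‖f x‖ + ‖f x‖ := by gcongr; exact norm_cutoffC_le n x
        _ = 2 * ‖f x‖ := by ring
    · refine tendsto_const_nhds.congr' ((hχlim x).mono fun n hn => ?_)
      simp [hfn, hn.1]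
  have hL2 : Tendsto (fun n => eLpNorm (Gn n - G) 2 volume) atTop (𝓝 0) := by
    refine tendsto_eLpNorm_two_of_dominated (b := fun x => C * ‖f x‖ + 2 * ‖G x‖)
      (fun n => (hGn2 n).aestronglyMeasurable.sub hGm)
      ((hf.memLp.norm.const_mul C).add (hG.norm.const_mul 2))
      (fun n => Eventually.of_forall fun x => ?_) (Eventually.of_forall fun x => ?_)
    · calc ‖f x • grad (cutoffC n) x + cutoffC n x • G x - G x‖
          ≤ ‖f x‖ * ‖grad (cutoffC n) x‖ + ‖cutoffC n x‖ * ‖G x‖ + ‖G x‖ := by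
            rw [← norm_smul, ← norm_smul]
            exact (norm_sub_le _ _).trans (by gcongr; exact norm_add_le _ _)
        _ ≤ ‖f x‖ * C + 1 * ‖G x‖ + ‖G x‖ := by
            gcongr
            · exact hC n x
            · exact norm_cutoffC_le n x
        _ = C * ‖f x‖ + 2 * ‖G x‖ := by ring
    · refine tendsto_const_nhds.congr' ((hχlim x).mono fun n hn => ?_)
      simp [hGn, hn.1, hn.2]
  have hcs : ∀ n, HasCompactSupport (fn n) := fun n =>
    HasCompactSupport.mul_right
      ((hasCompactSupport_cutoff n).comp_left (g := fun t : ℝ => (t : ℂ)) rfl)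
  -- Diagonal choice: each cut-off function is mollified so finely that the error in value and
  -- gradient stays below `(n + 1)⁻¹`.
  have hm : ∀ n : ℕ, ∃ m : ℕ, eLpNorm (mollify m (fn n) - fn n) 2 volume
      + eLpNorm (mollify m (Gn n) - Gn n) 2 volume < ((n : ℝ≥0∞) + 1)⁻¹ := by
    intro n
    have h := (tendsto_eLpNorm_mollify_sub (hm1 n)).add (tendsto_eLpNorm_mollify_sub (hGn2 n))
    rw [add_zero] at h
    exact (h.eventually_lt_const (by simp)).exists
  choose m hm using hm
  have hlim0 : Tendsto (fun n : ℕ => ((n : ℝ≥0∞) + 1)⁻¹) atTop (𝓝 0) := by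
    have h1 := ENNReal.tendsto_inv_nat_nhds_zero.comp (tendsto_add_atTop_nat 1)
    refine h1.congr fun n => ?_
    simp
  have hsm : ∀ n, ContDiff ℝ ∞ (mollify (m n) (fn n)) := fun n =>
    contDiff_mollify _ (hw n).locallyIntegrable
  refine ⟨fun n => mollify (m n) (fn n), fun n => ⟨hsm n, hasCompactSupport_mollify _ (hcs n)⟩,
    ?_, ?_⟩
  · refine tendstoW12_of_tendsto (K := fun n => mollify (m n) (Gn n)) (fun n => ?_)
      hf.hasWeakGradient ?_ ?_
    · rw [← (hw n).mollify]
      exact ((hsm n).of_le (by exact_mod_cast le_top)).hasWeakGradient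
    · have h := hlim0.add hL1
      rw [add_zero] at h
      refine tendsto_of_tendsto_of_tendsto_of_le_of_le tendsto_const_nhds h (fun _ => zero_le)
        (fun n => ?_)
      have h1 : mollify (m n) (fn n) - f = (mollify (m n) (fn n) - fn n) + (fn n - f) := by abel
      dsimp only
      rw [h1]
      refine (eLpNorm_add_le (((hsm n).continuous.aestronglyMeasurable).sub
        (hm1 n).aestronglyMeasurable) ((hm1 n).aestronglyMeasurable.sub hfm) one_le_two).trans ?_
      gcongr
      exact le_self_add.trans (hm n).le
    · have h := hlim0.add hL2
      rw [add_zero] at h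
      refine tendsto_of_tendsto_of_tendsto_of_le_of_le tendsto_const_nhds h (fun _ => zero_le)
        (fun n => ?_)
      have h1 : mollify (m n) (Gn n) - G = (mollify (m n) (Gn n) - Gn n) + (Gn n - G) := by abel
      dsimp only
      rw [h1]
      refine (eLpNorm_add_le (((contDiff_mollify _
        (hw n).locallyIntegrable_grad).continuous.aestronglyMeasurable).sub
        (hGn2 n).aestronglyMeasurable) ((hGn2 n).aestronglyMeasurable.sub hGm) one_le_two).trans ?_
      gcongr
      exact le_add_self.trans (hm n).le
  -- Cutoffs and mollifiers are nonnegative, so they preserve sign. This later decides the sign of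
  -- the surface term.
  · rintro ⟨w, hw0, hfw⟩ n x
    have h1 : mollify (m n) (fn n) x = ((mollify (m n) (fun y => cutoff n y * w y) x : ℝ) : ℂ) := by
      rw [← mollify_ofReal]
      refine mollify_congr _ ?_
      filter_upwards [hfw] with y hy _
      simp [hfn, hy, cutoffC]
    refine ⟨_, ?_, h1⟩
    rw [mollify_apply]
    refine integral_nonneg_of_ae ?_
    filter_upwards [hw0] with y hy
    exact mul_nonneg ((mollifier d _).nonneg_normed _) (mul_nonneg (cutoff_nonneg _ _) hy)

end SingularSchrodinger

namespace SingularSchrodinger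

/-! ### The trace inequality in `W^{1,1}` -/

/-- Lipschitz images control integrals with respect to the Hausdorff measure. -/
lemma setLIntegral_image_le_of_lipschitzOnWith {m k : ℕ} {K : ℝ≥0} {f : Space m → Space k}
    {B : Set (Space m)} (hB : MeasurableSet B) (hf : LipschitzOnWith K f B)
    {h : Space k → ℝ≥0∞} (hh : Measurable h) :
    ∫⁻ x in f '' B, h x ∂(Measure.euclideanHausdorffMeasure m)
      ≤ (K : ℝ≥0∞) ^ m * ∫⁻ y in B, h (f y) := by
  have hfm : AEMeasurable f (volume.restrict B) := hf.continuousOn.aemeasurable hB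
  have hle : (Measure.euclideanHausdorffMeasure m).restrict (f '' B)
      ≤ (K : ℝ≥0∞) ^ m • (volume.restrict B).map f := by
    refine Measure.le_iff.2 fun A hA => ?_
    rw [Measure.restrict_apply hA, Measure.smul_apply, Measure.map_apply_of_aemeasurable hfm hA,
      Measure.restrict_apply' hB, smul_eq_mul]
    have h1 : A ∩ f '' B = f '' (f ⁻¹' A ∩ B) := by
      ext x; constructor
      · rintro ⟨hx, y, hy, rfl⟩; exact ⟨y, ⟨hx, hy⟩, rfl⟩
      · rintro ⟨y, ⟨hx, hy⟩, rfl⟩; exact ⟨hx, y, hy, rfl⟩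
    -- Lebesgue measure on `Space m` is the normalized Hausdorff measure of dimension `m`. The
    -- normalizing constants in source and target agree, so the estimate for Lipschitz images of
    -- Hausdorff measure carries over unchanged.
    rw [h1, ← EuclideanSpace.euclideanHausdorffMeasure_eq_volume,
      Measure.euclideanHausdorffMeasure_def, Measure.euclideanHausdorffMeasure_def,
      Measure.smul_apply, Measure.smul_apply, mul_smul_comm]
    have h2 := (hf.mono (Set.inter_subset_right (s := f ⁻¹' A))).hausdorffMeasure_image_le
      (d := (m : ℝ)) (Nat.cast_nonneg m)
    rw [ENNReal.rpow_natCast] at h2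
    exact smul_le_smul_of_nonneg_left h2 zero_le
  calc ∫⁻ x in f '' B, h x ∂(Measure.euclideanHausdorffMeasure m)
      ≤ ∫⁻ x, h x ∂((K : ℝ≥0∞) ^ m • (volume.restrict B).map f) := lintegral_mono' hle le_rfl
    _ = _ := by rw [lintegral_smul_measure, lintegral_map' hh.aemeasurable hfm, smul_eq_mul]

/-- Insert a coordinate at position `i`. -/
noncomputable def insertCoord {n : ℕ} (i : Fin (n + 1)) (t : ℝ) (y : Space n) : Space (n + 1) :=
  WithLp.toLp 2 (i.insertNth (α := fun _ => ℝ) t y.ofLp)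

/-- Delete the coordinate at position `i`. -/
noncomputable def deleteCoord {n : ℕ} (i : Fin (n + 1)) (y : Space (n + 1)) : Space n :=
  WithLp.toLp 2 fun j => y (i.succAbove j)

lemma insertCoord_deleteCoord {n : ℕ} (i : Fin (n + 1)) (y : Space (n + 1)) :
    insertCoord i (y i) (deleteCoord i y) = y := by
  ext j
  refine Fin.succAboveCases i ?_ (fun k => ?_) j
  · simp [insertCoord]
  · simp [insertCoord, deleteCoord]

lemma insertCoord_eq_add {n : ℕ} (i : Fin (n + 1)) (t : ℝ) (y : Space n) :
    insertCoord i t y = insertCoord i 0 y + t • EuclideanSpace.single i (1 : ℝ) := by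
  ext j
  refine Fin.succAboveCases i ?_ (fun k => ?_) j
  · simp [insertCoord]
  · simp [insertCoord]

lemma norm_sq_insertCoord_sub {n : ℕ} (i : Fin (n + 1)) (t s : ℝ) (y z : Space n) :
    ‖insertCoord i t y - insertCoord i s z‖ ^ 2 = (t - s) ^ 2 + ‖y - z‖ ^ 2 := by
  rw [EuclideanSpace.norm_sq_eq, EuclideanSpace.norm_sq_eq, Fin.sum_univ_succAbove _ i]
  simp [insertCoord]

lemma norm_insertCoord_sub_left {n : ℕ} (i : Fin (n + 1)) (t : ℝ) (y z : Space n) :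
    ‖insertCoord i t y - insertCoord i t z‖ = ‖y - z‖ := by
  have h := norm_sq_insertCoord_sub i t t y z
  rw [sub_self, zero_pow two_ne_zero, zero_add] at h
  exact (sq_eq_sq₀ (norm_nonneg _) (norm_nonneg _)).1 h

lemma norm_insertCoord_sub_le {n : ℕ} (i : Fin (n + 1)) (t s : ℝ) (y z : Space n) :
    ‖insertCoord i t y - insertCoord i s z‖ ≤ |t - s| + ‖y - z‖ := by
  refine abs_le_of_sq_le_sq' ?_ (by positivity) |>.2
  rw [norm_sq_insertCoord_sub, ← sq_abs (t - s)]
  nlinarith [abs_nonneg (t - s), norm_nonneg (y - z)]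

lemma measurePreserving_insertCoord {n : ℕ} (i : Fin (n + 1)) :
    MeasurePreserving (fun z : ℝ × Space n => insertCoord i z.1 z.2)
      (volume.prod volume) volume := by
  have h1 := (volume_preserving_piFinSuccAbove (fun _ : Fin (n + 1) => ℝ) i).symm
  have h2 := (MeasurePreserving.id (volume : Measure ℝ)).prod (PiLp.volume_preserving_ofLp (Fin n))
  exact (PiLp.volume_preserving_toLp (Fin (n + 1))).comp (h1.comp h2)

/-- The trace inequality near a point of the hypersurface. -/
lemma exists_nhds_lintegral_surface_le {n : ℕ} {Γ : Set (Space (n + 1))} {p : Space (n + 1)}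
    {e : OpenPartialHomeomorph (Space (n + 1)) (Space (n + 1))} (hp : p ∈ e.source) (hpΓ : p ∈ Γ)
    (he : ContDiffOn ℝ 1 e e.source) (he' : ContDiffOn ℝ 1 e.symm e.target) {i : Fin (n + 1)}
    (hi : ∀ x ∈ Γ, x ∈ e.source → e x i = 0) :
    ∃ N ∈ 𝓝 p, ∃ C : ℝ≥0, ∀ η : Space (n + 1) → ℂ, ContDiff ℝ 1 η →
      ∫⁻ x in Γ ∩ N, ‖η x‖ₑ ∂(Measure.euclideanHausdorffMeasure n)
        ≤ C * ∫⁻ x, (‖η x‖ₑ + ‖fderiv ℝ η x‖ₑ) := by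
  have hq : e p ∈ e.target := e.map_source hp
  obtain ⟨K₁, s₁, hs₁, hK₁⟩ :=
    (he.contDiffAt (e.open_source.mem_nhds hp)).exists_lipschitzOnWith
  obtain ⟨K₂, s₂, hs₂, hK₂⟩ :=
    (he'.contDiffAt (e.open_target.mem_nhds hq)).exists_lipschitzOnWith
  have hT : e.target ∩ s₂ ∩ e.symm ⁻¹' s₁ ∈ 𝓝 (e p) := by
    refine inter_mem (inter_mem (e.open_target.mem_nhds hq) hs₂) ?_
    refine (e.continuousAt_symm hq).preimage_mem_nhds ?_
    rwa [e.left_inv hp]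
  obtain ⟨r, hr, hball⟩ := Metric.mem_nhds_iff.1 hT
  set D := Metric.ball (e p) r with hD
  have hDt : D ⊆ e.target := fun y hy => (hball hy).1.1
  have hDs₂ : D ⊆ s₂ := fun y hy => (hball hy).1.2
  have hDs₁ : ∀ y ∈ D, e.symm y ∈ s₁ := fun y hy => (hball hy).2
  -- Half the radius: a tangential displacement below `ρ` together with a normal one of at most `ρ`
  -- stays inside `D`.
  set ρ := r / 2 with hρ
  have hρ0 : 0 < ρ := by positivity
  set q' := deleteCoord i (e p) with hq'
  have hqi : insertCoord i 0 q' = e p := by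
    rw [← hi p hpΓ hp]; exact insertCoord_deleteCoord i (e p)
  set B := Metric.ball q' ρ with hB
  have hins : ∀ y ∈ B, ∀ t ∈ Set.Icc 0 ρ, insertCoord i t y ∈ D := by
    intro y hy t ht
    rw [hD, mem_ball_iff_norm, ← hqi]
    rw [hB, mem_ball_iff_norm] at hy
    calc _ ≤ |t - 0| + ‖y - q'‖ := norm_insertCoord_sub_le _ _ _ _ _
      _ < ρ + ρ := by
        rw [sub_zero, abs_of_nonneg ht.1]; exact add_lt_add_of_le_of_lt ht.2 hy
      _ = r := by rw [hρ]; ring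
  set Ψ : Space n → Space (n + 1) := fun y => e.symm (insertCoord i 0 y) with hΨ
  have hΨL : LipschitzOnWith K₂ Ψ B := by
    refine LipschitzOnWith.of_dist_le_mul fun y hy z hz => ?_
    have h := hK₂.dist_le_mul _ (hDs₂ (hins y hy 0 ⟨le_rfl, hρ0.le⟩)) _
      (hDs₂ (hins z hz 0 ⟨le_rfl, hρ0.le⟩))
    rwa [dist_eq_norm (insertCoord i 0 y), norm_insertCoord_sub_left, ← dist_eq_norm] at h
  set N := e.source ∩ e ⁻¹' Metric.ball (e p) ρ with hN
  have hNp : N ∈ 𝓝 p := inter_mem (e.open_source.mem_nhds hp)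
    ((e.continuousAt hp).preimage_mem_nhds (Metric.ball_mem_nhds _ hρ0))
  have hΓN : Γ ∩ N ⊆ Ψ '' B := by
    rintro x ⟨hxΓ, hxs, hxb⟩
    have h1 : insertCoord i 0 (deleteCoord i (e x)) = e x := by
      rw [← hi x hxΓ hxs]; exact insertCoord_deleteCoord i (e x)
    refine ⟨deleteCoord i (e x), ?_, ?_⟩
    · rw [hB, mem_ball_iff_norm, ← norm_insertCoord_sub_left i 0, h1, hqi]
      exact mem_ball_iff_norm.1 hxb
    · rw [hΨ]; dsimp only; rw [h1, e.left_inv hxs]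
  -- `K₂ ^ n` comes from the parametrization `Ψ` of the surface, `ρ⁻¹` from averaging over
  -- transversal segments, `K₁ ^ (n + 1)` from the return to the original coordinates, and the last
  -- factor from the integrand `h`.
  refine ⟨N, hNp, K₂ ^ n * (Real.toNNReal ρ)⁻¹ * K₁ ^ (n + 1) * (1 + Real.toNNReal ρ * K₂),
    fun η hη => ?_⟩
  set h : Space (n + 1) → ℝ≥0∞ := fun x =>
    ‖η x‖ₑ + ENNReal.ofReal ρ * (K₂ * ‖fderiv ℝ η x‖ₑ) with hh
  have hηm : Measurable fun x => ‖η x‖ₑ := hη.continuous.measurable.enorm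
  have hηm' : Measurable fun x => ‖fderiv ℝ η x‖ₑ :=
    (hη.continuous_fderiv (by simp)).measurable.enorm
  have hhm : Measurable h := hηm.add ((hηm'.const_mul _).const_mul _)
  -- the estimate along the segments transversal to the hypersurface
  have hseg : ∀ y ∈ B, ENNReal.ofReal ρ * ‖η (Ψ y)‖ₑ
      ≤ ∫⁻ t in Set.Icc 0 ρ, h (e.symm (insertCoord i t y)) := by
    intro y hy
    set γ : ℝ → Space (n + 1) := fun t => e.symm (insertCoord i t y) with hγ
    have hinsc : ContDiff ℝ 1 fun t => insertCoord i t y := by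
      have heq : (fun t => insertCoord i t y)
          = fun t => insertCoord i 0 y + t • EuclideanSpace.single i (1 : ℝ) :=
        funext fun t => insertCoord_eq_add i t y
      rw [heq]
      exact contDiff_const.add (contDiff_id.smul contDiff_const)
    have hγc : ContDiffOn ℝ 1 γ (Set.Icc 0 ρ) :=
      he'.comp hinsc.contDiffOn fun t ht => hDt (hins y hy t ht)
    have hθc : ContDiffOn ℝ 1 (fun t => η (γ t)) (Set.Icc 0 ρ) := hη.comp_contDiffOn hγc
    have hderiv : ∀ t ∈ Set.Icc 0 ρ, ‖deriv (fun t => η (γ t)) t‖ₑ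
        ≤ K₂ * ‖fderiv ℝ η (γ t)‖ₑ := by
      intro t ht
      have hDn : ∀ᶠ s in 𝓝 t, insertCoord i s y ∈ D :=
        hinsc.continuous.continuousAt.preimage_mem_nhds
          (Metric.isOpen_ball.mem_nhds (hins y hy t ht))
      have h1 : DifferentiableAt ℝ γ t := by
        have h2 := (he'.contDiffAt (e.open_target.mem_nhds
          (hDt (hins y hy t ht)))).differentiableAt (by simp)
        exact h2.comp t (hinsc.differentiable (by simp) t)
      have h3 : ‖deriv γ t‖ ≤ K₂ := by
        refine norm_deriv_le_of_lipschitzOn (s := {s | insertCoord i s y ∈ D}) hDn ?_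
        refine LipschitzOnWith.of_dist_le_mul fun a ha b hb => ?_
        have h4 := hK₂.dist_le_mul _ (hDs₂ ha) _ (hDs₂ hb)
        refine h4.trans (mul_le_mul_of_nonneg_left ?_ K₂.2)
        rw [dist_eq_norm, Real.dist_eq]
        simpa using norm_insertCoord_sub_le i a b y y
      have h5 : HasDerivAt (fun t => η (γ t)) (fderiv ℝ η (γ t) (deriv γ t)) t :=
        (hη.differentiable (by simp) (γ t)).hasFDerivAt.comp_hasDerivAt t h1.hasDerivAt
      rw [h5.deriv, mul_comm]
      refine (ContinuousLinearMap.le_opENorm _ _).trans ?_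
      gcongr
      rw [← ofReal_norm]
      exact ENNReal.ofReal_le_of_le_toReal (by simpa using h3)
    -- The fundamental theorem of calculus along `γ` from 0 to `t`. Integrating over `t` in `[0, ρ]`
    -- replaces the free endpoint value by a solid integral.
    have hpt : ∀ t ∈ Set.Icc 0 ρ, ‖η (Ψ y)‖ₑ
        ≤ ‖η (γ t)‖ₑ + ∫⁻ s in Set.Icc 0 ρ, K₂ * ‖fderiv ℝ η (γ s)‖ₑ := by
      intro t ht
      have h1 := enorm_sub_le_lintegral_deriv_of_contDiffOn_Icc
        (hθc.mono (Set.Icc_subset_Icc_right ht.2)) ht.1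
      have h2 : η (Ψ y) = η (γ t) - (η (γ t) - η (γ 0)) := by simp [hγ, hΨ]
      rw [h2]
      refine enorm_sub_le.trans ?_
      gcongr
      refine h1.trans ((lintegral_mono_set (Set.Icc_subset_Icc_right ht.2)).trans ?_)
      exact setLIntegral_mono' measurableSet_Icc hderiv
    have hγm : AEMeasurable γ (volume.restrict (Set.Icc 0 ρ)) :=
      hγc.continuousOn.aemeasurable measurableSet_Icc
    have hvol : (volume : Measure ℝ) (Set.Icc 0 ρ) = ENNReal.ofReal ρ := by simp
    calc ENNReal.ofReal ρ * ‖η (Ψ y)‖ₑ = ∫⁻ t in Set.Icc 0 ρ, ‖η (Ψ y)‖ₑ := by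
          rw [setLIntegral_const, hvol, mul_comm]
      _ ≤ ∫⁻ t in Set.Icc 0 ρ, (‖η (γ t)‖ₑ
            + ∫⁻ s in Set.Icc 0 ρ, K₂ * ‖fderiv ℝ η (γ s)‖ₑ) :=
          setLIntegral_mono' measurableSet_Icc hpt
      _ = (∫⁻ t in Set.Icc 0 ρ, ‖η (γ t)‖ₑ)
            + ENNReal.ofReal ρ * ∫⁻ s in Set.Icc 0 ρ, K₂ * ‖fderiv ℝ η (γ s)‖ₑ := by
          rw [lintegral_add_right _ measurable_const, setLIntegral_const, hvol, mul_comm]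
      _ = ∫⁻ t in Set.Icc 0 ρ, h (γ t) := by
          rw [← lintegral_const_mul' _ _ ENNReal.ofReal_ne_top,
            ← lintegral_add_left' (f := fun t => ‖η (γ t)‖ₑ) (hηm.comp_aemeasurable hγm)]
  -- change of variables
  set g : Space (n + 1) → ℝ≥0∞ := D.indicator fun y => h (e.symm y) with hg
  have hgm : Measurable g := by
    have hc : ContinuousOn (fun y => h (e.symm y)) D := by
      have h1 : ContinuousOn e.symm D := e.continuousOn_symm.mono hDt
      have hhc : Continuous h := by
        refine hη.continuous.enorm.add ?_
        refine ENNReal.continuous_const_mul ENNReal.ofReal_ne_top |>.comp ?_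
        exact (ENNReal.continuous_const_mul ENNReal.coe_ne_top).comp
          (hη.continuous_fderiv (by simp)).enorm
      exact hhc.comp_continuousOn h1
    classical
    rw [hg, ← Set.piecewise_eq_indicator]
    exact hc.measurable_piecewise continuousOn_const measurableSet_ball
  -- No Jacobian is needed: `D` is the image of `e.symm '' D` under the Lipschitz map `e`, and the
  -- Hausdorff measure estimate applies with source and target both of dimension `n + 1`.
  have hcov : ∫⁻ y, g y ≤ (K₁ : ℝ≥0∞) ^ (n + 1) * ∫⁻ x, h x := by
    have himg : e '' (e.symm '' D) = D := by
      rw [Set.image_image]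
      refine Set.EqOn.image_eq_self fun y hy => ?_
      exact e.right_inv (hDt hy)
    have hBm : MeasurableSet (e.symm '' D) :=
      (e.symm.isOpen_image_of_subset_source Metric.isOpen_ball hDt).measurableSet
    have hL : LipschitzOnWith K₁ e (e.symm '' D) := hK₁.mono (by
      rintro _ ⟨y, hy, rfl⟩; exact hDs₁ y hy)
    have h1 := setLIntegral_image_le_of_lipschitzOnWith hBm hL hgm
    rw [himg, EuclideanSpace.euclideanHausdorffMeasure_eq_volume] at h1
    have h2 : ∫⁻ y, g y = ∫⁻ y in D, g y := by
      rw [hg, lintegral_indicator measurableSet_ball, setLIntegral_indicator measurableSet_ball,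
        Set.inter_self]
    rw [h2]
    refine h1.trans ?_
    refine mul_le_mul_of_nonneg_left ?_ zero_le
    refine (le_of_eq (setLIntegral_congr_fun hBm ?_)).trans (setLIntegral_le_lintegral _ h)
    rintro _ ⟨y, hy, rfl⟩
    simp only [hg, e.right_inv (hDt hy), Set.indicator_of_mem hy]
  have hfub : ∫⁻ y in B, ∫⁻ t in Set.Icc 0 ρ, h (e.symm (insertCoord i t y)) ≤ ∫⁻ y, g y := by
    rw [← (measurePreserving_insertCoord i).lintegral_comp hgm, lintegral_prod_symm']
    · refine le_trans ?_ (setLIntegral_le_lintegral B _)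
      refine setLIntegral_mono' measurableSet_ball fun y hy => ?_
      refine le_trans ?_ (setLIntegral_le_lintegral (Set.Icc 0 ρ) _)
      refine setLIntegral_mono' measurableSet_Icc fun t ht => ?_
      rw [hg, Set.indicator_of_mem (hins y hy t ht)]
    · exact hgm.comp (measurePreserving_insertCoord i).measurable
  have hρ' : ENNReal.ofReal ρ ≠ 0 := by simpa using hρ0
  have hmain : ∫⁻ y in B, ‖η (Ψ y)‖ₑ
      ≤ (ENNReal.ofReal ρ)⁻¹ * ((K₁ : ℝ≥0∞) ^ (n + 1) * ∫⁻ x, h x) := by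
    rw [← ENNReal.mul_le_iff_le_inv hρ' ENNReal.ofReal_ne_top,
      ← lintegral_const_mul' _ _ ENNReal.ofReal_ne_top]
    exact (setLIntegral_mono' measurableSet_ball hseg).trans (hfub.trans hcov)
  have hhle : ∫⁻ x, h x ≤ (1 + ENNReal.ofReal ρ * K₂) * ∫⁻ x, (‖η x‖ₑ + ‖fderiv ℝ η x‖ₑ) := by
    rw [← lintegral_const_mul' _ _ (by finiteness)]
    refine lintegral_mono fun x => ?_
    simp only [hh]
    rw [add_mul, one_mul, mul_add, mul_assoc, mul_assoc]
    calc _ ≤ ‖η x‖ₑ + ENNReal.ofReal ρ * (K₂ * ‖fderiv ℝ η x‖ₑ) := le_rfl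
      _ ≤ _ := add_le_add le_self_add le_add_self
  calc ∫⁻ x in Γ ∩ N, ‖η x‖ₑ ∂(Measure.euclideanHausdorffMeasure n)
      ≤ ∫⁻ x in Ψ '' B, ‖η x‖ₑ ∂(Measure.euclideanHausdorffMeasure n) := lintegral_mono_set hΓN
    _ ≤ (K₂ : ℝ≥0∞) ^ n * ∫⁻ y in B, ‖η (Ψ y)‖ₑ :=
        setLIntegral_image_le_of_lipschitzOnWith measurableSet_ball hΨL hηm
    _ ≤ (K₂ : ℝ≥0∞) ^ n * ((ENNReal.ofReal ρ)⁻¹ * ((K₁ : ℝ≥0∞) ^ (n + 1) *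
          ((1 + ENNReal.ofReal ρ * K₂) * ∫⁻ x, (‖η x‖ₑ + ‖fderiv ℝ η x‖ₑ)))) := by
        gcongr
        exact hmain.trans (by gcongr)
    _ = _ := by
        have : Real.toNNReal ρ ≠ 0 := by simpa using hρ0
        push_cast [ENNReal.coe_inv this]
        simp only [ENNReal.ofReal, mul_assoc]

/-- The trace inequality: restriction to a compact `C²` hypersurface is bounded from `W^{1,1}` to
`L¹` of the surface measure. -/
theorem IsCompactHypersurface.exists_lintegral_le {d : ℕ} (hd : 1 ≤ d) {Γ : Set (Space d)}
    (hΓ : IsCompactHypersurface Γ) :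
    ∃ C : ℝ≥0, ∀ η : Space d → ℂ, ContDiff ℝ 1 η →
      ∫⁻ x, ‖η x‖ₑ ∂(surfaceMeasure Γ) ≤ C * ∫⁻ x, (‖η x‖ₑ + ‖fderiv ℝ η x‖ₑ) := by
  obtain ⟨n, rfl⟩ : ∃ n, d = n + 1 := ⟨d - 1, by omega⟩
  simp only [surfaceMeasure, Nat.add_sub_cancel]
  refine hΓ.isCompact.induction_on (p := fun s => ∃ C : ℝ≥0, ∀ η : Space (n + 1) → ℂ,
    ContDiff ℝ 1 η → ∫⁻ x in s, ‖η x‖ₑ ∂(Measure.euclideanHausdorffMeasure n)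
      ≤ C * ∫⁻ x, (‖η x‖ₑ + ‖fderiv ℝ η x‖ₑ)) ⟨0, by simp⟩ ?_ ?_ ?_
  · rintro s t hst ⟨C, hC⟩
    exact ⟨C, fun η hη => (lintegral_mono_set hst).trans (hC η hη)⟩
  · rintro s t ⟨C, hC⟩ ⟨C', hC'⟩
    refine ⟨C + C', fun η hη => (lintegral_union_le _ _ _).trans ?_⟩
    rw [ENNReal.coe_add, add_mul]
    exact add_le_add (hC η hη) (hC' η hη)
  · intro p hp
    obtain ⟨e, hpe, he, he', hcase⟩ := hΓ.chart p hp
    -- Only the inclusion of `Γ` in a coordinate hyperplane matters for an upper bound, so boundary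
    -- points are treated like interior ones.
    have hi : ∃ i, ∀ x ∈ Γ, x ∈ e.source → e x i = 0 := by
      rcases hcase with ⟨i, hi⟩ | ⟨i, j, -, hi⟩
      · refine ⟨i, fun x hx hxs => ?_⟩
        have : e x ∈ e '' (Γ ∩ e.source) := ⟨x, ⟨hx, hxs⟩, rfl⟩
        rw [hi] at this
        exact this.2
      · refine ⟨i, fun x hx hxs => ?_⟩
        have : e x ∈ e '' (Γ ∩ e.source) := ⟨x, ⟨hx, hxs⟩, rfl⟩
        rw [hi] at this
        exact this.2.1
    obtain ⟨i, hi⟩ := hi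
    obtain ⟨N, hN, C, hC⟩ := exists_nhds_lintegral_surface_le hpe hp (he.of_le one_le_two)
      (he'.of_le one_le_two) hi
    exact ⟨Γ ∩ N, inter_mem_nhdsWithin Γ hN, C, hC⟩

end SingularSchrodinger

namespace SingularSchrodinger

variable {d : ℕ} {Γ : Set (Space d)}

/-! ### Limits of norms and products -/

lemma tendsto_eLpNorm_of_tendsto_sub {α E : Type*} [MeasurableSpace α] {μ : Measure α}
    [NormedAddCommGroup E] {f : α → E} {fn : ℕ → α → E} (hf : MemLp f 2 μ)
    (hfn : ∀ n, MemLp (fn n) 2 μ)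
    (h : Tendsto (fun n => eLpNorm (fn n - f) 2 μ) atTop (𝓝 0)) :
    Tendsto (fun n => eLpNorm (fn n) 2 μ) atTop (𝓝 (eLpNorm f 2 μ)) := by
  have h1 : Tendsto (fun n => (hfn n).toLp (fn n)) atTop (𝓝 (hf.toLp f)) :=
    (Lp.tendsto_Lp_iff_tendsto_eLpNorm'' _ _ _ _).2 h
  have h2 := h1.enorm
  simpa only [Lp.enorm_toLp] using h2

lemma tendsto_eLpNorm_one_smul_sub {α E : Type*} [MeasurableSpace α] {μ : Measure α}
    [NormedAddCommGroup E] [NormedSpace ℂ E] {f : α → ℂ} {g : α → E} {fn : ℕ → α → ℂ}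
    {gn : ℕ → α → E} (hf : MemLp f 2 μ) (hg : MemLp g 2 μ) (hfn : ∀ n, MemLp (fn n) 2 μ)
    (hgn : ∀ n, MemLp (gn n) 2 μ)
    (hflim : Tendsto (fun n => eLpNorm (fn n - f) 2 μ) atTop (𝓝 0))
    (hglim : Tendsto (fun n => eLpNorm (gn n - g) 2 μ) atTop (𝓝 0)) :
    Tendsto (fun n => eLpNorm (fn n • gn n - f • g) 1 μ) atTop (𝓝 0) := by
  have hlim : Tendsto (fun n => eLpNorm (fn n - f) 2 μ * eLpNorm (gn n) 2 μ
      + eLpNorm f 2 μ * eLpNorm (gn n - g) 2 μ) atTop (𝓝 0) := by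
    have h1 := ENNReal.Tendsto.mul hflim (Or.inr hg.2.ne)
      (tendsto_eLpNorm_of_tendsto_sub hg hgn hglim) (Or.inr (by simp))
    have h2 := ENNReal.Tendsto.const_mul (a := eLpNorm f 2 μ) hglim (Or.inr hf.2.ne)
    simpa using h1.add h2
  refine tendsto_of_tendsto_of_tendsto_of_le_of_le tendsto_const_nhds hlim (fun _ => zero_le)
    fun n => ?_
  have h1 : fn n • gn n - f • g = (fn n - f) • gn n + f • (gn n - g) := by
    ext x
    simp [sub_smul, smul_sub]
  dsimp only
  rw [h1]
  have hm1 := (hfn n).sub hf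
  have hm2 := (hgn n).sub hg
  refine (eLpNorm_add_le (hm1.1.smul (hgn n).1) (hf.1.smul hm2.1) le_rfl).trans ?_
  gcongr
  · exact eLpNorm_smul_le_mul_eLpNorm (hgn n).1 hm1.1
  · exact eLpNorm_smul_le_mul_eLpNorm hm2.1 hf.1

/-! ### The trace inequality in `W^{1,2}` -/

lemma norm_fderiv_le_grad (f : Space d → ℂ) (x : Space d) :
    ‖fderiv ℝ f x‖ ≤ d * ‖grad f x‖ := by
  refine (norm_fderiv_le_sum f x).trans ?_
  calc ∑ i, ‖grad f x i‖ ≤ ∑ _i : Fin d, ‖grad f x‖ :=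
        Finset.sum_le_sum fun i _ => PiLp.norm_apply_le _ i
    _ = d * ‖grad f x‖ := by simp

lemma enorm_fderiv_le_grad (f : Space d → ℂ) (x : Space d) :
    ‖fderiv ℝ f x‖ₑ ≤ d * ‖grad f x‖ₑ := by
  rw [← ofReal_norm, ← ofReal_norm, ← ENNReal.ofReal_natCast,
    ← ENNReal.ofReal_mul (Nat.cast_nonneg d)]
  exact ENNReal.ofReal_le_ofReal (norm_fderiv_le_grad f x)

/-- The `W^{1,1}` inequality is applied to the complex square `η * η`, whose gradient is at most `2
|η| |∇η|` up to a dimensional factor. Young's inequality with the parameter `ε` makes the gradient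
coefficient as small as desired, which is what coercivity of the form requires. -/
lemma IsCompactHypersurface.exists_lintegral_sq_le (hd : 1 ≤ d) (hΓ : IsCompactHypersurface Γ) :
    ∃ C : ℝ, 0 < C ∧ ∀ ε : ℝ, 0 < ε → ∀ η : Space d → ℂ, ContDiff ℝ 1 η →
      ∫⁻ x, ‖η x‖ₑ ^ (2 : ℝ) ∂(surfaceMeasure Γ)
        ≤ ENNReal.ofReal (C * (1 + ε⁻¹)) * (∫⁻ x, ‖η x‖ₑ ^ (2 : ℝ))
          + ENNReal.ofReal (C * ε) * ∫⁻ x, ‖grad η x‖ₑ ^ (2 : ℝ) := by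
  obtain ⟨C, hC⟩ := hΓ.exists_lintegral_le hd
  -- The dimension enters through `‖fderiv ℝ η x‖ ≤ d * ‖grad η x‖`; adding one makes the constant
  -- positive and lets it cover the zero order term.
  refine ⟨(C + 1) * (d ^ 2 + 1), by positivity, fun ε hε η hη => ?_⟩
  have h1 := hC (fun x => η x * η x) (hη.mul hη)
  have hleft : ∀ x, ‖η x‖ₑ ^ (2 : ℝ) = ‖η x * η x‖ₑ := fun x => by
    rw [enorm_mul, ENNReal.rpow_two, sq]
  simp only [hleft]
  refine h1.trans ?_
  have hm : AEMeasurable (fun x => ‖η x * η x‖ₑ) volume :=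
    (hη.continuous.mul hη.continuous).measurable.enorm.aemeasurable
  rw [← lintegral_const_mul' _ _ ENNReal.ofReal_ne_top,
    ← lintegral_const_mul' _ _ ENNReal.ofReal_ne_top, ← lintegral_const_mul' _ _ (by simp),
    ← lintegral_add_left' (hm.const_mul _)]
  refine lintegral_mono fun x => ?_
  have h2 : HasFDerivAt (fun x => η x * η x) (η x • fderiv ℝ η x + η x • fderiv ℝ η x) x :=
    ((hη.differentiable (by simp) x).hasFDerivAt.mul (hη.differentiable (by simp) x).hasFDerivAt)
  have h3 : ‖fderiv ℝ (fun x => η x * η x) x‖ ≤ 2 * ‖η x‖ * (d * ‖grad η x‖) := by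
    rw [h2.fderiv]
    refine (norm_add_le _ _).trans ?_
    rw [norm_smul]
    have := mul_le_mul_of_nonneg_left (norm_fderiv_le_grad η x) (norm_nonneg (η x))
    linarith
  rw [← ofReal_norm, ← ofReal_norm (fderiv ℝ _ x), ← ofReal_norm (grad η x),
    ENNReal.ofReal_rpow_of_nonneg (norm_nonneg _) (by norm_num), ← ENNReal.ofReal_add
      (norm_nonneg _) (norm_nonneg _), ← ENNReal.ofReal_coe_nnreal, ← ENNReal.ofReal_mul (NNReal.coe_nonneg C),
    ← ENNReal.ofReal_mul (by positivity), ← ENNReal.ofReal_mul (by positivity),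
    ← ENNReal.ofReal_add (by positivity) (by positivity)]
  refine ENNReal.ofReal_le_ofReal ?_
  rw [norm_mul, Real.rpow_two]
  set a := ‖η x‖
  set b := ‖grad η x‖
  have ha : 0 ≤ a := norm_nonneg _
  have hb : 0 ≤ b := norm_nonneg _
  have hC0 : (0 : ℝ) ≤ C := C.2
  have h4 : 2 * a * (d * b) ≤ ε⁻¹ * a ^ 2 + ε * (d ^ 2 * b ^ 2) := by
    have h5 : 0 ≤ ε * (ε⁻¹ * a - d * b) ^ 2 := by positivity
    have h6 : ε * (ε⁻¹ * a - d * b) ^ 2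
        = ε⁻¹ * a ^ 2 + ε * (d ^ 2 * b ^ 2) - 2 * a * (d * b) := by
      field_simp
      ring
    linarith
  have hε' : 0 < ε⁻¹ := inv_pos.2 hε
  calc (C : ℝ) * (a * a + ‖fderiv ℝ (fun x => η x * η x) x‖)
      ≤ (C + 1) * (a ^ 2 + (ε⁻¹ * a ^ 2 + ε * (d ^ 2 * b ^ 2))) := by
        refine mul_le_mul (by linarith) ?_ (by positivity) (by positivity)
        rw [← sq]; linarith
    _ ≤ _ := by
        have h7 : (0 : ℝ) ≤ (C + 1) * ((d : ℝ) ^ 2 * (a ^ 2 * (1 + ε⁻¹)) + ε * b ^ 2) := by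
          positivity
        nlinarith [h7]

/-- The norm of `W^{1,2}(ℝ^d)`. -/
noncomputable def normW12 (f : Space d → ℂ) : ℝ≥0∞ :=
  eLpNorm f 2 volume + eLpNorm (weakGrad f) 2 volume

lemma normW12_sub_le {f g h : Space d → ℂ} (hf : MemW12 volume f) (hg : MemW12 volume g)
    (hh : MemW12 volume h) : normW12 (f - g) ≤ normW12 (f - h) + normW12 (g - h) := by
  have h1 : f - g = (f - h) - (g - h) := by abel
  have h2 : weakGrad (f - g) =ᵐ[volume] weakGrad (f - h) - weakGrad (g - h) := by
    conv_lhs => rw [h1]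
    exact (hf.sub hh).weakGrad_sub (hg.sub hh)
  have h3 : eLpNorm (f - g) 2 volume ≤ eLpNorm (f - h) 2 volume + eLpNorm (g - h) 2 volume := by
    conv_lhs => rw [h1]
    exact eLpNorm_sub_le (hf.sub hh).memLp.1 (hg.sub hh).memLp.1 one_le_two
  have h4 : eLpNorm (weakGrad (f - g)) 2 volume
      ≤ eLpNorm (weakGrad (f - h)) 2 volume + eLpNorm (weakGrad (g - h)) 2 volume := by
    rw [eLpNorm_congr_ae h2]
    exact eLpNorm_sub_le (hf.sub hh).memLp_weakGrad_volume.1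
      (hg.sub hh).memLp_weakGrad_volume.1 one_le_two
  unfold normW12
  refine (add_le_add h3 h4).trans (le_of_eq ?_)
  ring

lemma weakGrad_ae_eq_grad {η : Space d → ℂ} (hη : ContDiff ℝ 1 η) :
    weakGrad η =ᵐ[volume] grad η :=
  hη.hasWeakGradient.weakGrad_ae_eq

lemma IsCompactHypersurface.exists_eLpNorm_le (hd : 1 ≤ d) (hΓ : IsCompactHypersurface Γ) :
    ∃ C : ℝ≥0, ∀ η : Space d → ℂ, ContDiff ℝ 1 η →
      eLpNorm η 2 (surfaceMeasure Γ) ≤ C * normW12 η := by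
  obtain ⟨C, hC0, hC⟩ := hΓ.exists_lintegral_sq_le hd
  refine ⟨(Real.toNNReal (C * 2)) ^ (1 / 2 : ℝ), fun η hη => ?_⟩
  have h1 := hC 1 one_pos η hη
  have h2 : ENNReal.ofReal (C * 1) ≤ ENNReal.ofReal (C * 2) :=
    ENNReal.ofReal_le_ofReal (by linarith)
  have h3 : (1 : ℝ) + 1⁻¹ = 2 := by norm_num
  rw [h3, ← eLpNorm_two_rpow_two, ← eLpNorm_two_rpow_two, ← eLpNorm_two_rpow_two] at h1
  have h4 : eLpNorm η 2 (surfaceMeasure Γ) ^ (2 : ℝ)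
      ≤ ENNReal.ofReal (C * 2) * (normW12 η) ^ (2 : ℝ) := by
    refine h1.trans ((add_le_add_right (mul_le_mul_of_nonneg_right h2 zero_le) _).trans ?_)
    rw [← mul_add]
    refine mul_le_mul_of_nonneg_left ?_ zero_le
    rw [normW12, eLpNorm_congr_ae (weakGrad_ae_eq_grad hη)]
    exact ENNReal.add_rpow_le_rpow_add _ _ one_le_two
  have h5 := ENNReal.rpow_le_rpow h4 (z := 1 / 2) (by norm_num)
  rw [ENNReal.mul_rpow_of_nonneg _ _ (by norm_num), ← ENNReal.rpow_mul, ← ENNReal.rpow_mul] at h5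
  norm_num at h5
  refine h5.trans (le_of_eq ?_)
  rw [ENNReal.coe_rpow_of_nonneg _ (by norm_num)]
  norm_num [ENNReal.ofReal]

/-! ### The trace map -/

/-- Sequences of test functions. -/
def IsTestSeq (η : ℕ → Space d → ℂ) : Prop :=
  ∀ n, ContDiff ℝ ∞ (η n) ∧ HasCompactSupport (η n)

lemma IsTestSeq.contDiff_one {η : ℕ → Space d → ℂ} (h : IsTestSeq η) (n : ℕ) :
    ContDiff ℝ 1 (η n) := (h n).1.of_le (by exact_mod_cast le_top)

lemma IsTestSeq.memW12 {η : ℕ → Space d → ℂ} (h : IsTestSeq η) (n : ℕ) : MemW12 volume (η n) :=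
  memW12_of_contDiff (h.contDiff_one n) (h n).2

lemma normW12_lt_top {f : Space d → ℂ} (hf : MemW12 volume f) : normW12 f < ⊤ :=
  ENNReal.add_lt_top.2 ⟨hf.memLp.2, hf.memLp_weakGrad_volume.2⟩

lemma IsCompactHypersurface.memLp_surface (hd : 1 ≤ d) (hΓ : IsCompactHypersurface Γ)
    {η : Space d → ℂ} (hη : ContDiff ℝ 1 η) (hc : HasCompactSupport η) :
    MemLp η 2 (surfaceMeasure Γ) := by
  obtain ⟨C, hC⟩ := hΓ.exists_eLpNorm_le hd
  refine ⟨hη.continuous.aestronglyMeasurable, (hC η hη).trans_lt ?_⟩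
  exact ENNReal.mul_lt_top ENNReal.coe_lt_top (normW12_lt_top (memW12_of_contDiff hη hc))

/-- Sequences of test functions with the same limit in `W^{1,2}` have the same limit on `Γ`. -/
lemma IsCompactHypersurface.tendsto_surface (hd : 1 ≤ d) (hΓ : IsCompactHypersurface Γ)
    {f g : Space d → ℂ} (hf : MemW12 volume f) {η ζ : ℕ → Space d → ℂ} (hη : IsTestSeq η)
    (hζ : IsTestSeq ζ) (hηf : TendstoW12 η f) (hζf : TendstoW12 ζ f)
    (hg : MemLp g 2 (surfaceMeasure Γ))
    (hηg : Tendsto (fun n => eLpNorm (η n - g) 2 (surfaceMeasure Γ)) atTop (𝓝 0)) :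
    Tendsto (fun n => eLpNorm (ζ n - g) 2 (surfaceMeasure Γ)) atTop (𝓝 0) := by
  obtain ⟨C, hC⟩ := hΓ.exists_eLpNorm_le hd
  have h1 : Tendsto (fun n => C * (normW12 (ζ n - f) + normW12 (η n - f))
      + eLpNorm (η n - g) 2 (surfaceMeasure Γ)) atTop (𝓝 0) := by
    have h2 := (ENNReal.Tendsto.const_mul (a := (C : ℝ≥0∞)) (Tendsto.add hζf hηf)
      (Or.inr ENNReal.coe_ne_top)).add hηg
    simpa [normW12] using h2
  refine tendsto_of_tendsto_of_tendsto_of_le_of_le tendsto_const_nhds h1 (fun _ => zero_le)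
    fun n => ?_
  have h2 : ζ n - g = (ζ n - η n) + (η n - g) := by abel
  have h3 : ContDiff ℝ 1 (ζ n - η n) := (hζ.contDiff_one n).sub (hη.contDiff_one n)
  dsimp only
  rw [h2]
  refine (eLpNorm_add_le h3.continuous.aestronglyMeasurable
    ((hη.contDiff_one n).continuous.aestronglyMeasurable.sub hg.1) one_le_two).trans ?_
  gcongr
  refine (hC _ h3).trans ?_
  gcongr
  exact normW12_sub_le (hζ.memW12 n) (hη.memW12 n) hf

/-- By the trace inequality for differences, the restrictions to `Γ` of approximating test functions
form a Cauchy sequence in `L²(σ_Γ)`. -/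
lemma IsCompactHypersurface.exists_isTrace (hd : 1 ≤ d) (hΓ : IsCompactHypersurface Γ)
    {f : Space d → ℂ} (hf : MemW12 volume f) : ∃ g, IsTrace Γ f g := by
  obtain ⟨η, hη, hηf, -⟩ := hf.exists_tendstoW12
  have hη' : IsTestSeq η := hη
  obtain ⟨C, hC⟩ := hΓ.exists_eLpNorm_le hd
  have hmem : ∀ n, MemLp (η n) 2 (surfaceMeasure Γ) := fun n =>
    hΓ.memLp_surface hd (hη'.contDiff_one n) (hη n).2
  have hcauchy : CauchySeq fun n => (hmem n).toLp (η n) := by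
    rw [EMetric.cauchySeq_iff]
    intro ε hε
    have h1 : Tendsto (fun n => (C : ℝ≥0∞) * normW12 (η n - f)) atTop (𝓝 0) := by
      have h2 := ENNReal.Tendsto.const_mul (a := (C : ℝ≥0∞)) hηf (Or.inr ENNReal.coe_ne_top)
      simpa [normW12] using h2
    obtain ⟨N, hN⟩ := eventually_atTop.1 (h1.eventually_lt_const (ENNReal.half_pos hε.ne'))
    refine ⟨N, fun m hm n hn => ?_⟩
    rw [Lp.edist_toLp_toLp]
    have h3 : ContDiff ℝ 1 (η m - η n) := (hη'.contDiff_one m).sub (hη'.contDiff_one n)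
    calc _ ≤ C * normW12 (η m - η n) := hC _ h3
      _ ≤ C * (normW12 (η m - f) + normW12 (η n - f)) := by
          gcongr
          exact normW12_sub_le (hη'.memW12 m) (hη'.memW12 n) hf
      _ < ε / 2 + ε / 2 := by
          rw [mul_add]
          exact ENNReal.add_lt_add (hN m hm) (hN n hn)
      _ = ε := ENNReal.add_halves ε
  obtain ⟨g, hg⟩ := cauchySeq_tendsto_of_complete hcauchy
  refine ⟨g, Lp.memLp g, η, hη, hηf, ?_⟩
  rw [Lp.tendsto_Lp_iff_tendsto_eLpNorm'] at hg
  refine hg.congr fun n => eLpNorm_congr_ae ?_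
  filter_upwards [(hmem n).coeFn_toLp] with x hx
  simp [hx]

section Trace

variable (hd : 1 ≤ d) (hΓ : IsCompactHypersurface Γ) {f g : Space d → ℂ}

include hd hΓ

lemma isTrace_trace (hf : MemW12 volume f) : IsTrace Γ f (trace Γ f) := by
  have h := hΓ.exists_isTrace hd hf
  rw [trace, dif_pos h]
  exact h.choose_spec

lemma memLp_trace (hf : MemW12 volume f) : MemLp (trace Γ f) 2 (surfaceMeasure Γ) :=
  (isTrace_trace hd hΓ hf).1

/-- Any approximating sequence computes the trace, not only the one that witnesses the chosen
function. All later limit arguments on `Γ` rely on this freedom. -/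
lemma tendsto_eLpNorm_sub_trace (hf : MemW12 volume f) {η : ℕ → Space d → ℂ} (hη : IsTestSeq η)
    (hηf : TendstoW12 η f) :
    Tendsto (fun n => eLpNorm (η n - trace Γ f) 2 (surfaceMeasure Γ)) atTop (𝓝 0) := by
  obtain ⟨hg, ζ, hζ, hζf, hζg⟩ := isTrace_trace hd hΓ hf
  exact hΓ.tendsto_surface hd hf hζ hη hζf hηf hg hζg

/-- The constant sequence `η` is an admissible approximation. -/
lemma trace_ae_eq_self {η : Space d → ℂ} (hη : ContDiff ℝ ∞ η) (hc : HasCompactSupport η) :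
    trace Γ η =ᵐ[surfaceMeasure Γ] η := by
  have h1 : ContDiff ℝ 1 η := hη.of_le (by exact_mod_cast le_top)
  have hW := memW12_of_contDiff h1 hc
  have h2 : TendstoW12 (fun _ => η) η :=
    tendstoW12_of_tendsto (K := fun _ => grad η) (fun _ => h1.hasWeakGradient)
      h1.hasWeakGradient (by simp) (by simp)
  have h3 := tendsto_eLpNorm_sub_trace hd hΓ hW (fun _ => ⟨hη, hc⟩) h2
  have h4 : eLpNorm (η - trace Γ η) 2 (surfaceMeasure Γ) = 0 :=
    tendsto_nhds_unique tendsto_const_nhds h3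
  rw [eLpNorm_eq_zero_iff ((hΓ.memLp_surface hd h1 hc).1.sub (memLp_trace hd hΓ hW).1)
    (by simp)] at h4
  filter_upwards [h4] with x hx
  exact (sub_eq_zero.1 hx).symm

/-- The trace is form bounded with relative bound zero. -/
lemma exists_lintegral_trace_sq_le : ∃ C : ℝ, 0 < C ∧ ∀ ε : ℝ, 0 < ε → ∀ f : Space d → ℂ,
    MemW12 volume f → ∫⁻ x, ‖trace Γ f x‖ₑ ^ (2 : ℝ) ∂(surfaceMeasure Γ)
      ≤ ENNReal.ofReal (C * (1 + ε⁻¹)) * (∫⁻ x, ‖f x‖ₑ ^ (2 : ℝ))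
        + ENNReal.ofReal (C * ε) * ∫⁻ x, ‖weakGrad f x‖ₑ ^ (2 : ℝ) := by
  obtain ⟨C, hC0, hC⟩ := hΓ.exists_lintegral_sq_le hd
  refine ⟨C, hC0, fun ε hε f hf => ?_⟩
  obtain ⟨η, hη, hηf, -⟩ := hf.exists_tendstoW12
  have hη' : IsTestSeq η := hη
  have h1 := (tendsto_eLpNorm_of_tendsto_sub (memLp_trace hd hΓ hf)
    (fun n => hΓ.memLp_surface hd (hη'.contDiff_one n) (hη n).2)
    (tendsto_eLpNorm_sub_trace hd hΓ hf hη hηf)).ennrpow_const 2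
  have h2 := (tendsto_eLpNorm_of_tendsto_sub hf.memLp (fun n => (hη'.memW12 n).memLp)
    hηf.tendsto_eLpNorm).ennrpow_const 2
  have h3 := (tendsto_eLpNorm_of_tendsto_sub hf.memLp_weakGrad_volume
    (fun n => (hη'.memW12 n).memLp_weakGrad_volume)
    (hηf.tendsto_eLpNorm_weakGrad hη'.memW12 hf)).ennrpow_const 2
  simp only [← eLpNorm_two_rpow_two]
  refine le_of_tendsto_of_tendsto' h1
    ((ENNReal.Tendsto.const_mul h2 (Or.inr ENNReal.ofReal_ne_top)).add
      (ENNReal.Tendsto.const_mul h3 (Or.inr ENNReal.ofReal_ne_top))) fun n => ?_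
  rw [eLpNorm_congr_ae (weakGrad_ae_eq_grad (hη'.contDiff_one n))]
  simp only [eLpNorm_two_rpow_two]
  exact hC ε hε (η n) (hη'.contDiff_one n)

lemma tendsto_integral_trace (hf : MemW12 volume f) (hg : MemW12 volume g)
    {η ζ : ℕ → Space d → ℂ} (hη : IsTestSeq η) (hζ : IsTestSeq ζ) (hηf : TendstoW12 η f)
    (hζg : TendstoW12 ζ g) :
    Tendsto (fun n => ∫ x, η n x * conj (ζ n x) ∂(surfaceMeasure Γ)) atTop
      (𝓝 (∫ x, trace Γ f x * conj (trace Γ g x) ∂(surfaceMeasure Γ))) := by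
  have := tendsto_integral_inner (memLp_trace hd hΓ hf) (memLp_trace hd hΓ hg)
    (fun n => hΓ.memLp_surface hd (hη.contDiff_one n) (hη n).2)
    (fun n => hΓ.memLp_surface hd (hζ.contDiff_one n) (hζ n).2)
    (tendsto_eLpNorm_sub_trace hd hΓ hf hη hηf) (tendsto_eLpNorm_sub_trace hd hΓ hg hζ hζg)
  simpa only [RCLike.inner_apply] using this

/-- Continuity of the form along test functions. -/
lemma tendsto_singularForm (α : ℝ) (hf : MemW12 volume f) (hg : MemW12 volume g)
    {η ζ : ℕ → Space d → ℂ} (hη : IsTestSeq η) (hζ : IsTestSeq ζ) (hηf : TendstoW12 η f)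
    (hζg : TendstoW12 ζ g) :
    Tendsto (fun n => singularForm Γ α (η n) (ζ n)) atTop (𝓝 (singularForm Γ α f g)) := by
  unfold singularForm
  refine Tendsto.sub ?_ (Tendsto.const_mul _ ?_)
  · exact tendsto_integral_inner hf.memLp_weakGrad_volume hg.memLp_weakGrad_volume
      (fun n => (hη.memW12 n).memLp_weakGrad_volume) (fun n => (hζ.memW12 n).memLp_weakGrad_volume)
      (hηf.tendsto_eLpNorm_weakGrad hη.memW12 hf) (hζg.tendsto_eLpNorm_weakGrad hζ.memW12 hg)
  · refine (tendsto_integral_trace hd hΓ hf hg hη hζ hηf hζg).congr fun n => ?_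
    refine integral_congr_ae ?_
    filter_upwards [trace_ae_eq_self hd hΓ (hη n).1 (hη n).2,
      trace_ae_eq_self hd hΓ (hζ n).1 (hζ n).2] with x hx1 hx2
    rw [hx1, hx2]

end Trace

lemma tendsto_scalarProduct {f g : Space d → ℂ} {η ζ : ℕ → Space d → ℂ} (hf : MemLp f 2 volume)
    (hg : MemLp g 2 volume) (hη : ∀ n, MemLp (η n) 2 volume) (hζ : ∀ n, MemLp (ζ n) 2 volume)
    (hηf : Tendsto (fun n => eLpNorm (η n - f) 2 volume) atTop (𝓝 0))
    (hζg : Tendsto (fun n => eLpNorm (ζ n - g) 2 volume) atTop (𝓝 0)) :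
    Tendsto (fun n => scalarProduct (η n) (ζ n)) atTop (𝓝 (scalarProduct f g)) := by
  have := tendsto_integral_inner hf hg hη hζ hηf hζg
  simpa only [scalarProduct, RCLike.inner_apply] using this

/-! ### Products of `W^{1,2}` functions as elements of `W^{1,1}` -/

/-- The weak gradient of `f * conj g`. -/
noncomputable def mulConjGrad (f g : Space d → ℂ) : Space d → EuclideanSpace ℂ (Fin d) :=
  (fun x => conj (g x)) • weakGrad f + f • fun x => conjVec (weakGrad g x)

lemma _root_.MeasureTheory.MemLp.conj_comp {α : Type*} [MeasurableSpace α] {μ : Measure α} {f : α → ℂ}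
    (hf : MemLp f 2 μ) : MemLp (fun x => conj (f x)) 2 μ :=
  hf.of_le (Complex.continuous_conj.comp_aestronglyMeasurable hf.1)
    (Eventually.of_forall fun x => by simp)

lemma _root_.MeasureTheory.MemLp.conjVec_comp {α : Type*} [MeasurableSpace α] {μ : Measure α}
    {G : α → EuclideanSpace ℂ (Fin d)}
    (hG : MemLp G 2 μ) : MemLp (fun x => conjVec (G x)) 2 μ :=
  hG.of_le (continuous_conjVec.comp_aestronglyMeasurable hG.1)
    (Eventually.of_forall fun x => by simp)

lemma conjVec_sub (z w : EuclideanSpace ℂ (Fin d)) : conjVec (z - w) = conjVec z - conjVec w := by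
  ext i; simp

lemma MemW12.hasWeakGradient_mulConj {f g : Space d → ℂ} (hf : MemW12 volume f)
    (hg : MemW12 volume g) : HasWeakGradient (fun x => f x * conj (g x)) (mulConjGrad f g) :=
  hf.hasWeakGradient.mul hg.hasWeakGradient.conj
    (integrable_smul_of_memLp hf.memLp hg.memLp.conj_comp).locallyIntegrable
    (integrable_smul_of_memLp hg.memLp.conj_comp hf.memLp_weakGrad_volume).locallyIntegrable
    (integrable_smul_of_memLp hf.memLp hg.memLp_weakGrad_volume.conjVec_comp).locallyIntegrable

/-- Hölder's inequality for the product and for each term of its gradient: convergence of the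
factors in `W^{1,2}` gives convergence of the product in `W^{1,1}`. -/
lemma tendsto_mulConj {f g : Space d → ℂ} (hf : MemW12 volume f) (hg : MemW12 volume g)
    {η ζ : ℕ → Space d → ℂ} (hη : IsTestSeq η) (hζ : IsTestSeq ζ) (hηf : TendstoW12 η f)
    (hζg : TendstoW12 ζ g) :
    Tendsto (fun n => eLpNorm ((fun x => η n x * conj (ζ n x)) - fun x => f x * conj (g x)) 1
      volume) atTop (𝓝 0) ∧
    Tendsto (fun n => eLpNorm (mulConjGrad (η n) (ζ n) - mulConjGrad f g) 1 volume)
      atTop (𝓝 0) := by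
  have hζc : Tendsto (fun n => eLpNorm ((fun x => conj (ζ n x)) - fun x => conj (g x)) 2 volume)
      atTop (𝓝 0) := by
    refine hζg.tendsto_eLpNorm.congr fun n => eLpNorm_congr_norm_ae (Eventually.of_forall fun x => ?_)
    simp only [Pi.sub_apply]
    rw [← map_sub, RCLike.norm_conj]
  have hζc' : Tendsto (fun n => eLpNorm ((fun x => conjVec (weakGrad (ζ n) x))
      - fun x => conjVec (weakGrad g x)) 2 volume) atTop (𝓝 0) := by
    refine (hζg.tendsto_eLpNorm_weakGrad hζ.memW12 hg).congr fun n =>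
      eLpNorm_congr_norm_ae (Eventually.of_forall fun x => ?_)
    simp only [Pi.sub_apply]
    rw [← conjVec_sub, norm_conjVec]
  have h1 := tendsto_eLpNorm_one_smul_sub hf.memLp hg.memLp.conj_comp
    (fun n => (hη.memW12 n).memLp) (fun n => (hζ.memW12 n).memLp.conj_comp)
    hηf.tendsto_eLpNorm hζc
  have h2 := tendsto_eLpNorm_one_smul_sub hg.memLp.conj_comp hf.memLp_weakGrad_volume
    (fun n => (hζ.memW12 n).memLp.conj_comp) (fun n => (hη.memW12 n).memLp_weakGrad_volume)
    hζc (hηf.tendsto_eLpNorm_weakGrad hη.memW12 hf)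
  have h3 := tendsto_eLpNorm_one_smul_sub hf.memLp hg.memLp_weakGrad_volume.conjVec_comp
    (fun n => (hη.memW12 n).memLp) (fun n => (hζ.memW12 n).memLp_weakGrad_volume.conjVec_comp)
    hηf.tendsto_eLpNorm hζc'
  refine ⟨h1, ?_⟩
  have h4 := h2.add h3
  rw [add_zero] at h4
  refine tendsto_of_tendsto_of_tendsto_of_le_of_le tendsto_const_nhds h4 (fun _ => zero_le)
    fun n => ?_
  dsimp only [mulConjGrad]
  rw [add_sub_add_comm]
  refine eLpNorm_add_le ?_ ?_ le_rfl
  · exact (((hζ.memW12 n).memLp.conj_comp.1.smul (hη.memW12 n).memLp_weakGrad_volume.1)).sub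
      (hg.memLp.conj_comp.1.smul hf.memLp_weakGrad_volume.1)
  · exact ((hη.memW12 n).memLp.1.smul (hζ.memW12 n).memLp_weakGrad_volume.conjVec_comp.1).sub
      (hf.memLp.1.smul hg.memLp_weakGrad_volume.conjVec_comp.1)

/-- The trace of a product in `W^{1,1}` does not depend on its factors in `W^{1,2}`. -/
theorem integral_trace_mul_conj_congr (hd : 1 ≤ d) (hΓ : IsCompactHypersurface Γ)
    {a b c e : Space d → ℂ} (ha : MemW12 volume a)
    (hb : MemW12 volume b) (hc : MemW12 volume c) (he : MemW12 volume e)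
    (habce : (fun x => a x * conj (b x)) =ᵐ[volume] fun x => c x * conj (e x)) :
    ∫ x, trace Γ a x * conj (trace Γ b x) ∂(surfaceMeasure Γ)
      = ∫ x, trace Γ c x * conj (trace Γ e x) ∂(surfaceMeasure Γ) := by
  obtain ⟨an, han, hlima, -⟩ := ha.exists_tendstoW12
  obtain ⟨bn, hbn, hlimb, -⟩ := hb.exists_tendstoW12
  obtain ⟨cn, hcn, hlimc, -⟩ := hc.exists_tendstoW12
  obtain ⟨en, hen, hlime, -⟩ := he.exists_tendstoW12
  change IsTestSeq an at han
  change IsTestSeq bn at hbn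
  change IsTestSeq cn at hcn
  change IsTestSeq en at hen
  obtain ⟨C, hC⟩ := hΓ.exists_lintegral_le hd
  have h1 := tendsto_integral_trace hd hΓ ha hb han hbn hlima hlimb
  have h2 := tendsto_integral_trace hd hΓ hc he hcn hen hlimc hlime
  have hprod : ∀ {u v : ℕ → Space d → ℂ}, IsTestSeq u → IsTestSeq v → ∀ n,
      ContDiff ℝ 1 (fun x => u n x * conj (v n x)) := fun hu hv n =>
    (hu.contDiff_one n).mul ((Complex.conjCLE : ℂ →L[ℝ] ℂ).contDiff.comp (hv.contDiff_one n))
  have hint : ∀ {u v : ℕ → Space d → ℂ}, IsTestSeq u → IsTestSeq v → ∀ n,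
      Integrable (fun x => u n x * conj (v n x)) (surfaceMeasure Γ) := fun hu hv n =>
    integrable_smul_of_memLp (hΓ.memLp_surface hd (hu.contDiff_one n) (hu n).2)
      (hΓ.memLp_surface hd (hv.contDiff_one n) (hv n).2).conj_comp
  -- Both products converge in `W^{1,1}` to the same function, so `h n → 0` there, and the `W^{1,1}`
  -- trace inequality forces the integrals of `h n` over `Γ` to vanish in the limit.
  set h : ℕ → Space d → ℂ := fun n x => an n x * conj (bn n x) - cn n x * conj (en n x) with hh
  have hhc : ∀ n, ContDiff ℝ 1 (h n) := fun n => (hprod han hbn n).sub (hprod hcn hen n)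
  obtain ⟨h3, h3'⟩ := tendsto_mulConj ha hb han hbn hlima hlimb
  obtain ⟨h4, h4'⟩ := tendsto_mulConj hc he hcn hen hlimc hlime
  -- Both sides are weak gradients of the same function.
  have hG : mulConjGrad a b =ᵐ[volume] mulConjGrad c e :=
    (ha.hasWeakGradient_mulConj hb).unique
      ((hc.hasWeakGradient_mulConj he).congr habce.symm ae_eq_rfl)
  have hgrad : ∀ n, grad (h n) =ᵐ[volume]
      mulConjGrad (an n) (bn n) - mulConjGrad (cn n) (en n) := fun n =>
    (hhc n).hasWeakGradient.unique
      (((han.memW12 n).hasWeakGradient_mulConj (hbn.memW12 n)).sub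
        ((hcn.memW12 n).hasWeakGradient_mulConj (hen.memW12 n)))
  have hmc : ∀ {u v : Space d → ℂ}, MemW12 volume u → MemW12 volume v →
      AEStronglyMeasurable (fun x => u x * conj (v x)) volume ∧
      AEStronglyMeasurable (mulConjGrad u v) volume := fun hu hv =>
    ⟨(hu.hasWeakGradient_mulConj hv).locallyIntegrable.aestronglyMeasurable,
      (hu.hasWeakGradient_mulConj hv).locallyIntegrable_grad.aestronglyMeasurable⟩
  have hlim : Tendsto (fun n => (C : ℝ≥0∞) * (eLpNorm (h n) 1 volume
      + d * eLpNorm (grad (h n)) 1 volume)) atTop (𝓝 0) := by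
    have h5 : Tendsto (fun n => eLpNorm (h n) 1 volume) atTop (𝓝 0) := by
      have h6 := h3.add h4
      rw [add_zero] at h6
      refine tendsto_of_tendsto_of_tendsto_of_le_of_le tendsto_const_nhds h6 (fun _ => zero_le)
        fun n => ?_
      refine le_trans (le_of_eq ?_) (eLpNorm_sub_le
        ((hmc (han.memW12 n) (hbn.memW12 n)).1.sub (hmc ha hb).1)
        ((hmc (hcn.memW12 n) (hen.memW12 n)).1.sub (hmc hc he).1) le_rfl)
      refine eLpNorm_congr_ae ?_
      filter_upwards [habce] with x hx
      simp only [hh, Pi.sub_apply, hx]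
      ring
    have h5' : Tendsto (fun n => eLpNorm (grad (h n)) 1 volume) atTop (𝓝 0) := by
      have h6 := h3'.add h4'
      rw [add_zero] at h6
      refine tendsto_of_tendsto_of_tendsto_of_le_of_le tendsto_const_nhds h6 (fun _ => zero_le)
        fun n => ?_
      refine le_trans (le_of_eq ?_) (eLpNorm_sub_le
        ((hmc (han.memW12 n) (hbn.memW12 n)).2.sub (hmc ha hb).2)
        ((hmc (hcn.memW12 n) (hen.memW12 n)).2.sub (hmc hc he).2) le_rfl)
      refine eLpNorm_congr_ae ?_
      filter_upwards [hG, hgrad n] with x hx hx'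
      rw [hx']
      simp only [Pi.sub_apply, hx]
      abel
    have h7 := ENNReal.Tendsto.const_mul (a := (C : ℝ≥0∞)) (h5.add
      (ENNReal.Tendsto.const_mul (a := (d : ℝ≥0∞)) h5' (Or.inr (by simp))))
      (Or.inr ENNReal.coe_ne_top)
    simpa using h7
  have hsurf : Tendsto (fun n => ∫⁻ x, ‖h n x‖ₑ ∂(surfaceMeasure Γ)) atTop (𝓝 0) := by
    refine tendsto_of_tendsto_of_tendsto_of_le_of_le tendsto_const_nhds hlim (fun _ => zero_le)
      fun n => (hC (h n) (hhc n)).trans ?_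
    rw [eLpNorm_one_eq_lintegral_enorm, eLpNorm_one_eq_lintegral_enorm,
      ← lintegral_const_mul' (d : ℝ≥0∞) _ (by simp),
      ← lintegral_add_left' (hhc n).continuous.measurable.enorm.aemeasurable]
    gcongr with x
    exact enorm_fderiv_le_grad _ _
  have h8 : Tendsto (fun n => ∫ x, h n x ∂(surfaceMeasure Γ)) atTop (𝓝 0) := by
    rw [tendsto_zero_iff_enorm_tendsto_zero]
    exact tendsto_of_tendsto_of_tendsto_of_le_of_le tendsto_const_nhds hsurf (fun _ => zero_le)
      fun n => enorm_integral_le_lintegral_enorm _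
  have h9 := h1.sub h2
  simp only [← fun n => integral_sub (hint han hbn n) (hint hcn hen n)] at h9
  exact sub_eq_zero.1 (tendsto_nhds_unique h9 h8)

end SingularSchrodinger

namespace SingularSchrodinger

variable {d : ℕ}

/-! ### Local lower bounds for positive supersolutions -/

/-- A smooth radial profile that vanishes on `[1, ∞)`. -/
noncomputable def profile (t : ℝ) : ℝ := expNegInvGlue (1 - t)

/-- Minus the derivative of `profile`. -/
noncomputable def profileSlope (t : ℝ) : ℝ := ((1 - t)⁻¹) ^ 2 * expNegInvGlue (1 - t)

lemma hasDerivAt_profile (t : ℝ) : HasDerivAt profile (-profileSlope t) t := by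
  have h1 : HasDerivAt expNegInvGlue (((1 - t)⁻¹) ^ 2 * expNegInvGlue (1 - t)) (1 - t) := by
    have h0 := expNegInvGlue.hasDerivAt_polynomial_eval_inv_mul 1 (1 - t)
    simpa using h0
  have h2 := h1.comp t ((hasDerivAt_const t (1 : ℝ)).sub (hasDerivAt_id t))
  refine HasDerivAt.congr_deriv (f := profile) h2 ?_
  rw [profileSlope]
  ring

lemma contDiff_profile : ContDiff ℝ ∞ profile :=
  expNegInvGlue.contDiff.comp (contDiff_const.sub contDiff_id)

lemma contDiff_profileSlope : ContDiff ℝ ∞ profileSlope := by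
  have h1 : profileSlope = fun t => -deriv profile t := by
    ext t; rw [(hasDerivAt_profile t).deriv, neg_neg]
  rw [h1]
  exact ((contDiff_infty_iff_deriv.1 contDiff_profile).2).neg

lemma profile_nonneg (t : ℝ) : 0 ≤ profile t := expNegInvGlue.nonneg _

lemma profileSlope_nonneg (t : ℝ) : 0 ≤ profileSlope t :=
  mul_nonneg (sq_nonneg _) (expNegInvGlue.nonneg _)

lemma profileSlope_pos {t : ℝ} (ht : t < 1) : 0 < profileSlope t := by
  have : 0 < 1 - t := by linarith
  exact mul_pos (by positivity) (expNegInvGlue.pos_of_pos this)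

lemma profile_eq_zero {t : ℝ} (ht : 1 ≤ t) : profile t = 0 :=
  expNegInvGlue.zero_of_nonpos (by linarith)

lemma profileSlope_eq_zero {t : ℝ} (ht : 1 ≤ t) : profileSlope t = 0 := by
  rw [profileSlope, expNegInvGlue.zero_of_nonpos (by linarith), mul_zero]

/-- The factor `(1 - t)⁻²` is at least one on `[0, 1)`. The comparison bounds the zero order term of
the supersolution inequality by the average itself. -/
lemma profile_le_profileSlope {t : ℝ} (ht : 0 ≤ t) : profile t ≤ profileSlope t := by
  rcases le_or_gt 1 t with h1 | h1
  · rw [profile_eq_zero h1, profileSlope_eq_zero h1]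
  · have h2 : 1 ≤ ((1 - t)⁻¹) ^ 2 := one_le_pow₀ (one_le_inv_iff₀.2 ⟨by linarith, by linarith⟩)
    exact le_mul_of_one_le_left (expNegInvGlue.nonneg _) h2

lemma deriv_profileSlope_eq_zero {t : ℝ} (ht : 1 < t) : deriv profileSlope t = 0 := by
  have h1 : profileSlope =ᶠ[𝓝 t] fun _ => (0 : ℝ) := by
    filter_upwards [Ioi_mem_nhds ht] with u hu using profileSlope_eq_zero (le_of_lt hu)
  rw [h1.deriv_eq, deriv_const]

lemma exists_profileSlope_le : ∃ C : ℝ, 0 < C ∧ ∀ t, 0 ≤ t → profileSlope t ≤ C := by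
  obtain ⟨C, hC⟩ := (isCompact_Icc (a := (0 : ℝ)) (b := 1)).exists_bound_of_continuousOn
    contDiff_profileSlope.continuous.continuousOn
  refine ⟨|C| + 1, by positivity, fun t ht => ?_⟩
  rcases le_or_gt t 1 with h1 | h1
  · linarith [le_abs_self (profileSlope t), hC t ⟨ht, h1⟩, le_abs_self C,
      Real.norm_eq_abs (profileSlope t)]
  · rw [profileSlope_eq_zero h1.le]; positivity

/-! ### Radial averaging kernels and their derivative in the scale -/

/-- The averaging kernel at scale `s⁻¹`. -/
noncomputable def averageKernel (s : ℝ) (z : Space d) : ℝ := s ^ d * profileSlope (s ^ 2 * ‖z‖ ^ 2)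

/-- The test function whose Laplacian is the derivative of the averaging kernel in the scale. -/
noncomputable def averageTest (s : ℝ) (x z : Space d) : ℝ :=
  s ^ d / 2 * profile (s ^ 2 * ‖z - x‖ ^ 2)

/-- The derivative of the averaging kernel in the scale. -/
noncomputable def averageKernelDeriv (s : ℝ) (z : Space d) : ℝ :=
  d * s ^ (d - 1) * profileSlope (s ^ 2 * ‖z‖ ^ 2)
    + s ^ d * (deriv profileSlope (s ^ 2 * ‖z‖ ^ 2) * (2 * s * ‖z‖ ^ 2))

lemma hasDerivAt_averageKernel (s : ℝ) (z : Space d) :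
    HasDerivAt (fun s => averageKernel s z) (averageKernelDeriv s z) s := by
  have h1 : HasDerivAt (fun s : ℝ => s ^ 2 * ‖z‖ ^ 2) (2 * s * ‖z‖ ^ 2) s := by
    have := (hasDerivAt_pow 2 s).mul_const (‖z‖ ^ 2)
    simpa using this
  have h2 : HasDerivAt profileSlope (deriv profileSlope (s ^ 2 * ‖z‖ ^ 2)) (s ^ 2 * ‖z‖ ^ 2) :=
    (contDiff_profileSlope.differentiable (by simp) _).hasDerivAt
  have h3 := HasDerivAt.comp (h₂ := profileSlope) s h2 h1
  exact (hasDerivAt_pow d s).mul h3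

/-- The Laplacian. -/
noncomputable def lap (g : Space d → ℝ) (x : Space d) : ℝ :=
  ∑ i, fderiv ℝ (fun y => fderiv ℝ g y (EuclideanSpace.single i 1)) x (EuclideanSpace.single i 1)

lemma hasFDerivAt_comp_norm_sq {Φ : ℝ → ℝ} {Φ' : ℝ} (s : ℝ) (x z : Space d)
    (h : HasDerivAt Φ Φ' (s ^ 2 * ‖z - x‖ ^ 2)) :
    HasFDerivAt (fun z => Φ (s ^ 2 * ‖z - x‖ ^ 2))
      ((2 * s ^ 2 * Φ') • innerSL ℝ (z - x)) z := by
  have h1 : HasFDerivAt (fun z : Space d => z - x) (ContinuousLinearMap.id ℝ (Space d)) z :=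
    (hasFDerivAt_id z).sub_const x
  have h2 := (h1.norm_sq).const_mul (s ^ 2)
  have h3 := h.comp_hasFDerivAt z h2
  refine h3.congr_fderiv ?_
  ext v
  simp
  ring

lemma innerSL_single (y : Space d) (i : Fin d) :
    innerSL ℝ y (EuclideanSpace.single i (1 : ℝ)) = y i := by
  simp [EuclideanSpace.inner_single_right]

lemma fderiv_averageTest (s : ℝ) (x z : Space d) (i : Fin d) :
    fderiv ℝ (averageTest s x) z (EuclideanSpace.single i 1)
      = -(s ^ (d + 2) * profileSlope (s ^ 2 * ‖z - x‖ ^ 2)) * (z - x) i := by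
  have h := (hasFDerivAt_comp_norm_sq s x z (hasDerivAt_profile _)).const_mul (s ^ d / 2)
  have h' : HasFDerivAt (averageTest s x) _ z := h
  rw [h'.fderiv]
  simp only [smul_apply, smul_eq_mul, innerSL_single]
  ring

/-- Write `S` for `profileSlope` and `r = ‖z - x‖`. The gradient of the test function is `-s ^ (d +
2) S(s² r²) (z - x)`, and its divergence `-s ^ (d + 2) (d S + 2 s² r² S')` is `-s ^ 3` times the
derivative of `s ^ d S(s² r²)` in `s`. A supersolution, tested with `averageTest`, thus has its
averages controlled as the scale varies. -/
lemma lap_averageTest (s : ℝ) (x z : Space d) :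
    lap (averageTest s x) z = -s ^ 3 * averageKernelDeriv s (z - x) := by
  set ρ := s ^ 2 * ‖z - x‖ ^ 2 with hρ
  have h1 : ∀ i, fderiv ℝ (fun y => fderiv ℝ (averageTest s x) y (EuclideanSpace.single i 1)) z
      (EuclideanSpace.single i 1) = -s ^ (d + 2) * (profileSlope ρ
        + 2 * s ^ 2 * deriv profileSlope ρ * (z - x) i ^ 2) := by
    intro i
    simp only [fderiv_averageTest]
    have h2 : HasDerivAt profileSlope (deriv profileSlope ρ) ρ :=
      (contDiff_profileSlope.differentiable (by simp) _).hasDerivAt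
    have h3 := ((hasFDerivAt_comp_norm_sq s x z h2).const_mul (s ^ (d + 2))).neg
    have h4 : HasFDerivAt (fun y : Space d => (y - x) i)
        (EuclideanSpace.proj i : Space d →L[ℝ] ℝ) z := by
      have h5 := (EuclideanSpace.proj i : Space d →L[ℝ] ℝ).hasFDerivAt (x := z)
      exact h5.sub_const (x i)
    have h6 : HasFDerivAt (fun y : Space d =>
        -(s ^ (d + 2) * profileSlope (s ^ 2 * ‖y - x‖ ^ 2)) * (y - x) i) _ z := h3.mul h4
    rw [h6.fderiv]
    simp only [add_apply, smul_apply, neg_apply, Pi.neg_apply, smul_eq_mul, innerSL_single,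
      EuclideanSpace.coe_proj, PiLp.single_apply, if_true]
    rw [← hρ]
    ring
  have h7 : ∑ i, (z - x) i ^ 2 = ‖z - x‖ ^ 2 := by
    rw [EuclideanSpace.norm_sq_eq]; simp
  -- The truncated exponent `d - 1` does no harm for `d = 0`, as the factor `d` vanishes.
  have h8 : (d : ℝ) * s ^ (d - 1) * s = d * s ^ d := by
    rcases d with _ | n
    · simp
    · rw [Nat.add_sub_cancel, pow_succ]; ring
  rw [lap, Finset.sum_congr rfl fun i _ => h1 i, ← Finset.mul_sum, Finset.sum_add_distrib,
    ← Finset.mul_sum, h7, averageKernelDeriv, ← hρ]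
  simp only [Finset.sum_const, Finset.card_univ, Fintype.card_fin, nsmul_eq_mul]
  linear_combination (s ^ 2 * profileSlope ρ) * h8

lemma contDiff_averageTest (s : ℝ) (x : Space d) : ContDiff ℝ ∞ (averageTest s x) :=
  contDiff_const.mul (contDiff_profile.comp
    (contDiff_const.mul ((contDiff_norm_sq ℝ).comp (contDiff_id.sub contDiff_const))))

lemma contDiff_averageKernel (s : ℝ) : ContDiff ℝ ∞ (averageKernel (d := d) s) :=
  contDiff_const.mul (contDiff_profileSlope.comp (contDiff_const.mul (contDiff_norm_sq ℝ)))

lemma one_lt_of_notMem_closedBall {s : ℝ} (hs : 0 < s) {z : Space d}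
    (hz : z ∉ Metric.closedBall 0 s⁻¹) : 1 < s ^ 2 * ‖z‖ ^ 2 := by
  rw [mem_closedBall_zero_iff, not_le] at hz
  rw [← mul_pow]
  refine one_lt_pow₀ ?_ two_ne_zero
  rwa [inv_lt_iff_one_lt_mul₀ hs, mul_comm] at hz

lemma hasCompactSupport_averageTest {s : ℝ} (hs : 0 < s) (x : Space d) :
    HasCompactSupport (averageTest s x) := by
  refine HasCompactSupport.intro (isCompact_closedBall x s⁻¹) fun z hz => ?_
  have h1 : z - x ∉ Metric.closedBall 0 s⁻¹ := by
    rw [mem_closedBall_zero_iff, ← mem_closedBall_iff_norm]; exact hz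
  rw [averageTest, profile_eq_zero (one_lt_of_notMem_closedBall hs h1).le, mul_zero]

lemma averageKernel_eq_zero {s : ℝ} (hs : 0 < s) {z : Space d}
    (hz : z ∉ Metric.closedBall 0 s⁻¹) : averageKernel s z = 0 := by
  rw [averageKernel, profileSlope_eq_zero (one_lt_of_notMem_closedBall hs hz).le, mul_zero]

lemma hasCompactSupport_averageKernel {s : ℝ} (hs : 0 < s) :
    HasCompactSupport (averageKernel (d := d) s) :=
  HasCompactSupport.intro (isCompact_closedBall 0 s⁻¹) fun _ hz => averageKernel_eq_zero hs hz

lemma averageKernel_nonneg {s : ℝ} (hs : 0 < s) (z : Space d) : 0 ≤ averageKernel s z :=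
  mul_nonneg (by positivity) (profileSlope_nonneg _)

lemma averageTest_nonneg {s : ℝ} (hs : 0 < s) (x z : Space d) : 0 ≤ averageTest s x z :=
  mul_nonneg (by positivity) (profile_nonneg _)

lemma averageTest_le {s : ℝ} (hs : 0 < s) (x z : Space d) :
    averageTest s x z ≤ averageKernel s (z - x) / 2 := by
  have h := profile_le_profileSlope (t := s ^ 2 * ‖z - x‖ ^ 2) (by positivity)
  have h2 : 0 ≤ s ^ d / 2 := by positivity
  calc _ ≤ s ^ d / 2 * profileSlope (s ^ 2 * ‖z - x‖ ^ 2) := mul_le_mul_of_nonneg_left h h2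
    _ = _ := by rw [averageKernel]; ring

/-- The mass of the averaging kernels. -/
lemma integral_averageKernel {s : ℝ} (hs : 0 < s) :
    ∫ z : Space d, averageKernel s z = ∫ z : Space d, averageKernel 1 z := by
  have h := Measure.integral_comp_smul (volume : Measure (Space d)) (averageKernel 1) s
  have h1 : ∀ z : Space d, averageKernel s z = s ^ d * averageKernel 1 (s • z) := fun z => by
    simp only [averageKernel, norm_smul, mul_pow, Real.norm_eq_abs, sq_abs, one_pow, one_mul]
  simp only [h1]
  rw [integral_const_mul, h, finrank_euclideanSpace, Fintype.card_fin, smul_eq_mul,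
    abs_of_pos (by positivity), ← mul_assoc, mul_inv_cancel₀ (by positivity), one_mul]

lemma integral_averageKernel_one_pos : 0 < ∫ z : Space d, averageKernel 1 z := by
  refine (contDiff_averageKernel 1).continuous.integral_pos_of_hasCompactSupport_nonneg_nonzero
    (hasCompactSupport_averageKernel one_pos) (averageKernel_nonneg one_pos) (x := 0) ?_
  have := profileSlope_pos (t := (1 : ℝ) ^ 2 * ‖(0 : Space d)‖ ^ 2) (by simp)
  rw [averageKernel]
  positivity

/-- `w` is a distributional supersolution of `-Δ w + c w = 0`. -/
def IsSupersolution (c : ℝ) (w : Space d → ℝ) : Prop :=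
  ∀ g : Space d → ℝ, ContDiff ℝ ∞ g → HasCompactSupport g → (∀ x, 0 ≤ g x) →
    0 ≤ ∫ x, w x * (c * g x - lap g x)

lemma contDiff_lap {g : Space d → ℝ} (hg : ContDiff ℝ ∞ g) : ContDiff ℝ ∞ (lap g) :=
  ContDiff.sum fun _ _ => contDiff_fderiv_apply (contDiff_fderiv_apply hg _) _

lemma hasCompactSupport_lap {g : Space d → ℝ} (hg : HasCompactSupport g) :
    HasCompactSupport (lap g) := by
  refine HasCompactSupport.intro hg.isCompact fun x hx => ?_
  refine Finset.sum_eq_zero fun i _ => ?_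
  have h1 : x ∉ tsupport (fun y => fderiv ℝ (fun y => fderiv ℝ g y (EuclideanSpace.single i 1)) y
      (EuclideanSpace.single i (1 : ℝ))) := by
    intro hx'
    refine hx (tsupport_fderiv_subset ℝ (f := g) ?_)
    refine closure_mono ?_ (tsupport_fderiv_subset ℝ
      (f := fun y => fderiv ℝ g y (EuclideanSpace.single i (1 : ℝ))) (closure_mono ?_ hx'))
    · intro y hy
      rw [Function.mem_support] at hy ⊢
      intro h0; exact hy (by simp [h0])
    · intro y hy
      rw [Function.mem_support] at hy ⊢
      intro h0; exact hy (by simp [h0])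
  exact image_eq_zero_of_notMem_tsupport (f := fun y => fderiv ℝ (fun y => fderiv ℝ g y
    (EuclideanSpace.single i 1)) y (EuclideanSpace.single i (1 : ℝ))) h1

/-! ### Averages of supersolutions -/

section Average

variable {w : Space d → ℝ}

/-- The weighted average of `w` around `x` at scale `s⁻¹`. -/
noncomputable def average (w : Space d → ℝ) (x : Space d) (s : ℝ) : ℝ :=
  ∫ z, averageKernel s (z - x) * w z

lemma integrable_mul_of_hasCompactSupport (hw : LocallyIntegrable w volume) {k : Space d → ℝ}
    (hk : Continuous k) (hkc : HasCompactSupport k) : Integrable (fun z => k z * w z) volume :=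
  hw.integrable_smul_left_of_hasCompactSupport hk hkc

lemma continuous_averageKernel_sub (s : ℝ) (x : Space d) :
    Continuous fun z => averageKernel s (z - x) :=
  (contDiff_averageKernel s).continuous.comp (continuous_id.sub continuous_const)

lemma hasCompactSupport_averageKernel_sub {s : ℝ} (hs : 0 < s) (x : Space d) :
    HasCompactSupport fun z => averageKernel s (z - x) :=
  (hasCompactSupport_averageKernel hs).comp_homeomorph (Homeomorph.subRight x)

/-- Differentiation under the integral sign: for scale parameters in `[s / 2, 2 s]` the kernel
derivatives vanish outside one ball of radius `(s / 2)⁻¹` and are uniformly bounded on it. -/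
lemma hasDerivAt_average (hw : LocallyIntegrable w volume) (x : Space d) {s : ℝ} (hs : 0 < s) :
    HasDerivAt (average w x) (∫ z, averageKernelDeriv s (z - x) * w z) s := by
  have hK : Continuous fun p : ℝ × Space d => averageKernelDeriv p.1 p.2 := by
    have h1 : Continuous fun p : ℝ × Space d => p.1 ^ 2 * ‖p.2‖ ^ 2 := by fun_prop
    have h2 : Continuous (deriv profileSlope) :=
      (contDiff_profileSlope.continuous_deriv (by simp))
    have h3 := contDiff_profileSlope.continuous.comp h1
    have h4 := h2.comp h1
    unfold averageKernelDeriv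
    simp only [Function.comp_def] at h3 h4
    fun_prop
  obtain ⟨C, hC⟩ := ((isCompact_Icc (a := s / 2) (b := 2 * s)).prod
    (isCompact_closedBall (0 : Space d) (s / 2)⁻¹)).exists_bound_of_continuousOn hK.continuousOn
  have hzero : ∀ t ∈ Set.Icc (s / 2) (2 * s), ∀ z ∉ Metric.closedBall (0 : Space d) (s / 2)⁻¹,
      averageKernelDeriv t z = 0 := by
    intro t ht z hz
    have ht0 : 0 < t := lt_of_lt_of_le (by positivity) ht.1
    have h1 : z ∉ Metric.closedBall (0 : Space d) t⁻¹ := fun h => hz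
      (Metric.closedBall_subset_closedBall (inv_anti₀ (by positivity) ht.1) h)
    have h2 := one_lt_of_notMem_closedBall ht0 h1
    rw [averageKernelDeriv, profileSlope_eq_zero h2.le, deriv_profileSlope_eq_zero h2]
    ring
  refine (hasDerivAt_integral_of_dominated_loc_of_deriv_le (s := Set.Icc (s / 2) (2 * s))
    (F := fun s z => averageKernel s (z - x) * w z)
    (F' := fun s z => averageKernelDeriv s (z - x) * w z)
    (bound := (Metric.closedBall x (s / 2)⁻¹).indicator fun z => |C| * ‖w z‖)
    (Icc_mem_nhds (by linarith) (by linarith)) (Eventually.of_forall fun t => ?_) ?_ ?_ ?_ ?_ ?_).2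
  · exact (continuous_averageKernel_sub t x).aestronglyMeasurable.mul hw.aestronglyMeasurable
  · exact integrable_mul_of_hasCompactSupport hw (continuous_averageKernel_sub s x)
      (hasCompactSupport_averageKernel_sub hs x)
  · refine AEStronglyMeasurable.mul ?_ hw.aestronglyMeasurable
    exact (hK.comp (continuous_const.prodMk
      (continuous_id.sub continuous_const))).aestronglyMeasurable
  · refine Eventually.of_forall fun z t ht => ?_
    by_cases hz : z ∈ Metric.closedBall x (s / 2)⁻¹
    · rw [Set.indicator_of_mem hz, norm_mul]
      have h1 : z - x ∈ Metric.closedBall (0 : Space d) (s / 2)⁻¹ := by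
        rw [mem_closedBall_zero_iff, ← mem_closedBall_iff_norm]; exact hz
      exact mul_le_mul_of_nonneg_right ((hC (t, z - x) ⟨ht, h1⟩).trans (le_abs_self C))
        (norm_nonneg _)
    · rw [Set.indicator_of_notMem hz]
      have h1 : z - x ∉ Metric.closedBall (0 : Space d) (s / 2)⁻¹ := by
        rw [mem_closedBall_zero_iff, ← mem_closedBall_iff_norm]; exact hz
      rw [hzero t ht _ h1, zero_mul, norm_zero]
  · rw [integrable_indicator_iff measurableSet_closedBall]
    exact (hw.integrableOn_isCompact (isCompact_closedBall x _)).norm.const_mul |C|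
  · exact Eventually.of_forall fun z t _ =>
      (hasDerivAt_averageKernel t (z - x)).mul_const (w z)

/-- The derivative of the averages of a supersolution. -/
lemma IsSupersolution.average_deriv_ge {c : ℝ} (hc : 0 ≤ c) (h : IsSupersolution c w)
    (hw : LocallyIntegrable w volume) (hw0 : ∀ᵐ x, 0 ≤ w x) (x : Space d) {s : ℝ} (hs : 0 < s) :
    -(c / 2 * (s ^ 3)⁻¹ * average w x s) ≤ ∫ z, averageKernelDeriv s (z - x) * w z := by
  have h1 := h (averageTest s x) (contDiff_averageTest s x) (hasCompactSupport_averageTest hs x)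
    (averageTest_nonneg hs x)
  have h2 : ∫ z, averageKernelDeriv s (z - x) * w z
      = -((s ^ 3)⁻¹ * ∫ z, lap (averageTest s x) z * w z) := by
    simp only [lap_averageTest s, mul_assoc]
    rw [integral_const_mul]
    field_simp
  have hi1 : Integrable (fun z => averageTest s x z * w z) volume :=
    integrable_mul_of_hasCompactSupport hw (contDiff_averageTest s x).continuous
      (hasCompactSupport_averageTest hs x)
  have hi2 : Integrable (fun z => lap (averageTest s x) z * w z) volume :=
    integrable_mul_of_hasCompactSupport hw (contDiff_lap (contDiff_averageTest s x)).continuous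
      (hasCompactSupport_lap (hasCompactSupport_averageTest hs x))
  have hi3 : Integrable (fun z => averageKernel s (z - x) * w z) volume :=
    integrable_mul_of_hasCompactSupport hw (continuous_averageKernel_sub s x)
      (hasCompactSupport_averageKernel_sub hs x)
  have h3 : ∫ z, w z * (c * averageTest s x z - lap (averageTest s x) z)
      = c * (∫ z, averageTest s x z * w z) - ∫ z, lap (averageTest s x) z * w z := by
    rw [← integral_const_mul, ← integral_sub (hi1.const_mul c) hi2]
    exact integral_congr_ae (Eventually.of_forall fun z => by dsimp only; ring)
  have h4 : ∫ z, averageTest s x z * w z ≤ 1 / 2 * average w x s := by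
    rw [average, ← integral_const_mul]
    refine integral_mono_ae hi1 (hi3.const_mul _) ?_
    filter_upwards [hw0] with z hz
    have := mul_le_mul_of_nonneg_right (averageTest_le hs x z) hz
    linarith
  rw [h3] at h1
  rw [h2]
  have h5 : ∫ z, lap (averageTest s x) z * w z ≤ c / 2 * average w x s := by
    have := mul_le_mul_of_nonneg_left h4 hc
    linarith
  have h6 : 0 ≤ (s ^ 3)⁻¹ := by positivity
  have := mul_le_mul_of_nonneg_left h5 h6
  nlinarith [this]

/-- Averages of supersolutions almost increase as the scale shrinks. -/
lemma IsSupersolution.average_one_le {c : ℝ} (hc : 0 ≤ c) (h : IsSupersolution c w)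
    (hw : LocallyIntegrable w volume) (hw0 : ∀ᵐ x, 0 ≤ w x) (x : Space d) {s : ℝ} (hs : 1 ≤ s) :
    Real.exp (-(c / 4)) * average w x 1 ≤ average w x s := by
  -- Integrating factor: `-(c / 4) t⁻²` has derivative `(c / 2) t⁻³`, exactly the coefficient in
  -- `average_deriv_ge`, so `B` is monotone.
  set B : ℝ → ℝ := fun t => Real.exp (-(c / 4) * (t ^ 2)⁻¹) * average w x t with hB
  have hderiv : ∀ t, 0 < t → HasDerivAt B (Real.exp (-(c / 4) * (t ^ 2)⁻¹) *
      (c / 2 * (t ^ 3)⁻¹ * average w x t + ∫ z, averageKernelDeriv t (z - x) * w z)) t := by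
    intro t ht
    have h1 : HasDerivAt (fun t : ℝ => -(c / 4) * (t ^ 2)⁻¹) (c / 2 * (t ^ 3)⁻¹) t := by
      have h2 := ((hasDerivAt_pow 2 t).inv (pow_ne_zero 2 ht.ne')).const_mul (-(c / 4))
      refine h2.congr_deriv ?_
      have ht' := ht.ne'
      push_cast
      field_simp
      norm_num
    refine (h1.exp.mul (hasDerivAt_average hw x ht)).congr_deriv ?_
    ring
  have hmono : MonotoneOn B (Set.Ici 1) := by
    refine monotoneOn_of_deriv_nonneg (convex_Ici 1) ?_ ?_ ?_
    · exact fun t ht => (hderiv t (lt_of_lt_of_le one_pos ht)).continuousAt.continuousWithinAt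
    · intro t ht
      rw [interior_Ici] at ht
      exact (hderiv t (one_pos.trans ht)).differentiableAt.differentiableWithinAt
    · intro t ht
      rw [interior_Ici] at ht
      have ht0 : 0 < t := one_pos.trans ht
      rw [(hderiv t ht0).deriv]
      have := h.average_deriv_ge hc hw hw0 x ht0
      exact mul_nonneg (Real.exp_pos _).le (by linarith)
  have h1 := hmono (Set.mem_Ici.2 le_rfl) (Set.mem_Ici.2 hs) hs
  have hpos : 0 ≤ average w x s := by
    refine integral_nonneg_of_ae ?_
    filter_upwards [hw0] with z hz
    exact mul_nonneg (averageKernel_nonneg (by linarith) _) hz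
  have h2 : Real.exp (-(c / 4) * (s ^ 2)⁻¹) ≤ 1 := by
    rw [Real.exp_le_one_iff]
    have : 0 ≤ (s ^ 2)⁻¹ := by positivity
    nlinarith
  calc _ = B 1 := by simp [hB]
    _ ≤ B s := h1
    _ ≤ 1 * average w x s := mul_le_mul_of_nonneg_right h2 hpos
    _ = _ := one_mul _

/-- Convergence at Lebesgue points: after division by the mass `M`, the kernels have integral one,
live in balls of radius `(n + 1)⁻¹`, and are bounded by a constant over the volume of the ball. -/
lemma ae_tendsto_average (hw : LocallyIntegrable w volume) :
    ∀ᵐ x, Tendsto (fun n : ℕ => average w x ((n : ℝ) + 1)) atTop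
      (𝓝 ((∫ z : Space d, averageKernel 1 z) * w x)) := by
  set M := ∫ z : Space d, averageKernel 1 z with hM
  have hM0 : 0 < M := integral_averageKernel_one_pos
  obtain ⟨C, hC0, hC⟩ := exists_profileSlope_le
  filter_upwards [(Besicovitch.vitaliFamily (volume : Measure (Space d))).ae_tendsto_average_norm_sub
    hw] with x hx
  have hr : Tendsto (fun n : ℕ => ((n : ℝ) + 1)⁻¹) atTop (𝓝[>] 0) := by
    refine tendsto_nhdsWithin_iff.2 ⟨?_, Eventually.of_forall fun n => ?_⟩
    · exact tendsto_inv_atTop_zero.comp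
        (tendsto_atTop_add_const_right _ 1 tendsto_natCast_atTop_atTop)
    · rw [Set.mem_Ioi]; positivity
  have hx' := (hx.comp (Besicovitch.tendsto_filterAt volume x)).comp hr
  have h1 := tendsto_integral_smul_of_tendsto_average_norm_sub
    (g := fun (n : ℕ) z => M⁻¹ * averageKernel ((n : ℝ) + 1) (z - x))
    (C / M * volume.real (Metric.ball (0 : Space d) 1)) hx'
    (Eventually.of_forall fun n => hw.integrableOn_isCompact (isCompact_closedBall _ _)) ?_ ?_ ?_
  · have h2 := h1.const_mul M
    refine h2.congr fun n => ?_
    rw [average, ← integral_const_mul]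
    refine integral_congr_ae (Eventually.of_forall fun z => ?_)
    simp only [smul_eq_mul]
    field_simp
  · refine tendsto_const_nhds.congr fun n => ?_
    rw [integral_const_mul, integral_sub_right_eq_self (fun z => averageKernel ((n : ℝ) + 1) z) x,
      integral_averageKernel (by positivity), inv_mul_cancel₀ hM0.ne']
  · refine Eventually.of_forall fun n z hz => ?_
    by_contra hz'
    refine hz ?_
    have h2 : z - x ∉ Metric.closedBall (0 : Space d) ((n : ℝ) + 1)⁻¹ := by
      rw [mem_closedBall_zero_iff, ← mem_closedBall_iff_norm]; exact hz'
    dsimp only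
    rw [averageKernel_eq_zero (by positivity) h2, mul_zero]
  · refine Eventually.of_forall fun n z => ?_
    have hn : (0 : ℝ) < (n : ℝ) + 1 := by positivity
    have hv : 0 < volume.real (Metric.ball (0 : Space d) 1) :=
      ENNReal.toReal_pos (Metric.measure_ball_pos volume _ one_pos).ne' measure_ball_lt_top.ne
    simp only
    rw [Measure.addHaar_real_closedBall _ _ (by positivity), finrank_euclideanSpace,
      Fintype.card_fin, abs_of_nonneg (mul_nonneg (by positivity) (averageKernel_nonneg hn _)),
      averageKernel, inv_pow]
    have h3 := hC (((n : ℝ) + 1) ^ 2 * ‖z - x‖ ^ 2) (by positivity)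
    calc M⁻¹ * (((n : ℝ) + 1) ^ d * profileSlope (((n : ℝ) + 1) ^ 2 * ‖z - x‖ ^ 2))
        ≤ M⁻¹ * (((n : ℝ) + 1) ^ d * C) := by gcongr
      _ = _ := by field_simp

/-- Positive supersolutions are locally bounded below by positive constants. -/
theorem IsSupersolution.exists_pos_le {c : ℝ} (hc : 0 ≤ c) (h : IsSupersolution c w)
    (hw : LocallyIntegrable w volume) (hw0 : ∀ᵐ x, 0 < w x) (R : ℝ) :
    ∃ δ > 0, ∀ᵐ x, x ∈ Metric.closedBall (0 : Space d) R → δ ≤ w x := by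
  set M := ∫ z : Space d, averageKernel 1 z with hM
  have hM0 : 0 < M := integral_averageKernel_one_pos
  have hw0' : ∀ᵐ x, 0 ≤ w x := hw0.mono fun x hx => hx.le
  have hcont : Continuous fun x => average w x 1 := by
    have h1 := (hasCompactSupport_averageKernel (d := d) one_pos).continuous_convolution_left
      (μ := volume) (ContinuousLinearMap.mul ℝ ℝ) (contDiff_averageKernel 1).continuous hw
    refine h1.congr fun x => ?_
    rw [convolution_eq_swap, average]
    refine integral_congr_ae (Eventually.of_forall fun z => ?_)
    simp [averageKernel, norm_sub_rev z x]
  have hpos : ∀ x, 0 < average w x 1 := by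
    intro x
    have hi : Integrable (fun z => averageKernel 1 (z - x) * w z) volume :=
      integrable_mul_of_hasCompactSupport hw (continuous_averageKernel_sub 1 x)
        (hasCompactSupport_averageKernel_sub one_pos x)
    rw [average, integral_pos_iff_support_of_nonneg_ae ?_ hi]
    · have h1 : Metric.ball x 1 ≤ᵐ[volume]
          Function.support (fun z => averageKernel 1 (z - x) * w z) := by
        filter_upwards [hw0] with z hz hzb
        have h2 : ‖z - x‖ < 1 := mem_ball_iff_norm.1 hzb
        have h3 : 0 < profileSlope (1 ^ 2 * ‖z - x‖ ^ 2) := by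
          refine profileSlope_pos ?_
          nlinarith [norm_nonneg (z - x)]
        have h4 : 0 < averageKernel 1 (z - x) := by rw [averageKernel]; positivity
        exact (mul_pos h4 hz).ne'
      exact lt_of_lt_of_le (Metric.measure_ball_pos volume x one_pos) (measure_mono_ae h1)
    · filter_upwards [hw0'] with z hz
      exact mul_nonneg (averageKernel_nonneg one_pos _) hz
  obtain ⟨δ, hδ0, hδ⟩ : ∃ δ > 0, ∀ x ∈ Metric.closedBall (0 : Space d) R, δ ≤ average w x 1 := by
    rcases (Metric.closedBall (0 : Space d) R).eq_empty_or_nonempty with he | hne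
    · exact ⟨1, one_pos, by simp [he]⟩
    · obtain ⟨x₀, -, hx₀⟩ := (isCompact_closedBall (0 : Space d) R).exists_isMinOn hne
        hcont.continuousOn
      exact ⟨_, hpos x₀, fun x hx => hx₀ hx⟩
  -- The bound `δ` at scale one persists at every scale `(n + 1)⁻¹` with the loss `exp (-c / 4)`,
  -- and the averages tend to `M * w x`.
  refine ⟨M⁻¹ * (Real.exp (-(c / 4)) * δ), by positivity, ?_⟩
  filter_upwards [ae_tendsto_average hw] with x hx hxR
  have h1 : Real.exp (-(c / 4)) * δ ≤ M * w x := by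
    refine ge_of_tendsto' hx fun n => ?_
    refine le_trans ?_ (h.average_one_le hc hw hw0' x (s := (n : ℝ) + 1) (by simp))
    exact mul_le_mul_of_nonneg_left (hδ x hxR) (Real.exp_pos _).le
  calc M⁻¹ * (Real.exp (-(c / 4)) * δ) ≤ M⁻¹ * (M * w x) := by gcongr
    _ = w x := by rw [← mul_assoc, inv_mul_cancel₀ hM0.ne', one_mul]

end Average

end SingularSchrodinger

namespace SingularSchrodinger

variable {d : ℕ} {Γ : Set (Space d)}

/-! ### The form on almost everywhere equal functions -/

/-- As for `weakGrad`, the defining predicates coincide and hence so do the chosen functions. -/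
lemma trace_congr {f g : Space d → ℂ} (h : f =ᵐ[volume] g) : trace Γ f = trace Γ g := by
  have h1 : ∀ {f g : Space d → ℂ}, f =ᵐ[volume] g → ∀ t, IsTrace Γ f t → IsTrace Γ g t := by
    rintro f g h t ⟨ht, η, hη, hlim, hlim'⟩
    refine ⟨ht, η, hη, hlim.congr fun n => ?_, hlim'⟩
    have h2 : η n - f =ᵐ[volume] η n - g := by
      filter_upwards [h] with x hx
      simp [hx]
    rw [eLpNorm_congr_ae h2, weakGrad_congr h2]
  have h3 : IsTrace Γ f = IsTrace Γ g := by
    ext t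
    exact ⟨h1 h t, h1 h.symm t⟩
  have key : ∀ P Q : (Space d → ℂ) → Prop, P = Q →
      (open Classical in if h : ∃ G, P G then h.choose else 0)
        = (open Classical in if h : ∃ G, Q G then h.choose else 0) := by
    rintro P Q rfl
    rfl
  exact key _ _ h3

lemma singularForm_congr (α : ℝ) {f g f₁ g₁ : Space d → ℂ} (hf : f =ᵐ[volume] f₁)
    (hg : g =ᵐ[volume] g₁) : singularForm Γ α f g = singularForm Γ α f₁ g₁ := by
  rw [singularForm, singularForm, weakGrad_congr hf, weakGrad_congr hg, trace_congr hf,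
    trace_congr hg]

lemma scalarProduct_congr {f g f₁ g₁ : Space d → ℂ} (hf : f =ᵐ[volume] f₁)
    (hg : g =ᵐ[volume] g₁) : scalarProduct f g = scalarProduct f₁ g₁ := by
  refine integral_congr_ae ?_
  filter_upwards [hf, hg] with x h1 h2
  rw [h1, h2]

/-! ### Positive eigenfunctions are supersolutions -/

lemma fderiv_ofReal_comp {g : Space d → ℝ} (hg : ContDiff ℝ 1 g) (x v : Space d) :
    fderiv ℝ (fun x => (g x : ℂ)) x v = (fderiv ℝ g x v : ℂ) := by
  have h1 : HasFDerivAt (fun x => (g x : ℂ)) (Complex.ofRealCLM.comp (fderiv ℝ g x)) x :=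
    Complex.ofRealCLM.hasFDerivAt.comp x (hg.differentiable one_ne_zero x).hasFDerivAt
  rw [h1.fderiv]
  rfl

/-- The partial derivatives of a test function are again test functions, so the definition of the
weak gradient applies to each of them and moves the remaining derivative onto `g`. -/
lemma integral_inner_weakGrad_test {f : Space d → ℂ} (hf : MemW12 volume f) {g : Space d → ℝ}
    (hg : ContDiff ℝ ∞ g) (hgc : HasCompactSupport g) :
    ∫ x, inner ℂ (weakGrad (fun x => (g x : ℂ)) x) (weakGrad f x)
      = -∫ x, f x * (lap g x : ℂ) := by
  have hg1 : ContDiff ℝ 1 g := hg.of_le (by exact_mod_cast le_top)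
  have hgC : ContDiff ℝ 1 (fun x => (g x : ℂ)) := Complex.ofRealCLM.contDiff.comp hg1
  have hgi : ∀ i, ContDiff ℝ ∞ fun y => fderiv ℝ g y (EuclideanSpace.single i (1 : ℝ)) :=
    fun i => contDiff_fderiv_apply hg _
  have hgic : ∀ i, HasCompactSupport fun y => fderiv ℝ g y (EuclideanSpace.single i (1 : ℝ)) :=
    fun i => hasCompactSupport_fderiv_apply hgc _
  have hint : ∀ i, Integrable (fun x => weakGrad f x i *
      ((fderiv ℝ g x (EuclideanSpace.single i 1) : ℝ) : ℂ)) volume := by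
    intro i
    have := (hf.hasWeakGradient.hasWeakDeriv i).locallyIntegrable_deriv
      |>.integrable_smul_right_of_hasCompactSupport
        (Complex.continuous_ofReal.comp (hgi i).continuous)
        ((hgic i).comp_left (g := fun t : ℝ => (t : ℂ)) rfl)
    exact this
  have hint2 : ∀ i, Integrable (fun x => f x *
      ((fderiv ℝ (fun y => fderiv ℝ g y (EuclideanSpace.single i (1 : ℝ))) x
        (EuclideanSpace.single i (1 : ℝ)) : ℝ) : ℂ)) volume := by
    intro i
    have := hf.hasWeakGradient.locallyIntegrable.integrable_smul_right_of_hasCompactSupport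
        (Complex.continuous_ofReal.comp
          (contDiff_fderiv_apply (hgi i) (EuclideanSpace.single i 1)).continuous)
        ((hasCompactSupport_fderiv_apply (hgic i) (EuclideanSpace.single i 1)).comp_left
          (g := fun t : ℝ => (t : ℂ)) rfl)
    exact this
  calc ∫ x, inner ℂ (weakGrad (fun x => (g x : ℂ)) x) (weakGrad f x)
      = ∫ x, ∑ i, weakGrad f x i * ((fderiv ℝ g x (EuclideanSpace.single i 1) : ℝ) : ℂ) := by
        refine integral_congr_ae ?_
        filter_upwards [weakGrad_ae_eq_grad hgC] with x hx
        rw [hx, PiLp.inner_apply]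
        refine Finset.sum_congr rfl fun i _ => ?_
        rw [RCLike.inner_apply, grad_apply, fderiv_ofReal_comp hg1]
        simp
    _ = ∑ i, -∫ x, f x * ((fderiv ℝ (fun y => fderiv ℝ g y (EuclideanSpace.single i (1 : ℝ))) x
        (EuclideanSpace.single i (1 : ℝ)) : ℝ) : ℂ) := by
        rw [integral_finsetSum _ fun i _ => hint i]
        refine Finset.sum_congr rfl fun i _ => ?_
        rw [hf.hasWeakGradient.integral_eq _ (hgi i) (hgic i) i, neg_neg]
    _ = _ := by
        rw [Finset.sum_neg_distrib, ← integral_finsetSum _ fun i _ => hint2 i]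
        congr 1
        refine integral_congr_ae (Eventually.of_forall fun x => ?_)
        simp only [lap]
        push_cast
        rw [Finset.mul_sum]

/-- A nonnegative `w` is approximated by nonnegative test functions, and the sign survives in the
limit. It makes the attractive surface term work in favour of the supersolution property. -/
lemma integral_trace_test_nonneg (hd : 1 ≤ d) (hΓ : IsCompactHypersurface Γ) {w : Space d → ℝ}
    (hw : MemW12 volume fun x => (w x : ℂ)) (hw0 : ∀ᵐ x, 0 ≤ w x) {g : Space d → ℝ}
    (hg : ContDiff ℝ ∞ g) (hgc : HasCompactSupport g) (hg0 : ∀ x, 0 ≤ g x) :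
    0 ≤ (∫ x, trace Γ (fun x => (w x : ℂ)) x * conj (trace Γ (fun x => (g x : ℂ)) x)
      ∂(surfaceMeasure Γ)).re := by
  obtain ⟨η, hη, hlim, hpos⟩ := hw.exists_tendstoW12
  have hpos' := hpos ⟨w, hw0, ae_eq_rfl⟩
  have hgC : ContDiff ℝ ∞ (fun x => (g x : ℂ)) := Complex.ofRealCLM.contDiff.comp hg
  have hgCc : HasCompactSupport (fun x => (g x : ℂ)) :=
    hgc.comp_left (g := fun t : ℝ => (t : ℂ)) rfl
  have hgC1 : ContDiff ℝ 1 (fun x => (g x : ℂ)) := hgC.of_le (by exact_mod_cast le_top)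
  have hlim2 : TendstoW12 (fun _ => fun x => (g x : ℂ)) (fun x => (g x : ℂ)) :=
    tendstoW12_of_tendsto (K := fun _ => grad fun x => (g x : ℂ)) (fun _ => hgC1.hasWeakGradient)
      hgC1.hasWeakGradient (by simp) (by simp)
  have h1 := tendsto_integral_trace hd hΓ hw (memW12_of_contDiff hgC1 hgCc) hη
    (fun _ => ⟨hgC, hgCc⟩) hlim hlim2
  refine ge_of_tendsto' ((Complex.continuous_re.tendsto _).comp h1) fun n => ?_
  choose r hr0 hr using hpos' n
  have h2 : ∀ x, η n x * conj ((g x : ℝ) : ℂ) = ((r x * g x : ℝ) : ℂ) := by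
    intro x
    rw [hr x, Complex.conj_ofReal]
    push_cast
    rfl
  simp only [Function.comp_apply, h2]
  rw [integral_complex_ofReal, Complex.ofReal_re]
  exact integral_nonneg fun x => mul_nonneg (hr0 x) (hg0 x)

/-- A nonnegative eigenfunction is a supersolution. -/
lemma IsHamiltonianValue.isSupersolution (hd : 1 ≤ d) (hΓ : IsCompactHypersurface Γ) {α : ℝ}
    (hα : 0 < α) {w : Space d → ℝ} {E : ℝ}
    (h : IsHamiltonianValue Γ α (fun x => (w x : ℂ)) (fun x => (E : ℂ) * (w x : ℂ)))
    (hw0 : ∀ᵐ x, 0 ≤ w x) : IsSupersolution |E| w := by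
  intro g hg hgc hg0
  have hw := h.1
  have hwl : LocallyIntegrable w volume := fun x => by
    obtain ⟨U, hU, hint⟩ := hw.hasWeakGradient.locallyIntegrable x
    exact ⟨U, hU, hint.re⟩
  have hgC : ContDiff ℝ 1 (fun x => (g x : ℂ)) :=
    Complex.ofRealCLM.contDiff.comp (hg.of_le (by exact_mod_cast le_top))
  have hgCc : HasCompactSupport (fun x => (g x : ℂ)) :=
    hgc.comp_left (g := fun t : ℝ => (t : ℂ)) rfl
  have heq := h.2.2 _ (memW12_of_contDiff hgC hgCc)
  rw [singularForm, integral_inner_weakGrad_test hw hg hgc] at heq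
  have hT := integral_trace_test_nonneg hd hΓ hw hw0 hg hgc hg0
  set T := ∫ x, trace Γ (fun x => (w x : ℂ)) x * conj (trace Γ (fun x => (g x : ℂ)) x)
      ∂(surfaceMeasure Γ)
  have hi1 : Integrable (fun x => g x * w x) volume :=
    integrable_mul_of_hasCompactSupport hwl hg.continuous hgc
  have hi2 : Integrable (fun x => lap g x * w x) volume :=
    integrable_mul_of_hasCompactSupport hwl (contDiff_lap hg).continuous (hasCompactSupport_lap hgc)
  have h1 : ∫ x, (w x : ℂ) * (lap g x : ℂ) = ((∫ x, lap g x * w x : ℝ) : ℂ) := by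
    rw [← integral_complex_ofReal]
    refine integral_congr_ae (Eventually.of_forall fun x => ?_)
    dsimp only
    push_cast
    ring
  have h2 : scalarProduct (fun x => (E : ℂ) * (w x : ℂ)) (fun x => (g x : ℂ))
      = ((E * ∫ x, g x * w x : ℝ) : ℂ) := by
    rw [scalarProduct, ← integral_const_mul, ← integral_complex_ofReal]
    refine integral_congr_ae (Eventually.of_forall fun x => ?_)
    dsimp only
    rw [Complex.conj_ofReal]
    push_cast
    ring
  rw [h1, h2] at heq
  have h3 := congrArg Complex.re heq
  simp only [Complex.sub_re, Complex.neg_re, Complex.ofReal_re, Complex.re_ofReal_mul] at h3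
  have h4 : ∫ x, w x * (|E| * g x - lap g x) = |E| * (∫ x, g x * w x) - ∫ x, lap g x * w x := by
    rw [← integral_const_mul, ← integral_sub (hi1.const_mul _) hi2]
    exact integral_congr_ae (Eventually.of_forall fun z => by dsimp only; ring)
  rw [h4]
  have h5 : 0 ≤ ∫ x, g x * w x := integral_nonneg_of_ae (by
    filter_upwards [hw0] with x hx
    exact mul_nonneg (hg0 x) hx)
  have h6 : -E ≤ |E| := neg_le_abs E
  -- The eigenvalue equation turns the goal into `(|E| + E) * ∫ g w + α * Re T ≥ 0`, a sum of
  -- nonnegative terms.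
  nlinarith [mul_nonneg hα.le hT, mul_nonneg (by linarith : 0 ≤ |E| + E) h5]

/-! ### The form on products with an eigenfunction -/

lemma inner_conjVec_left (z v : EuclideanSpace ℂ (Fin d)) :
    inner ℂ (conjVec z) v = inner ℂ (conjVec v) z := by
  simp only [PiLp.inner_apply, RCLike.inner_apply, conjVec_apply, Complex.conj_conj]
  exact Finset.sum_congr rfl fun i _ => mul_comm _ _

/-- Uniqueness of the weak gradient, since a real function equals its conjugate. This reality
produces the cancellation in the ground state transformation. -/
lemma conjVec_weakGrad_ofReal {w : Space d → ℝ}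
    (hw : MemW12 volume fun x => (w x : ℂ)) :
    ∀ᵐ x, conjVec (weakGrad (fun x => (w x : ℂ)) x) = weakGrad (fun x => (w x : ℂ)) x := by
  have h1 := hw.hasWeakGradient.conj
  simp only [Complex.conj_ofReal] at h1
  exact h1.unique hw.hasWeakGradient

lemma memLp_bounded_smul {V : Type*} [NormedAddCommGroup V] [NormedSpace ℂ V] {f : Space d → ℂ}
    {G : Space d → V} (hf : AEStronglyMeasurable f volume)
    {C : ℝ} (hfC : ∀ᵐ x, ‖f x‖ ≤ C) (hG : MemLp G 2 volume) :
    MemLp (fun x => f x • G x) 2 volume :=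
  hG.of_le_mul (c := C) (hf.smul hG.1) (by
    filter_upwards [hfC] with x hx
    rw [norm_smul]
    exact mul_le_mul_of_nonneg_right hx (norm_nonneg _))

lemma locallyIntegrable_bounded_smul {V : Type*} [NormedAddCommGroup V] [NormedSpace ℂ V]
    {f : Space d → ℂ} {G : Space d → V} (hf : AEStronglyMeasurable f volume)
    (hfC : ∀ R : ℝ, ∃ C : ℝ, ∀ᵐ x, x ∈ Metric.closedBall (0 : Space d) R → ‖f x‖ ≤ C)
    (hG : LocallyIntegrable G volume) :
    LocallyIntegrable (fun x => f x • G x) volume := by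
  intro x
  refine ⟨Metric.closedBall 0 (‖x‖ + 1), ?_, ?_⟩
  · refine Filter.mem_of_superset (Metric.ball_mem_nhds x one_pos) fun y hy => ?_
    rw [mem_closedBall_zero_iff]
    have h1 : ‖y - x‖ < 1 := mem_ball_iff_norm.1 hy
    have h2 : ‖y‖ ≤ ‖x‖ + ‖y - x‖ := by
      simpa using norm_add_le x (y - x)
    linarith
  · obtain ⟨C, hC⟩ := hfC (‖x‖ + 1)
    have h1 := hG.integrableOn_isCompact (isCompact_closedBall (0 : Space d) (‖x‖ + 1))
    refine Integrable.mono' (h1.norm.const_mul C) (hf.restrict.smul h1.1) ?_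
    filter_upwards [ae_restrict_of_ae hC, ae_restrict_mem measurableSet_closedBall] with y hy hy'
    rw [norm_smul]
    exact mul_le_mul_of_nonneg_right (hy hy') (norm_nonneg _)

section Eigenfunction

variable {w : Space d → ℝ}

lemma MemW12.hasWeakGradient_mul_of_bounded (hw : MemW12 volume fun x => (w x : ℂ))
    {f : Space d → ℂ} {F : Space d → EuclideanSpace ℂ (Fin d)} (hf : HasWeakGradient f F)
    {C : ℝ} (hfC : ∀ᵐ x, ‖f x‖ ≤ C) (hF : MemLp (fun x => (w x : ℂ) • F x) 2 volume) :
    MemLp (fun x => (w x : ℂ) * f x) 2 volume ∧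
    HasWeakGradient (fun x => (w x : ℂ) * f x)
      (fun x => f x • weakGrad (fun x => (w x : ℂ)) x + (w x : ℂ) • F x) ∧
    MemLp (fun x => f x • weakGrad (fun x => (w x : ℂ)) x + (w x : ℂ) • F x) 2 volume := by
  have hfm := hf.locallyIntegrable.aestronglyMeasurable
  have h1 : MemLp (fun x => (w x : ℂ) * f x) 2 volume := by
    have := memLp_bounded_smul hfm hfC hw.memLp
    simpa only [smul_eq_mul, mul_comm] using this
  have h2 := memLp_bounded_smul hfm hfC hw.memLp_weakGrad_volume
  exact ⟨h1, hw.hasWeakGradient.mul hf (locallyIntegrable_of_memLp_two h1)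
    (locallyIntegrable_of_memLp_two h2) (locallyIntegrable_of_memLp_two hF), h2.add hF⟩

lemma MemW12.mul_of_bounded (hw : MemW12 volume fun x => (w x : ℂ))
    {f : Space d → ℂ} {F : Space d → EuclideanSpace ℂ (Fin d)} (hf : HasWeakGradient f F)
    {C : ℝ} (hfC : ∀ᵐ x, ‖f x‖ ≤ C) (hF : MemLp (fun x => (w x : ℂ) • F x) 2 volume) :
    MemW12 volume fun x => (w x : ℂ) * f x :=
  have h := hw.hasWeakGradient_mul_of_bounded hf hfC hF
  ⟨h.1, _, h.2⟩

/-- The ground state transformation of the form, for bounded functions. -/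
theorem IsHamiltonianValue.form_mul_of_bounded (hd : 1 ≤ d) (hΓ : IsCompactHypersurface Γ)
    {α E : ℝ} (h : IsHamiltonianValue Γ α (fun x => (w x : ℂ)) (fun x => (E : ℂ) * (w x : ℂ)))
    {f g : Space d → ℂ} {F G : Space d → EuclideanSpace ℂ (Fin d)} (hf : HasWeakGradient f F)
    (hg : HasWeakGradient g G) {C : ℝ} (hfC : ∀ᵐ x, ‖f x‖ ≤ C) (hgC : ∀ᵐ x, ‖g x‖ ≤ C)
    (hF : MemLp (fun x => (w x : ℂ) • F x) 2 volume)
    (hG : MemLp (fun x => (w x : ℂ) • G x) 2 volume) :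
    singularForm Γ α (fun x => (w x : ℂ) * f x) (fun x => (w x : ℂ) * g x)
      - (E : ℂ) * scalarProduct (fun x => (w x : ℂ) * f x) (fun x => (w x : ℂ) * g x)
      = ∫ x, inner ℂ ((w x : ℂ) • G x) ((w x : ℂ) • F x) := by
  have hw := h.1
  have hfm := hf.locallyIntegrable.aestronglyMeasurable
  have hgm := hg.locallyIntegrable.aestronglyMeasurable
  have hfcC : ∀ᵐ x, ‖conj (f x)‖ ≤ C := by
    filter_upwards [hfC] with x hx
    simpa using hx
  have hfcm : AEStronglyMeasurable (fun x => conj (f x)) volume :=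
    Complex.continuous_conj.comp_aestronglyMeasurable hfm
  have hfg : HasWeakGradient (fun x => conj (f x) * g x)
      (fun x => g x • conjVec (F x) + conj (f x) • G x) :=
    hf.conj.mul hg
      (locallyIntegrable_bounded_smul hfcm (fun _ => ⟨C, hfcC.mono fun _ h _ => h⟩)
        hg.locallyIntegrable)
      (locallyIntegrable_bounded_smul hgm (fun _ => ⟨C, hgC.mono fun _ h _ => h⟩)
        hf.conj.locallyIntegrable_grad)
      (locallyIntegrable_bounded_smul hfcm (fun _ => ⟨C, hfcC.mono fun _ h _ => h⟩)
        hg.locallyIntegrable_grad)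
  have hfgC : ∀ᵐ x, ‖conj (f x) * g x‖ ≤ C * C := by
    filter_upwards [hfcC, hgC] with x h1 h2
    rw [norm_mul]
    exact mul_le_mul h1 h2 (norm_nonneg _) ((norm_nonneg _).trans h1)
  have hFG : MemLp (fun x => (w x : ℂ) • (g x • conjVec (F x) + conj (f x) • G x)) 2 volume := by
    have h1 := (memLp_bounded_smul hgm hgC hF.conjVec_comp).add
      (memLp_bounded_smul hfcm hfcC hG)
    refine (memLp_congr_ae (Eventually.of_forall fun x => ?_)).1 h1
    ext i
    simp
    ring
  obtain ⟨ha1, ha2, ha3⟩ := hw.hasWeakGradient_mul_of_bounded hf hfC hF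
  obtain ⟨hb1, hb2, hb3⟩ := hw.hasWeakGradient_mul_of_bounded hg hgC hG
  obtain ⟨he1, he2, he3⟩ := hw.hasWeakGradient_mul_of_bounded hfg hfgC hFG
  -- The eigenvalue equation of `w`, tested with `w (conj f * g)`; boundedness of `f` and `g` makes
  -- this an element of `W^{1,2}`.
  have heq := h.2.2 _ ⟨he1, _, he2, he3⟩
  -- The products `(w f) * conj (w g)` and `w * conj (w (conj f * g))` coincide, so the surface
  -- terms agree although the individual traces differ.
  have htrace := integral_trace_mul_conj_congr hd hΓ (a := fun x => (w x : ℂ) * f x)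
    (b := fun x => (w x : ℂ) * g x) (c := fun x => (w x : ℂ))
    (e := fun x => (w x : ℂ) * (conj (f x) * g x)) ⟨ha1, _, ha2, ha3⟩ ⟨hb1, _, hb2, hb3⟩ hw
    ⟨he1, _, he2, he3⟩ (Eventually.of_forall fun x => by
      simp only [map_mul, Complex.conj_ofReal, Complex.conj_conj]
      ring)
  have hsp : scalarProduct (fun x => (E : ℂ) * (w x : ℂ))
      (fun x => (w x : ℂ) * (conj (f x) * g x))
      = (E : ℂ) * scalarProduct (fun x => (w x : ℂ) * f x) (fun x => (w x : ℂ) * g x) := by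
    rw [scalarProduct, scalarProduct, ← integral_const_mul]
    refine integral_congr_ae (Eventually.of_forall fun x => ?_)
    simp only [map_mul, Complex.conj_ofReal, Complex.conj_conj]
    ring
  rw [← hsp, ← heq, singularForm, singularForm, htrace, sub_sub_sub_cancel_right,
    ← integral_sub]
  · refine integral_congr_ae ?_
    filter_upwards [ha2.weakGrad_ae_eq, hb2.weakGrad_ae_eq, he2.weakGrad_ae_eq,
      conjVec_weakGrad_ofReal hw] with x h1 h2 h3 h4
    rw [h1, h2, h3]
    -- Since `∇w` is real, its products with `F` in the two expansions are equal; all terms that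
    -- contain `∇w` cancel.
    have h5 := inner_conjVec_left (F x) (weakGrad (fun x => (w x : ℂ)) x)
    rw [h4] at h5
    simp only [inner_add_left, inner_add_right, inner_smul_left, inner_smul_right, map_mul,
      Complex.conj_ofReal, Complex.conj_conj, h5]
    ring
  · exact integrable_inner_of_memLp ((memLp_congr_ae hb2.weakGrad_ae_eq).2 hb3)
      ((memLp_congr_ae ha2.weakGrad_ae_eq).2 ha3)
  · exact integrable_inner_of_memLp ((memLp_congr_ae he2.weakGrad_ae_eq).2 he3)
      hw.memLp_weakGrad_volume

end Eigenfunction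

end SingularSchrodinger

namespace SingularSchrodinger

variable {d : ℕ} {Γ : Set (Space d)}

/-! ### Coercivity of the form -/

lemma ofReal_integral_norm_sq {α V : Type*} [MeasurableSpace α] {μ : Measure α}
    [NormedAddCommGroup V] {f : α → V} (hf : MemLp f 2 μ) :
    ENNReal.ofReal (∫ x, ‖f x‖ ^ 2 ∂μ) = ∫⁻ x, ‖f x‖ₑ ^ (2 : ℝ) ∂μ := by
  rw [ofReal_integral_eq_lintegral_ofReal (hf.integrable_norm_pow two_ne_zero)
    (Eventually.of_forall fun x => by positivity)]
  refine lintegral_congr fun x => ?_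
  rw [ENNReal.ofReal_pow (norm_nonneg _), ofReal_norm]
  norm_cast

lemma integral_norm_sq_nonneg {α V : Type*} [MeasurableSpace α] (μ : Measure α)
    [NormedAddCommGroup V] (f : α → V) : 0 ≤ ∫ x, ‖f x‖ ^ 2 ∂μ :=
  integral_nonneg fun _ => by positivity

lemma eLpNorm_two_le_of_integral_le {α V : Type*} [MeasurableSpace α] {μ : Measure α}
    [NormedAddCommGroup V] {f : α → V} (hf : MemLp f 2 μ) {M : ℝ} (h : ∫ x, ‖f x‖ ^ 2 ∂μ ≤ M) :
    eLpNorm f 2 μ ≤ ENNReal.ofReal M ^ (1 / 2 : ℝ) := by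
  rw [eLpNorm_two_eq, ← ofReal_integral_norm_sq hf]
  exact ENNReal.rpow_le_rpow (ENNReal.ofReal_le_ofReal h) (by norm_num)

lemma integral_inner_self {α V : Type*} [MeasurableSpace α] (μ : Measure α)
    [NormedAddCommGroup V] [InnerProductSpace ℂ V] (f : α → V) :
    ∫ x, inner ℂ (f x) (f x) ∂μ = ((∫ x, ‖f x‖ ^ 2 ∂μ : ℝ) : ℂ) := by
  rw [← integral_complex_ofReal]
  refine integral_congr_ae (Eventually.of_forall fun x => ?_)
  dsimp only
  rw [inner_self_eq_norm_sq_to_K]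
  push_cast
  rfl

lemma scalarProduct_self (f : Space d → ℂ) :
    scalarProduct f f = ((∫ x, ‖f x‖ ^ 2 : ℝ) : ℂ) := by
  rw [← integral_inner_self, scalarProduct]
  simp only [RCLike.inner_apply]

lemma singularForm_self (α : ℝ) (f : Space d → ℂ) :
    singularForm Γ α f f = ((∫ x, ‖weakGrad f x‖ ^ 2) -
      α * ∫ x, ‖trace Γ f x‖ ^ 2 ∂(surfaceMeasure Γ) : ℝ) := by
  have h := integral_inner_self (surfaceMeasure Γ) (trace Γ f)
  simp only [RCLike.inner_apply] at h
  rw [singularForm, integral_inner_self, h]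
  push_cast
  rfl

lemma re_form_self (α E : ℝ) (f : Space d → ℂ) :
    (singularForm Γ α f f - (E : ℂ) * scalarProduct f f).re
      = (∫ x, ‖weakGrad f x‖ ^ 2) - α * (∫ x, ‖trace Γ f x‖ ^ 2 ∂(surfaceMeasure Γ))
        - E * ∫ x, ‖f x‖ ^ 2 := by
  rw [singularForm_self, scalarProduct_self, ← Complex.ofReal_mul, ← Complex.ofReal_sub,
    Complex.ofReal_re]

lemma re_form_self_le {α : ℝ} (hα : 0 ≤ α) (E : ℝ) (f : Space d → ℂ) :
    (singularForm Γ α f f - (E : ℂ) * scalarProduct f f).re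
      ≤ (∫ x, ‖weakGrad f x‖ ^ 2) + |E| * ∫ x, ‖f x‖ ^ 2 := by
  rw [re_form_self]
  have h1 := mul_nonneg hα (integral_norm_sq_nonneg (surfaceMeasure Γ) (trace Γ f))
  have h2 := mul_le_mul_of_nonneg_right (neg_le_abs E) (integral_norm_sq_nonneg volume f)
  linarith

lemma exists_integral_trace_sq_le (hd : 1 ≤ d) (hΓ : IsCompactHypersurface Γ) :
    ∃ C : ℝ, 0 < C ∧ ∀ ε : ℝ, 0 < ε → ∀ f : Space d → ℂ, MemW12 volume f →
      ∫ x, ‖trace Γ f x‖ ^ 2 ∂(surfaceMeasure Γ)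
        ≤ C * (1 + ε⁻¹) * (∫ x, ‖f x‖ ^ 2) + C * ε * ∫ x, ‖weakGrad f x‖ ^ 2 := by
  obtain ⟨C, hC0, hC⟩ := exists_lintegral_trace_sq_le hd hΓ
  refine ⟨C, hC0, fun ε hε f hf => ?_⟩
  have h1 := hC ε hε f hf
  have h2 := integral_norm_sq_nonneg volume f
  have h3 := integral_norm_sq_nonneg volume (weakGrad f)
  rw [← ofReal_integral_norm_sq (memLp_trace hd hΓ hf), ← ofReal_integral_norm_sq hf.memLp,
    ← ofReal_integral_norm_sq hf.memLp_weakGrad_volume, ← ENNReal.ofReal_mul (by positivity),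
    ← ENNReal.ofReal_mul (by positivity), ← ENNReal.ofReal_add (by positivity) (by positivity),
    ENNReal.ofReal_le_ofReal_iff (by positivity)] at h1
  exact h1

/-- The form is bounded below, and coercive after a shift. -/
lemma exists_integral_weakGrad_sq_le (hd : 1 ≤ d) (hΓ : IsCompactHypersurface Γ) {α : ℝ}
    (hα : 0 < α) (E : ℝ) : ∃ K : ℝ, 0 ≤ K ∧ ∀ f : Space d → ℂ, MemW12 volume f →
      ∫ x, ‖weakGrad f x‖ ^ 2 ≤ 2 * (singularForm Γ α f f - (E : ℂ) * scalarProduct f f).re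
        + K * ∫ x, ‖f x‖ ^ 2 := by
  obtain ⟨C, hC0, hC⟩ := exists_integral_trace_sq_le hd hΓ
  -- Chosen so that `α * C * ε = 1 / 2`: the trace term costs half of the gradient term, whence the
  -- factor 2 in front of the form.
  set ε := (2 * α * C)⁻¹ with hε
  have hε0 : 0 < ε := by positivity
  refine ⟨2 * (α * (C * (1 + ε⁻¹)) + |E|), by positivity, fun f hf => ?_⟩
  have h1 := mul_le_mul_of_nonneg_left (hC ε hε0 f hf) hα.le
  have h2 : α * (C * ε) = 1 / 2 := by
    rw [hε]; field_simp
  have h3 := mul_le_mul_of_nonneg_right (le_abs_self E) (integral_norm_sq_nonneg volume f)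
  rw [re_form_self]
  have h4 : α * (C * (1 + ε⁻¹) * (∫ x, ‖f x‖ ^ 2) + C * ε * ∫ x, ‖weakGrad f x‖ ^ 2)
      = α * (C * (1 + ε⁻¹)) * (∫ x, ‖f x‖ ^ 2) + 1 / 2 * ∫ x, ‖weakGrad f x‖ ^ 2 := by
    rw [← h2]; ring
  rw [h4] at h1
  linarith

/-! ### Continuity of the form -/

lemma tendsto_normW12_iff {η : ℕ → Space d → ℂ} {f : Space d → ℂ} :
    TendstoW12 η f ↔ Tendsto (fun n => normW12 (η n - f)) atTop (𝓝 0) := Iff.rfl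

/-- The form is continuous on `W^{1,2}(ℝ^d)`. -/
lemma tendsto_singularForm_of_memW12 (hd : 1 ≤ d) (hΓ : IsCompactHypersurface Γ) (α : ℝ)
    {f g : Space d → ℂ} (hf : MemW12 volume f) (hg : MemW12 volume g) {fn gn : ℕ → Space d → ℂ}
    (hfn : ∀ n, MemW12 volume (fn n)) (hgn : ∀ n, MemW12 volume (gn n)) (hflim : TendstoW12 fn f)
    (hglim : TendstoW12 gn g) :
    Tendsto (fun n => singularForm Γ α (fn n) (gn n)) atTop (𝓝 (singularForm Γ α f g)) := by
  have hpos : ∀ n : ℕ, (0 : ℝ≥0∞) < ((n : ℝ≥0∞) + 1)⁻¹ := fun n =>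
    ENNReal.inv_pos.2 (by finiteness)
  -- Continuity is known along test functions. Each pair `fn n`, `gn n` is replaced by test
  -- functions that are `(n + 1)⁻¹`-close in `W^{1,2}` and in the value of the form.
  have hdiag : ∀ n : ℕ, ∃ η ζ : Space d → ℂ, (ContDiff ℝ ∞ η ∧ HasCompactSupport η) ∧
      (ContDiff ℝ ∞ ζ ∧ HasCompactSupport ζ) ∧ normW12 (η - fn n) < ((n : ℝ≥0∞) + 1)⁻¹ ∧
      normW12 (ζ - gn n) < ((n : ℝ≥0∞) + 1)⁻¹ ∧
      edist (singularForm Γ α η ζ) (singularForm Γ α (fn n) (gn n)) < ((n : ℝ≥0∞) + 1)⁻¹ := by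
    intro n
    obtain ⟨η, hη, hηlim, -⟩ := (hfn n).exists_tendstoW12
    obtain ⟨ζ, hζ, hζlim, -⟩ := (hgn n).exists_tendstoW12
    have h1 := tendsto_singularForm hd hΓ α (hfn n) (hgn n) hη hζ hηlim hζlim
    have h2 := (tendsto_order.1 (tendsto_normW12_iff.1 hηlim)).2 _ (hpos n)
    have h3 := (tendsto_order.1 (tendsto_normW12_iff.1 hζlim)).2 _ (hpos n)
    have h4 := (tendsto_order.1 (tendsto_iff_edist_tendsto_0.1 h1)).2 _ (hpos n)
    obtain ⟨k, hk2, hk3, hk4⟩ := (h2.and (h3.and h4)).exists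
    exact ⟨η k, ζ k, hη k, hζ k, hk2, hk3, hk4⟩
  choose η ζ hη hζ h1 h2 h3 using hdiag
  have hη' : IsTestSeq η := hη
  have hζ' : IsTestSeq ζ := hζ
  have hinv : Tendsto (fun n : ℕ => ((n : ℝ≥0∞) + 1)⁻¹) atTop (𝓝 0) := by
    have := (ENNReal.tendsto_inv_nat_nhds_zero).comp (tendsto_add_atTop_nat 1)
    refine this.congr fun n => ?_
    simp
  have hlim : ∀ {f : Space d → ℂ} {fn η : ℕ → Space d → ℂ}, MemW12 volume f →
      (∀ n, MemW12 volume (fn n)) → IsTestSeq η → TendstoW12 fn f →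
      (∀ n, normW12 (η n - fn n) < ((n : ℝ≥0∞) + 1)⁻¹) → TendstoW12 η f := by
    intro f fn η hf hfn hη hflim h
    have h4 := hinv.add (tendsto_normW12_iff.1 hflim)
    rw [add_zero] at h4
    refine tendsto_normW12_iff.2 (tendsto_of_tendsto_of_tendsto_of_le_of_le tendsto_const_nhds h4
      (fun _ => zero_le) fun n => ?_)
    have h5 := normW12_sub_le (hη.memW12 n) hf (hfn n)
    have h6 : normW12 (f - fn n) = normW12 (fn n - f) := by
      have h7 : weakGrad (f - fn n) =ᵐ[volume] -weakGrad (fn n - f) := by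
        filter_upwards [hf.weakGrad_sub (hfn n), (hfn n).weakGrad_sub hf] with x h7 h8
        simp [h7, h8]
      rw [normW12, normW12, eLpNorm_congr_ae h7, eLpNorm_neg, ← eLpNorm_neg, neg_sub]
    rw [h6] at h5
    exact h5.trans (add_le_add (h n).le le_rfl)
  have h4 := tendsto_singularForm hd hΓ α hf hg hη' hζ' (hlim hf hfn hη' hflim h1)
    (hlim hg hgn hζ' hglim h2)
  refine tendsto_iff_edist_tendsto_0.2 ?_
  have h5 := hinv.add (tendsto_iff_edist_tendsto_0.1 h4)
  rw [add_zero] at h5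
  refine tendsto_of_tendsto_of_tendsto_of_le_of_le tendsto_const_nhds h5
      (fun _ => zero_le) fun n => ?_
  refine (edist_triangle _ (singularForm Γ α (η n) (ζ n)) _).trans (add_le_add ?_ le_rfl)
  rw [edist_comm]
  exact (h3 n).le

/-! ### Truncation of functions with a weak gradient -/

/-- The derivative of the truncation, applied to each coordinate of a vector. -/
noncomputable def truncateGrad (n : ℕ) (z : ℂ) (v : EuclideanSpace ℂ (Fin d)) :
    EuclideanSpace ℂ (Fin d) :=
  WithLp.toLp 2 fun i => fderiv ℝ (truncate n) z (v i)

lemma continuous_truncateGrad (n : ℕ) :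
    Continuous fun p : ℂ × EuclideanSpace ℂ (Fin d) => truncateGrad n p.1 p.2 := by
  have h1 : Continuous (fderiv ℝ (truncate n)) :=
    (contDiff_truncate n).continuous_fderiv (by simp)
  unfold truncateGrad
  fun_prop

lemma norm_truncateGrad_le {C : ℝ} (hC0 : 0 ≤ C) {n : ℕ} {z : ℂ}
    (hC : ‖fderiv ℝ (truncate n) z‖ ≤ C) (v : EuclideanSpace ℂ (Fin d)) :
    ‖truncateGrad n z v‖ ≤ C * ‖v‖ := by
  refine le_of_sq_le_sq ?_ (by positivity)
  rw [mul_pow, EuclideanSpace.norm_sq_eq, EuclideanSpace.norm_sq_eq, Finset.mul_sum]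
  refine Finset.sum_le_sum fun i _ => ?_
  rw [← mul_pow]
  exact pow_le_pow_left₀ (norm_nonneg _) (ContinuousLinearMap.le_of_opNorm_le _ hC _) 2

lemma eventually_truncateGrad_eq (z : ℂ) (v : EuclideanSpace ℂ (Fin d)) :
    ∀ᶠ n : ℕ in atTop, truncateGrad n z v = v := by
  filter_upwards [eventually_fderiv_truncate_eq z] with n hn
  ext i
  simp [truncateGrad, hn]

lemma HasWeakGradient.truncate {f : Space d → ℂ} {F : Space d → EuclideanSpace ℂ (Fin d)}
    (h : HasWeakGradient f F) (n : ℕ) :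
    HasWeakGradient (fun x => truncate n (f x)) (fun x => truncateGrad n (f x) (F x)) := by
  obtain ⟨C, hC0, hC⟩ := exists_norm_fderiv_truncate_le
  have hfm := h.locallyIntegrable.aestronglyMeasurable
  refine of_hasWeakDeriv ?_ ?_ fun i => (h.hasWeakDeriv i).comp_truncate n
  · exact h.locallyIntegrable.mono
      ((contDiff_truncate n).continuous.comp_aestronglyMeasurable hfm)
      (Eventually.of_forall fun x => norm_truncate_le n _)
  · refine (h.locallyIntegrable_grad.norm.smul C).mono ((continuous_truncateGrad n)
      |>.comp_aestronglyMeasurable (hfm.prodMk h.locallyIntegrable_grad.aestronglyMeasurable))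
      (Eventually.of_forall fun x => ?_)
    refine (norm_truncateGrad_le hC0 (hC n _) _).trans (le_of_eq ?_)
    simp [abs_of_nonneg hC0]

lemma eLpNorm_le_of_tendsto {α V : Type*} [MeasurableSpace α] {μ : Measure α}
    [NormedAddCommGroup V] {f : ℕ → α → V} {g : α → V} {K : ℕ → ℝ≥0∞} {K' : ℝ≥0∞}
    (hf : ∀ n, AEStronglyMeasurable (f n) μ) (hK : ∀ n, eLpNorm (f n) 2 μ ≤ K n)
    (hK' : Tendsto K atTop (𝓝 K')) (h : ∀ᵐ x ∂μ, Tendsto (fun n => f n x) atTop (𝓝 (g x))) :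
    eLpNorm g 2 μ ≤ K' :=
  calc eLpNorm g 2 μ ≤ liminf (fun n => eLpNorm (f n) 2 μ) atTop :=
        Lp.eLpNorm_lim_le_liminf_eLpNorm hf g h
    _ ≤ liminf K atTop := liminf_le_liminf (Eventually.of_forall hK)
    _ = K' := hK'.liminf_eq

section Eigenfunction

variable {w : Space d → ℝ} {ψ : Space d → ℂ} {F : Space d → EuclideanSpace ℂ (Fin d)}

lemma aestronglyMeasurable_truncateGrad (hψ : HasWeakGradient ψ F) (n : ℕ) :
    AEStronglyMeasurable (fun x => truncateGrad n (ψ x) (F x)) volume :=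
  (continuous_truncateGrad n).comp_aestronglyMeasurable
    (hψ.locallyIntegrable.aestronglyMeasurable.prodMk
      hψ.locallyIntegrable_grad.aestronglyMeasurable)

lemma memLp_smul_truncateGrad (hw : MemW12 volume fun x => (w x : ℂ)) (hψ : HasWeakGradient ψ F)
    (hF : MemLp (fun x => (w x : ℂ) • F x) 2 volume) (n : ℕ) :
    MemLp (fun x => (w x : ℂ) • truncateGrad n (ψ x) (F x)) 2 volume := by
  obtain ⟨C, hC0, hC⟩ := exists_norm_fderiv_truncate_le
  refine hF.of_le_mul (c := C) (hw.memLp.1.smul (aestronglyMeasurable_truncateGrad hψ n))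
    (Eventually.of_forall fun x => ?_)
  rw [norm_smul, norm_smul]
  calc _ ≤ ‖(w x : ℂ)‖ * (C * ‖F x‖) := by
        gcongr
        exact norm_truncateGrad_le hC0 (hC n _) _
    _ = _ := by ring

lemma MemW12.mul_truncate (hw : MemW12 volume fun x => (w x : ℂ)) (hψ : HasWeakGradient ψ F)
    (hF : MemLp (fun x => (w x : ℂ) • F x) 2 volume) (n : ℕ) :
    MemW12 volume fun x => (w x : ℂ) * truncate n (ψ x) :=
  hw.mul_of_bounded (hψ.truncate n) (C := 2 * ((n : ℝ) + 1))
    (Eventually.of_forall fun _ => norm_truncate_le_const n _) (memLp_smul_truncateGrad hw hψ hF n)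

end Eigenfunction

end SingularSchrodinger

namespace SingularSchrodinger

variable {d : ℕ} {Γ : Set (Space d)}

/-! ### The ground state transformation -/

section Eigenfunction

variable {w : Space d → ℝ} {ψ : Space d → ℂ} {F : Space d → EuclideanSpace ℂ (Fin d)}

lemma integral_norm_sq_le {V V' : Type*} [NormedAddCommGroup V] [NormedAddCommGroup V']
    {f : Space d → V} {g : Space d → V'} (hf : MemLp f 2 volume) (hg : MemLp g 2 volume) {C : ℝ}
    (h : ∀ x, ‖f x‖ ≤ C * ‖g x‖) : ∫ x, ‖f x‖ ^ 2 ≤ C ^ 2 * ∫ x, ‖g x‖ ^ 2 := by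
  rw [← integral_const_mul]
  refine integral_mono (hf.integrable_norm_pow two_ne_zero)
    ((hg.integrable_norm_pow two_ne_zero).const_mul _) fun x => ?_
  dsimp only
  rw [← mul_pow]
  exact pow_le_pow_left₀ (norm_nonneg _) (h x) 2

lemma norm_smul_truncateGrad_le {C : ℝ} (hC0 : 0 ≤ C)
    (hC : ∀ n z, ‖fderiv ℝ (truncate n) z‖ ≤ C) (n : ℕ) (x : Space d) :
    ‖(w x : ℂ) • truncateGrad n (ψ x) (F x)‖ ≤ C * ‖(w x : ℂ) • F x‖ := by
  rw [norm_smul, norm_smul, mul_left_comm]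
  exact mul_le_mul_of_nonneg_left (norm_truncateGrad_le hC0 (hC n _) _) (norm_nonneg _)

lemma norm_mul_truncate_le (n : ℕ) (x : Space d) :
    ‖(w x : ℂ) * truncate n (ψ x)‖ ≤ 1 * ‖(w x : ℂ) * ψ x‖ := by
  rw [norm_mul, norm_mul, one_mul]
  exact mul_le_mul_of_nonneg_left (norm_truncate_le n _) (norm_nonneg _)

/-- If `ψ` and its weak gradient are square integrable with respect to `w² dx`, then so is
`w⁻¹ ψ ∇w`. -/
lemma IsHamiltonianValue.memLp_smul_weakGrad (hd : 1 ≤ d) (hΓ : IsCompactHypersurface Γ)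
    {α E : ℝ} (hα : 0 < α)
    (h : IsHamiltonianValue Γ α (fun x => (w x : ℂ)) (fun x => (E : ℂ) * (w x : ℂ)))
    (hψ : HasWeakGradient ψ F) (hψw : MemLp (fun x => (w x : ℂ) * ψ x) 2 volume)
    (hF : MemLp (fun x => (w x : ℂ) • F x) 2 volume) :
    MemLp (fun x => ψ x • weakGrad (fun x => (w x : ℂ)) x) 2 volume := by
  have hw := h.1
  obtain ⟨C, hC0, hC⟩ := exists_norm_fderiv_truncate_le
  obtain ⟨K, hK0, hK⟩ := exists_integral_weakGrad_sq_le hd hΓ hα E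
  have hFn := memLp_smul_truncateGrad hw hψ hF
  have ha := hw.mul_truncate hψ hF
  have hb : ∀ n : ℕ, ∀ᵐ x, ‖truncate n (ψ x)‖ ≤ 2 * ((n : ℝ) + 1) := fun n =>
    Eventually.of_forall fun _ => norm_truncate_le_const n _
  have hgrad : ∀ n, weakGrad (fun x => (w x : ℂ) * truncate n (ψ x)) =ᵐ[volume]
      fun x => truncate n (ψ x) • weakGrad (fun x => (w x : ℂ)) x
        + (w x : ℂ) • truncateGrad n (ψ x) (F x) := fun n =>
    (hw.hasWeakGradient_mul_of_bounded (hψ.truncate n) (hb n) (hFn n)).2.1.weakGrad_ae_eq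
  -- Coercivity bounds the gradient of `w * truncate n ψ` by the form and the `L²` norm. The
  -- identity for bounded functions gives the first summand, with `C` the uniform bound for the
  -- derivatives of the truncations.
  set M := 2 * (C ^ 2 * ∫ x, ‖(w x : ℂ) • F x‖ ^ 2) + K * (1 ^ 2 * ∫ x, ‖(w x : ℂ) * ψ x‖ ^ 2)
  have hbound : ∀ n, ∫ x, ‖weakGrad (fun x => (w x : ℂ) * truncate n (ψ x)) x‖ ^ 2 ≤ M := by
    intro n
    refine (hK _ (ha n)).trans (add_le_add ?_ ?_)
    · rw [h.form_mul_of_bounded hd hΓ (hψ.truncate n) (hψ.truncate n) (hb n) (hb n) (hFn n) (hFn n),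
        integral_inner_self, Complex.ofReal_re]
      exact mul_le_mul_of_nonneg_left (integral_norm_sq_le (hFn n) hF
        (norm_smul_truncateGrad_le hC0 hC n)) two_pos.le
    · exact mul_le_mul_of_nonneg_left (integral_norm_sq_le (ha n).memLp hψw
        (norm_mul_truncate_le n)) hK0
  have hsum : MemLp (fun x => ψ x • weakGrad (fun x => (w x : ℂ)) x + (w x : ℂ) • F x) 2
      volume := by
    refine ⟨(hψ.locallyIntegrable.aestronglyMeasurable.smul hw.memLp_weakGrad_volume.1).add hF.1,
      ?_⟩
    -- Fatou's lemma: at almost every point the gradients of the truncated products are eventually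
    -- equal to `ψ ∇w + w F`.
    refine (eLpNorm_le_of_tendsto (fun n => (ha n).memLp_weakGrad_volume.1)
      (fun n => eLpNorm_two_le_of_integral_le (ha n).memLp_weakGrad_volume (hbound n))
      tendsto_const_nhds ?_).trans_lt (ENNReal.rpow_lt_top_of_nonneg (by norm_num)
        ENNReal.ofReal_ne_top)
    filter_upwards [ae_all_iff.2 hgrad] with x hx
    refine tendsto_const_nhds.congr' ?_
    filter_upwards [eventually_truncate_eq (ψ x), eventually_truncateGrad_eq (ψ x) (F x)]
      with n h1 h2
    rw [hx n, h1, h2]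
  refine (memLp_congr_ae (Eventually.of_forall fun x => ?_)).1 (hsum.sub hF)
  simp

/-- Multiplication by `w` maps the weighted Sobolev space into `W^{1,2}(ℝ^d)`, and it maps
truncations to convergent sequences. -/
lemma IsHamiltonianValue.memW12_mul (hd : 1 ≤ d) (hΓ : IsCompactHypersurface Γ)
    {α E : ℝ} (hα : 0 < α)
    (h : IsHamiltonianValue Γ α (fun x => (w x : ℂ)) (fun x => (E : ℂ) * (w x : ℂ)))
    (hψ : HasWeakGradient ψ F) (hψw : MemLp (fun x => (w x : ℂ) * ψ x) 2 volume)
    (hF : MemLp (fun x => (w x : ℂ) • F x) 2 volume) :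
    MemW12 volume (fun x => (w x : ℂ) * ψ x) ∧
      TendstoW12 (fun n x => (w x : ℂ) * truncate n (ψ x)) (fun x => (w x : ℂ) * ψ x) := by
  have hw := h.1
  obtain ⟨C, hC0, hC⟩ := exists_norm_fderiv_truncate_le
  have hψN := h.memLp_smul_weakGrad hd hΓ hα hψ hψw hF
  have hFn := memLp_smul_truncateGrad hw hψ hF
  have ha := hw.mul_truncate hψ hF
  have hb : ∀ n : ℕ, ∀ᵐ x, ‖truncate n (ψ x)‖ ≤ 2 * ((n : ℝ) + 1) := fun n =>
    Eventually.of_forall fun _ => norm_truncate_le_const n _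
  have hgrad : HasWeakGradient (fun x => (w x : ℂ) * ψ x)
      (fun x => ψ x • weakGrad (fun x => (w x : ℂ)) x + (w x : ℂ) • F x) :=
    hw.hasWeakGradient.mul hψ (locallyIntegrable_of_memLp_two hψw)
      (locallyIntegrable_of_memLp_two hψN) (locallyIntegrable_of_memLp_two hF)
  have hgradn := fun n => hw.hasWeakGradient_mul_of_bounded (hψ.truncate n) (hb n) (hFn n)
  refine ⟨⟨hψw, _, hgrad, hψN.add hF⟩, tendstoW12_of_tendsto (fun n => (hgradn n).2.1) hgrad
    (tendsto_eLpNorm_two_of_dominated (b := fun x => 2 * ‖(w x : ℂ) * ψ x‖)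
      (fun n => ((hgradn n).1.sub hψw).1) (hψw.norm.const_mul 2) (fun n => ?_) ?_)
    -- Domination is available only now that `ψ ∇w` is known to be square integrable.
    (tendsto_eLpNorm_two_of_dominated
      (b := fun x => 2 * ‖ψ x • weakGrad (fun x => (w x : ℂ)) x‖ + (C + 1) * ‖(w x : ℂ) • F x‖)
      (fun n => ((hgradn n).2.2.sub (hψN.add hF)).1)
      ((hψN.norm.const_mul 2).add (hF.norm.const_mul (C + 1))) (fun n => ?_) ?_)⟩
  · refine Eventually.of_forall fun x => (norm_sub_le _ _).trans ?_
    have := norm_mul_truncate_le (w := w) (ψ := ψ) n x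
    linarith
  · refine Eventually.of_forall fun x => tendsto_const_nhds.congr' ?_
    filter_upwards [eventually_truncate_eq (ψ x)] with n hn
    simp [hn]
  · refine Eventually.of_forall fun x => (norm_sub_le _ _).trans ?_
    have h1 := norm_smul_truncateGrad_le (w := w) (ψ := ψ) (F := F) hC0 hC n x
    have h2 : ‖truncate n (ψ x) • weakGrad (fun x => (w x : ℂ)) x‖
        ≤ ‖ψ x • weakGrad (fun x => (w x : ℂ)) x‖ := by
      rw [norm_smul, norm_smul]
      exact mul_le_mul_of_nonneg_right (norm_truncate_le n _) (norm_nonneg _)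
    have h3 := norm_add_le (truncate n (ψ x) • weakGrad (fun x => (w x : ℂ)) x)
      ((w x : ℂ) • truncateGrad n (ψ x) (F x))
    have h4 := norm_add_le (ψ x • weakGrad (fun x => (w x : ℂ)) x) ((w x : ℂ) • F x)
    linarith
  · refine Eventually.of_forall fun x => tendsto_const_nhds.congr' ?_
    filter_upwards [eventually_truncate_eq (ψ x), eventually_truncateGrad_eq (ψ x) (F x)]
      with n h1 h2
    simp [h1, h2]

/-- The ground state transformation of the form. -/
theorem IsHamiltonianValue.form_mul (hd : 1 ≤ d) (hΓ : IsCompactHypersurface Γ)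
    {α E : ℝ} (hα : 0 < α)
    (h : IsHamiltonianValue Γ α (fun x => (w x : ℂ)) (fun x => (E : ℂ) * (w x : ℂ)))
    {φ : Space d → ℂ} {G : Space d → EuclideanSpace ℂ (Fin d)}
    (hψ : HasWeakGradient ψ F) (hψw : MemLp (fun x => (w x : ℂ) * ψ x) 2 volume)
    (hF : MemLp (fun x => (w x : ℂ) • F x) 2 volume)
    (hφ : HasWeakGradient φ G) (hφw : MemLp (fun x => (w x : ℂ) * φ x) 2 volume)
    (hG : MemLp (fun x => (w x : ℂ) • G x) 2 volume) :
    singularForm Γ α (fun x => (w x : ℂ) * ψ x) (fun x => (w x : ℂ) * φ x)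
      - (E : ℂ) * scalarProduct (fun x => (w x : ℂ) * ψ x) (fun x => (w x : ℂ) * φ x)
      = ∫ x, inner ℂ ((w x : ℂ) • G x) ((w x : ℂ) • F x) := by
  have hw := h.1
  obtain ⟨C, hC0, hC⟩ := exists_norm_fderiv_truncate_le
  have hb : ∀ (f : Space d → ℂ) (n : ℕ), ∀ᵐ x, ‖truncate n (f x)‖ ≤ 2 * ((n : ℝ) + 1) :=
    fun f n => Eventually.of_forall fun _ => norm_truncate_le_const n _
  have hlim : ∀ {f : Space d → ℂ} {K : Space d → EuclideanSpace ℂ (Fin d)},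
      HasWeakGradient f K → MemLp (fun x => (w x : ℂ) • K x) 2 volume →
      Tendsto (fun n => eLpNorm ((fun x => (w x : ℂ) • truncateGrad n (f x) (K x))
        - fun x => (w x : ℂ) • K x) 2 volume) atTop (𝓝 0) := by
    intro f K hf hK
    refine tendsto_eLpNorm_two_of_dominated (b := fun x => (C + 1) * ‖(w x : ℂ) • K x‖)
      (fun n => ((memLp_smul_truncateGrad hw hf hK n).sub hK).1) (hK.norm.const_mul _)
      (fun n => ?_) ?_
    · refine Eventually.of_forall fun x => (norm_sub_le _ _).trans ?_
      have h1 := norm_smul_truncateGrad_le (w := w) (ψ := f) (F := K) hC0 hC n x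
      linarith
    · refine Eventually.of_forall fun x => tendsto_const_nhds.congr' ?_
      filter_upwards [eventually_truncateGrad_eq (f x) (K x)] with n h2
      simp [h2]
  obtain ⟨ha, halim⟩ := h.memW12_mul hd hΓ hα hψ hψw hF
  obtain ⟨hb', hblim⟩ := h.memW12_mul hd hΓ hα hφ hφw hG
  have han := hw.mul_truncate hψ hF
  have hbn := hw.mul_truncate hφ hG
  -- Form, scalar product and weighted gradient integral all converge along the truncations, for
  -- which the identity is already established.
  have h1 := tendsto_singularForm_of_memW12 hd hΓ α ha hb' han hbn halim hblim
  have h2 := tendsto_scalarProduct hψw hφw (fun n => (han n).memLp) (fun n => (hbn n).memLp)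
    halim.tendsto_eLpNorm hblim.tendsto_eLpNorm
  have h3 := tendsto_integral_inner hF hG (memLp_smul_truncateGrad hw hψ hF)
    (memLp_smul_truncateGrad hw hφ hG) (hlim hψ hF) (hlim hφ hG)
  refine tendsto_nhds_unique ((h1.sub (h2.const_mul (E : ℂ))).congr fun n => ?_) h3
  exact h.form_mul_of_bounded hd hΓ (hψ.truncate n) (hφ.truncate n) (hb ψ n) (hb φ n)
    (memLp_smul_truncateGrad hw hψ hF n) (memLp_smul_truncateGrad hw hφ hG n)

end Eigenfunction

/-! ### Division by a locally bounded below function -/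

/-- A regularization of the inverse. -/
noncomputable def regInv (ε t : ℝ) : ℝ := t / (t ^ 2 + ε ^ 2)

lemma hasDerivAt_regInv {ε : ℝ} (hε : 0 < ε) (t : ℝ) :
    HasDerivAt (regInv ε) ((ε ^ 2 - t ^ 2) / (t ^ 2 + ε ^ 2) ^ 2) t := by
  have h0 : t ^ 2 + ε ^ 2 ≠ 0 := by positivity
  have h1 := (hasDerivAt_id t).div ((hasDerivAt_pow 2 t).add_const (ε ^ 2)) h0
  refine HasDerivAt.congr_deriv (f := regInv ε) h1 ?_
  simp only [id]
  push_cast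
  ring

lemma contDiff_regInv {ε : ℝ} (hε : 0 < ε) : ContDiff ℝ 1 (regInv ε) :=
  contDiff_id.div ((contDiff_id.pow 2).add contDiff_const) fun t => by
    have : 0 < t ^ 2 + ε ^ 2 := by positivity
    exact this.ne'

/-- One estimate with two uses: the bound `ε⁻²` permits the chain rule for fixed `ε`, and the bound
`t⁻²`, for `t > 0`, is a majorant independent of `ε`. -/
lemma abs_deriv_regInv_le {ε : ℝ} (hε : 0 < ε) (t : ℝ) :
    |(ε ^ 2 - t ^ 2) / (t ^ 2 + ε ^ 2) ^ 2| ≤ (t ^ 2 + ε ^ 2)⁻¹ := by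
  have h0 : 0 < t ^ 2 + ε ^ 2 := by positivity
  rw [abs_div, abs_of_pos (pow_pos h0 2), div_le_iff₀ (pow_pos h0 2)]
  have h1 : (t ^ 2 + ε ^ 2)⁻¹ * (t ^ 2 + ε ^ 2) ^ 2 = t ^ 2 + ε ^ 2 := by field_simp
  rw [h1, abs_le]
  constructor <;> nlinarith [sq_nonneg t, sq_nonneg ε]

lemma norm_fderiv_regInv_le {ε : ℝ} (hε : 0 < ε) (t : ℝ) :
    ‖fderiv ℝ (regInv ε) t‖ ≤ (ε ^ 2)⁻¹ := by
  rw [← norm_deriv_eq_norm_fderiv, (hasDerivAt_regInv hε t).deriv, Real.norm_eq_abs]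
  refine (abs_deriv_regInv_le hε t).trans (inv_anti₀ (by positivity) ?_)
  nlinarith [sq_nonneg t]

lemma abs_regInv_le {ε t : ℝ} (ht : 0 < t) : |regInv ε t| ≤ t⁻¹ := by
  have h0 : 0 < t ^ 2 + ε ^ 2 := by positivity
  rw [regInv, abs_of_nonneg (by positivity), div_le_iff₀ h0]
  have h1 : t⁻¹ * (t ^ 2 + ε ^ 2) = t + t⁻¹ * ε ^ 2 := by field_simp
  rw [h1]
  have : 0 ≤ t⁻¹ * ε ^ 2 := by positivity
  linarith

/-- `w` is locally bounded below by positive constants. -/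
def LocallyBoundedBelow (w : Space d → ℝ) : Prop :=
  ∀ R : ℝ, ∃ δ > 0, ∀ᵐ x, x ∈ Metric.closedBall (0 : Space d) R → δ ≤ w x

/-- The inverse has no bounded derivative near zero, so the chain rule is applied to `t / (t² +
ε²)`. The limit `ε → 0` is dominated by multiples of `|w⁻¹|` and `|w⁻² g|`, the two functions
assumed locally integrable. -/
lemma HasWeakDeriv.inv {w g : Space d → ℝ} {v : Space d} (h : HasWeakDeriv v w g)
    (hw0 : ∀ᵐ x, 0 < w x) (h1 : LocallyIntegrable (fun x => (w x)⁻¹) volume)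
    (h2 : LocallyIntegrable (fun x => (w x ^ 2)⁻¹ * g x) volume) :
    HasWeakDeriv v (fun x => (w x)⁻¹) (fun x => -((w x ^ 2)⁻¹ * g x)) := by
  have hε : ∀ n : ℕ, (0 : ℝ) < ((n : ℝ) + 1)⁻¹ := fun n => by positivity
  have hεlim : Tendsto (fun n : ℕ => ((n : ℝ) + 1)⁻¹) atTop (𝓝 0) :=
    tendsto_inv_atTop_zero.comp (tendsto_atTop_add_const_right _ 1 tendsto_natCast_atTop_atTop)
  have hn : ∀ n : ℕ, HasWeakDeriv v (fun x => regInv ((n : ℝ) + 1)⁻¹ (w x))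
      (fun x => g x * (((((n : ℝ) + 1)⁻¹) ^ 2 - w x ^ 2)
        / (w x ^ 2 + (((n : ℝ) + 1)⁻¹) ^ 2) ^ 2)) := by
    intro n
    refine (h.comp (contDiff_regInv (hε n)) (norm_fderiv_regInv_le (hε n))).congr ae_eq_rfl
      (Eventually.of_forall fun x => ?_)
    dsimp only
    rw [(hasDerivAt_regInv (hε n) (w x)).hasFDerivAt.fderiv]
    simp
  refine HasWeakDeriv.of_tendsto hn h1 h2.neg
    (tendstoL1loc_of_dominated (b := fun x => (2 : ℝ) * ‖(w x)⁻¹‖)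
      (fun n => (hn n).locallyIntegrable.aestronglyMeasurable) h1.aestronglyMeasurable
      (h1.norm.smul (2 : ℝ)) (fun n => ?_) ?_)
    (tendstoL1loc_of_dominated (b := fun x => (2 : ℝ) * ‖(w x ^ 2)⁻¹ * g x‖)
      (fun n => (hn n).locallyIntegrable_deriv.aestronglyMeasurable) h2.neg.aestronglyMeasurable
      (h2.norm.smul (2 : ℝ)) (fun n => ?_) ?_)
  · filter_upwards [hw0] with x hx
    refine (norm_sub_le _ _).trans ?_
    have := abs_regInv_le (ε := ((n : ℝ) + 1)⁻¹) hx
    rw [Real.norm_eq_abs, Real.norm_of_nonneg (inv_nonneg.2 hx.le)]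
    linarith
  · filter_upwards [hw0] with x hx
    have h3 : Tendsto (fun n : ℕ => w x / (w x ^ 2 + (((n : ℝ) + 1)⁻¹) ^ 2)) atTop
        (𝓝 (w x / (w x ^ 2 + 0 ^ 2))) :=
      tendsto_const_nhds.div (tendsto_const_nhds.add (hεlim.pow 2)) (by positivity)
    have h4 : w x / (w x ^ 2 + 0 ^ 2) = (w x)⁻¹ := by
      have := hx.ne'
      field_simp
      simp
    rw [h4] at h3
    exact h3
  · filter_upwards [hw0] with x hx
    refine (norm_sub_le _ _).trans ?_
    have h3 : ‖g x * (((((n : ℝ) + 1)⁻¹) ^ 2 - w x ^ 2)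
        / (w x ^ 2 + (((n : ℝ) + 1)⁻¹) ^ 2) ^ 2)‖ ≤ ‖(w x ^ 2)⁻¹ * g x‖ := by
      rw [norm_mul, norm_mul, mul_comm]
      refine mul_le_mul_of_nonneg_right ((abs_deriv_regInv_le (hε n) (w x)).trans ?_)
        (norm_nonneg _)
      rw [Real.norm_of_nonneg (by positivity)]
      exact inv_anti₀ (by positivity) (le_add_of_nonneg_right (by positivity))
    rw [norm_neg]
    linarith
  · filter_upwards [hw0] with x hx
    have h3 : Tendsto (fun n : ℕ => g x * (((((n : ℝ) + 1)⁻¹) ^ 2 - w x ^ 2)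
        / (w x ^ 2 + (((n : ℝ) + 1)⁻¹) ^ 2) ^ 2)) atTop
        (𝓝 (g x * ((0 ^ 2 - w x ^ 2) / (w x ^ 2 + 0 ^ 2) ^ 2))) :=
      tendsto_const_nhds.mul (((hεlim.pow 2).sub tendsto_const_nhds).div
        ((tendsto_const_nhds.add (hεlim.pow 2)).pow 2) (by positivity))
    convert h3 using 2
    have := hx.ne'
    field_simp
    ring

end SingularSchrodinger

namespace SingularSchrodinger

variable {d : ℕ} {Γ : Set (Space d)}

/-! ### Quotients by the eigenfunction -/

section Division

variable {w : Space d → ℝ}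

lemma LocallyBoundedBelow.inv_pow_le (h : LocallyBoundedBelow w) (k : ℕ) (R : ℝ) :
    ∃ C : ℝ, ∀ᵐ x, x ∈ Metric.closedBall (0 : Space d) R → ‖((w x : ℂ) ^ k)⁻¹‖ ≤ C := by
  obtain ⟨δ, hδ, hw⟩ := h R
  refine ⟨(δ ^ k)⁻¹, ?_⟩
  filter_upwards [hw] with x hx hxR
  have h1 := hx hxR
  rw [norm_inv, norm_pow, Complex.norm_real, Real.norm_of_nonneg (hδ.le.trans h1)]
  exact inv_anti₀ (pow_pos hδ k) (pow_le_pow_left₀ hδ.le h1 k)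

lemma LocallyBoundedBelow.locallyIntegrable_inv_pow_smul (h : LocallyBoundedBelow w)
    (hw : AEStronglyMeasurable (fun x => (w x : ℂ)) volume) (k : ℕ) {V : Type*}
    [NormedAddCommGroup V] [NormedSpace ℂ V] {G : Space d → V} (hG : LocallyIntegrable G volume) :
    LocallyIntegrable (fun x => ((w x : ℂ) ^ k)⁻¹ • G x) volume :=
  locallyIntegrable_bounded_smul (hw.pow k).inv₀ (h.inv_pow_le k) hG

/-- The rule for inverses is one for real functions; it is applied to the real parts of the
components of `∇w`, which lose nothing because `∇w` is real almost everywhere. -/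
lemma MemW12.hasWeakGradient_inv (hw : MemW12 volume fun x => (w x : ℂ))
    (hw0 : ∀ᵐ x, 0 < w x) (hb : LocallyBoundedBelow w) :
    HasWeakGradient (fun x => (w x : ℂ)⁻¹)
      (fun x => -(((w x : ℂ) ^ 2)⁻¹ • weakGrad (fun x => (w x : ℂ)) x)) := by
  have hm := hw.memLp.1
  have h1 : LocallyIntegrable (fun x => (w x : ℂ)⁻¹) volume := by
    have := hb.locallyIntegrable_inv_pow_smul hm 1
      (continuous_const (y := (1 : ℂ))).locallyIntegrable
    simpa using this
  have h2 := hb.locallyIntegrable_inv_pow_smul hm 2 hw.hasWeakGradient.locallyIntegrable_grad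
  have hreal := conjVec_weakGrad_ofReal hw
  have hre : ∀ᵐ x, ∀ i, ((weakGrad (fun x => (w x : ℂ)) x i).re : ℂ)
      = weakGrad (fun x => (w x : ℂ)) x i := by
    filter_upwards [hreal] with x hx i
    have := congrArg (fun v : EuclideanSpace ℂ (Fin d) => v i) hx
    exact Complex.conj_eq_iff_re.1 this
  refine .of_hasWeakDeriv h1 h2.neg fun i => ?_
  have h3 := (hw.hasWeakGradient.hasWeakDeriv i).clm_comp Complex.reCLM
  simp only [Complex.reCLM_apply, Complex.ofReal_re] at h3
  have h1r : LocallyIntegrable (fun x => (w x)⁻¹) volume := fun x => by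
    obtain ⟨U, hU, hint⟩ := h1 x
    refine ⟨U, hU, ?_⟩
    have := hint.re
    simpa only [IntegrableOn, ← Complex.ofReal_inv, RCLike.re_eq_complex_re, Complex.ofReal_re]
      using this
  have h2r : LocallyIntegrable
      (fun x => (w x ^ 2)⁻¹ * (weakGrad (fun x => (w x : ℂ)) x i).re) volume := fun x => by
    obtain ⟨U, hU, hint⟩ := h2 x
    refine ⟨U, hU, ?_⟩
    have := ((EuclideanSpace.proj (𝕜 := ℂ) i).integrable_comp hint).re
    refine this.congr (Eventually.of_forall fun y => ?_)
    simp only [EuclideanSpace.coe_proj, PiLp.smul_apply, smul_eq_mul, ← Complex.ofReal_pow,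
      ← Complex.ofReal_inv, RCLike.re_eq_complex_re, Complex.re_ofReal_mul]
  refine ((h3.inv hw0 h1r h2r).clm_comp Complex.ofRealCLM).congr
    (Eventually.of_forall fun x => by simp) ?_
  filter_upwards [hre] with x hx
  simp [hx i]

/-- The weak gradient of a quotient. -/
lemma MemW12.hasWeakGradient_div (hw : MemW12 volume fun x => (w x : ℂ))
    (hw0 : ∀ᵐ x, 0 < w x) (hb : LocallyBoundedBelow w) {u : Space d → ℂ} (hu : MemW12 volume u) :
    HasWeakGradient (fun x => (w x : ℂ)⁻¹ * u x)
      (fun x => (w x : ℂ)⁻¹ • (weakGrad u x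
        - ((w x : ℂ)⁻¹ * u x) • weakGrad (fun x => (w x : ℂ)) x)) := by
  have hm := hw.memLp.1
  have h1 : ∀ {V : Type} [NormedAddCommGroup V] [NormedSpace ℂ V] {G : Space d → V},
      LocallyIntegrable G volume → LocallyIntegrable (fun x => (w x : ℂ)⁻¹ • G x) volume := by
    intro V _ _ G hG
    simpa only [pow_one] using hb.locallyIntegrable_inv_pow_smul hm 1 hG
  have h2 := (integrable_smul_of_memLp hu.memLp hw.memLp_weakGrad_volume).locallyIntegrable
  have h3 := (hb.locallyIntegrable_inv_pow_smul hm 2 h2).neg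
  refine ((hw.hasWeakGradient_inv hw0 hb).mul hu.hasWeakGradient
    (h1 hu.hasWeakGradient.locallyIntegrable) (h3.congr (Eventually.of_forall fun x => ?_))
    (h1 hu.hasWeakGradient.locallyIntegrable_grad)).congr ae_eq_rfl
    (Eventually.of_forall fun x => ?_)
  · simp only [Pi.neg_apply, smul_neg]
    rw [smul_comm]
  · simp only [smul_neg, smul_sub, smul_smul]
    rw [neg_add_eq_sub]
    congr 2
    ring

lemma smul_weakGrad_div_ae_eq (hw0 : ∀ᵐ x, 0 < w x) (u : Space d → ℂ) :
    (fun x => (w x : ℂ) • (w x : ℂ)⁻¹ • (weakGrad u x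
        - ((w x : ℂ)⁻¹ * u x) • weakGrad (fun x => (w x : ℂ)) x)) =ᵐ[volume]
      fun x => weakGrad u x - ((w x : ℂ)⁻¹ * u x) • weakGrad (fun x => (w x : ℂ)) x := by
  filter_upwards [hw0] with x hx
  rw [smul_inv_smul₀ (by exact_mod_cast hx.ne')]

lemma mul_inv_mul_ae_eq (hw0 : ∀ᵐ x, 0 < w x) (u : Space d → ℂ) :
    (fun x => (w x : ℂ) * ((w x : ℂ)⁻¹ * u x)) =ᵐ[volume] u := by
  filter_upwards [hw0] with x hx
  rw [mul_inv_cancel_left₀ (by exact_mod_cast hx.ne')]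

/-- Since `w` is bounded below on the support of `u`, the quotient `u / w` is bounded and the
identity for bounded functions applies to it. The surface term is dropped by its sign. The resulting
bound involves only the `W^{1,2}` data of `u`, not the lower bound of `w`, and so extends by
density. -/
lemma IsHamiltonianValue.eLpNorm_div_le_of_test (hd : 1 ≤ d) (hΓ : IsCompactHypersurface Γ)
    {α E : ℝ} (hα : 0 < α)
    (h : IsHamiltonianValue Γ α (fun x => (w x : ℂ)) (fun x => (E : ℂ) * (w x : ℂ)))
    (hw0 : ∀ᵐ x, 0 < w x) (hb : LocallyBoundedBelow w) {u : Space d → ℂ} (hu : ContDiff ℝ ∞ u)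
    (huc : HasCompactSupport u) :
    eLpNorm (fun x => weakGrad u x - ((w x : ℂ)⁻¹ * u x) • weakGrad (fun x => (w x : ℂ)) x) 2
      volume ≤ (eLpNorm (weakGrad u) 2 volume ^ (2 : ℝ)
        + ENNReal.ofReal |E| * eLpNorm u 2 volume ^ (2 : ℝ)) ^ (1 / 2 : ℝ) := by
  have hw := h.1
  have huW : MemW12 volume u := memW12_of_contDiff (hu.of_le (by exact_mod_cast le_top)) huc
  obtain ⟨B, hB⟩ := huc.exists_bound_of_continuous hu.continuous
  obtain ⟨R, hR⟩ := huc.isCompact.isBounded.subset_closedBall 0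
  obtain ⟨C, hC⟩ := hb.inv_pow_le 1 R
  have hbound : ∀ᵐ x, ‖(w x : ℂ)⁻¹ * u x‖ ≤ |C| * B := by
    filter_upwards [hC] with x hx
    have hB0 : 0 ≤ B := (norm_nonneg _).trans (hB x)
    by_cases hxu : x ∈ tsupport u
    · have h1 := hx (hR hxu)
      rw [pow_one] at h1
      rw [norm_mul]
      exact mul_le_mul (h1.trans (le_abs_self C)) (hB x) (norm_nonneg _) (abs_nonneg C)
    · rw [image_eq_zero_of_notMem_tsupport hxu, mul_zero, norm_zero]
      positivity
  have hdiv := hw.hasWeakGradient_div hw0 hb huW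
  have hT : MemLp (fun x => weakGrad u x
      - ((w x : ℂ)⁻¹ * u x) • weakGrad (fun x => (w x : ℂ)) x) 2 volume :=
    huW.memLp_weakGrad_volume.sub (memLp_bounded_smul
      hdiv.locallyIntegrable.aestronglyMeasurable hbound hw.memLp_weakGrad_volume)
  have hT' := (memLp_congr_ae (smul_weakGrad_div_ae_eq hw0 u)).2 hT
  have h2 := h.form_mul_of_bounded hd hΓ hdiv hdiv hbound hbound hT' hT'
  have h3 := mul_inv_mul_ae_eq hw0 u
  rw [singularForm_congr α h3 h3, scalarProduct_congr h3 h3, integral_inner_self] at h2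
  have h4 : ∫ x, ‖weakGrad u x - ((w x : ℂ)⁻¹ * u x) • weakGrad (fun x => (w x : ℂ)) x‖ ^ 2
      ≤ (∫ x, ‖weakGrad u x‖ ^ 2) + |E| * ∫ x, ‖u x‖ ^ 2 := by
    refine le_of_eq_of_le ?_ (re_form_self_le (Γ := Γ) hα.le E u)
    rw [h2, Complex.ofReal_re]
    refine integral_congr_ae ?_
    filter_upwards [smul_weakGrad_div_ae_eq hw0 u] with x hx
    rw [hx]
  refine (eLpNorm_two_le_of_integral_le hT h4).trans_eq ?_
  rw [eLpNorm_two_rpow_two, eLpNorm_two_rpow_two, ← ofReal_integral_norm_sq huW.memLp,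
    ← ofReal_integral_norm_sq huW.memLp_weakGrad_volume, ← ENNReal.ofReal_mul (abs_nonneg E),
    ENNReal.ofReal_add (integral_norm_sq_nonneg _ _)
      (mul_nonneg (abs_nonneg E) (integral_norm_sq_nonneg _ _))]

/-- Division by `w` maps `W^{1,2}(ℝ^d)` into the weighted Sobolev space. -/
lemma IsHamiltonianValue.memLp_div (hd : 1 ≤ d) (hΓ : IsCompactHypersurface Γ)
    {α E : ℝ} (hα : 0 < α)
    (h : IsHamiltonianValue Γ α (fun x => (w x : ℂ)) (fun x => (E : ℂ) * (w x : ℂ)))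
    (hw0 : ∀ᵐ x, 0 < w x) (hb : LocallyBoundedBelow w) {u : Space d → ℂ} (hu : MemW12 volume u) :
    MemLp (fun x => weakGrad u x - ((w x : ℂ)⁻¹ * u x) • weakGrad (fun x => (w x : ℂ)) x) 2
      volume := by
  have hw := h.1
  have hmeas : ∀ {v : Space d → ℂ}, MemW12 volume v → AEStronglyMeasurable (fun x => weakGrad v x
      - ((w x : ℂ)⁻¹ * v x) • weakGrad (fun x => (w x : ℂ)) x) volume := fun hv =>
    hv.memLp_weakGrad_volume.1.sub ((hw.memLp.1.inv₀.mul hv.memLp.1).smul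
      hw.memLp_weakGrad_volume.1)
  obtain ⟨η, hη, hlim, -⟩ := hu.exists_tendstoW12
  have hη' : IsTestSeq η := hη
  have hlim0 := hlim.tendsto_eLpNorm
  have hlim1 := hlim.tendsto_eLpNorm_weakGrad hη'.memW12 hu
  -- Fatou's lemma needs pointwise convergence of functions and of gradients; two successive
  -- subsequences provide both.
  obtain ⟨ns, hns, hae⟩ := (tendstoInMeasure_of_tendsto_eLpNorm two_ne_zero
    (fun n => (hη'.memW12 n).memLp.1) hu.memLp.1 hlim0).exists_seq_tendsto_ae
  obtain ⟨ms, hms, hae'⟩ := (tendstoInMeasure_of_tendsto_eLpNorm two_ne_zero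
    (fun n => (hη'.memW12 (ns n)).memLp_weakGrad_volume.1) hu.memLp_weakGrad_volume.1
    (hlim1.comp hns.tendsto_atTop)).exists_seq_tendsto_ae
  have hk : Tendsto (fun n => ns (ms n)) atTop atTop := hns.tendsto_atTop.comp hms.tendsto_atTop
  have hN0 := (tendsto_eLpNorm_of_tendsto_sub hu.memLp (fun n => (hη'.memW12 n).memLp) hlim0).comp hk
  have hN1 := (tendsto_eLpNorm_of_tendsto_sub hu.memLp_weakGrad_volume
    (fun n => (hη'.memW12 n).memLp_weakGrad_volume) hlim1).comp hk
  have hK := ((hN1.ennrpow_const 2).add (ENNReal.Tendsto.const_mul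
    (a := ENNReal.ofReal |E|) (hN0.ennrpow_const 2) (Or.inr ENNReal.ofReal_ne_top))).ennrpow_const
      (1 / 2)
  refine ⟨hmeas hu, (eLpNorm_le_of_tendsto (fun n => hmeas (hη'.memW12 (ns (ms n))))
    (fun n => h.eLpNorm_div_le_of_test hd hΓ hα hw0 hb (hη _).1 (hη _).2) hK ?_).trans_lt ?_⟩
  · filter_upwards [hae, hae'] with x h1 h2
    exact h2.sub (((h1.comp hms.tendsto_atTop).const_mul _).smul_const _)
  · refine ENNReal.rpow_lt_top_of_nonneg (by norm_num) (ENNReal.add_ne_top.2 ⟨?_, ?_⟩)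
    · exact ENNReal.rpow_ne_top_of_nonneg (by norm_num) hu.memLp_weakGrad_volume.2.ne
    · exact ENNReal.mul_ne_top ENNReal.ofReal_ne_top
        (ENNReal.rpow_ne_top_of_nonneg (by norm_num) hu.memLp.2.ne)

end Division

/-! ### The weighted space -/

section Weighted

variable {w : Space d → ℝ}

/-- A density that is positive almost everywhere leaves the null sets unchanged, so almost
everywhere statements move freely between the two measures. -/
lemma weightedMeasure_ae (hwm : AEMeasurable w volume) (hw0 : ∀ᵐ x, 0 < w x) :
    ae (weightedMeasure w) = ae volume := by
  refine le_antisymm (withDensity_absolutelyContinuous _ _).ae_le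
    (withDensity_absolutelyContinuous' (hwm.pow_const 2).ennreal_ofReal ?_).ae_le
  filter_upwards [hw0] with x hx
  rw [ne_eq, ENNReal.ofReal_eq_zero, not_le]
  positivity

lemma eLpNorm_weightedMeasure {V : Type*} [NormedAddCommGroup V] [NormedSpace ℂ V]
    (hwm : AEMeasurable w volume) {f : Space d → V} (hf : AEStronglyMeasurable f volume) :
    eLpNorm f 2 (weightedMeasure w) = eLpNorm (fun x => (w x : ℂ) • f x) 2 volume := by
  rw [eLpNorm_two_eq, eLpNorm_two_eq, weightedMeasure,
    lintegral_withDensity_eq_lintegral_mul₀ (hwm.pow_const 2).ennreal_ofReal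
      (hf.enorm.pow_const 2)]
  congr 1
  refine lintegral_congr fun x => ?_
  rw [Pi.mul_apply, enorm_smul, ENNReal.mul_rpow_of_nonneg _ _ (by norm_num)]
  congr 1
  rw [← ofReal_norm, Complex.norm_real, Real.norm_eq_abs, ← sq_abs,
    ENNReal.ofReal_pow (abs_nonneg _)]
  norm_cast

lemma memLp_weightedMeasure_iff {V : Type*} [NormedAddCommGroup V] [NormedSpace ℂ V]
    (hwm : AEMeasurable w volume) (hw0 : ∀ᵐ x, 0 < w x) {f : Space d → V} :
    MemLp f 2 (weightedMeasure w) ↔ MemLp (fun x => (w x : ℂ) • f x) 2 volume := by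
  have hae := weightedMeasure_ae hwm hw0
  have hwC : AEStronglyMeasurable (fun x => (w x : ℂ)) volume :=
    (Complex.measurable_ofReal.comp_aemeasurable hwm).aestronglyMeasurable
  constructor
  · intro h
    have hf : AEStronglyMeasurable f volume :=
      h.1.mono_ac (Measure.ae_le_iff_absolutelyContinuous.1 hae.ge)
    exact ⟨hwC.smul hf, (eLpNorm_weightedMeasure hwm hf).symm.trans_lt h.2⟩
  · intro h
    have hf : AEStronglyMeasurable f volume := by
      refine (hwC.inv₀.smul h.1).congr ?_
      filter_upwards [hw0] with x hx
      exact inv_smul_smul₀ (Complex.ofReal_ne_zero.2 hx.ne') _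
    exact ⟨hf.mono_ac (Measure.ae_le_iff_absolutelyContinuous.1 hae.le),
      (eLpNorm_weightedMeasure hwm hf).trans_lt h.2⟩

/-- Division by `w` is a unitary map from `L²(ℝ^d)` to `L²(ℝ^d, w² dx)`. -/
lemma exists_unitary_div (hwm : AEMeasurable w volume) (hw0 : ∀ᵐ x, 0 < w x) :
    ∃ U : Lp ℂ 2 (volume : Measure (Space d)) ≃ₗᵢ[ℂ] Lp ℂ 2 (weightedMeasure w),
      ∀ f, U f =ᵐ[volume] fun x => (w x : ℂ)⁻¹ * f x := by
  have hae := weightedMeasure_ae hwm hw0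
  have hdiv : ∀ f : Lp ℂ 2 (volume : Measure (Space d)),
      MemLp (fun x => (w x : ℂ)⁻¹ * f x) 2 (weightedMeasure w) := fun f =>
    (memLp_weightedMeasure_iff hwm hw0).2
      ((memLp_congr_ae (mul_inv_mul_ae_eq hw0 f)).2 (Lp.memLp f))
  have hmul : ∀ f : Lp ℂ 2 (weightedMeasure w), MemLp (fun x => (w x : ℂ) * f x) 2 volume :=
    fun f => (memLp_weightedMeasure_iff hwm hw0).1 (Lp.memLp f)
  have hU : ∀ f, (hdiv f).toLp =ᵐ[volume] fun x => (w x : ℂ)⁻¹ * f x := fun f => by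
    have := (hdiv f).coeFn_toLp
    rwa [EventuallyEq, hae] at this
  have hext : ∀ {f g : Lp ℂ 2 (weightedMeasure w)}, f =ᵐ[volume] g → f = g := fun {f g} h =>
    Lp.ext (by rwa [EventuallyEq, hae])
  have hcoe : ∀ {f g : Space d → ℂ}, f =ᵐ[weightedMeasure w] g → f =ᵐ[volume] g := fun h => by
    rwa [EventuallyEq, hae] at h
  let L : Lp ℂ 2 (volume : Measure (Space d)) →ₗᵢ[ℂ] Lp ℂ 2 (weightedMeasure w) :=
    { toFun := fun f => (hdiv f).toLp
      map_add' := fun f g => hext (by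
        filter_upwards [hU (f + g), hU f, hU g, Lp.coeFn_add f g,
          hcoe (Lp.coeFn_add (hdiv f).toLp (hdiv g).toLp)] with x h1 h2 h3 h4 h5
        rw [h1, h4, h5, Pi.add_apply, Pi.add_apply, h2, h3, mul_add])
      map_smul' := fun c f => hext (by
        filter_upwards [hU (c • f), hU f, Lp.coeFn_smul c f,
          hcoe (Lp.coeFn_smul c (hdiv f).toLp)] with x h1 h2 h3 h4
        rw [h1, h3, RingHom.id_apply, h4, Pi.smul_apply, Pi.smul_apply, h2, smul_eq_mul,
          smul_eq_mul, mul_left_comm])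
      norm_map' := fun f => by
        change ‖(hdiv f).toLp‖ = ‖f‖
        rw [Lp.norm_toLp, Lp.norm_def, eLpNorm_weightedMeasure hwm]
        · exact congrArg _ (eLpNorm_congr_ae (mul_inv_mul_ae_eq hw0 f))
        · exact (hdiv f).1.mono_ac (Measure.ae_le_iff_absolutelyContinuous.1 hae.ge) }
  have hL : ∀ f, L f =ᵐ[volume] fun x => (w x : ℂ)⁻¹ * f x := hU
  refine ⟨LinearIsometryEquiv.ofSurjective L fun g => ⟨(hmul g).toLp, hext ?_⟩, hU⟩
  filter_upwards [hL (hmul g).toLp, (hmul g).coeFn_toLp, hw0] with x h1 h2 h3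
  rw [h1, h2, inv_mul_cancel_left₀ (by exact_mod_cast h3.ne')]

end Weighted

end SingularSchrodinger

/-! ### The theorem -/

open SingularSchrodinger in
theorem theorem3p1 {d : ℕ} (hd : 1 ≤ d) (Γ : Set (Space d)) (hΓ : IsCompactHypersurface Γ)
    (α : ℝ) (hα : 0 < α) (ψ₀ : Space d → ℝ) (E₀ : ℝ)
    (hψ₀ : IsEigenfunction Γ α (fun x => (ψ₀ x : ℂ)) E₀)
    (hpos : ∀ᵐ x ∂(volume : Measure (Space d)), 0 < ψ₀ x) :
    ∃ U : Lp ℂ 2 (volume : Measure (Space d)) ≃ₗᵢ[ℂ] Lp ℂ 2 (weightedMeasure ψ₀),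
      (∀ f, U f =ᵐ[volume] fun x => (ψ₀ x : ℂ)⁻¹ * f x) ∧
      (∀ ψ : Lp ℂ 2 (weightedMeasure ψ₀),
        MemW12 (weightedMeasure ψ₀) ψ ↔ MemW12 volume (U.symm ψ)) ∧
      ∀ ψ φ : Lp ℂ 2 (weightedMeasure ψ₀),
        MemW12 (weightedMeasure ψ₀) ψ → MemW12 (weightedMeasure ψ₀) φ →
        singularForm Γ α (U.symm ψ) (U.symm φ) - (E₀ : ℂ) * scalarProduct (U.symm ψ) (U.symm φ) =
          ∫ x, inner ℂ (weakGrad φ x) (weakGrad ψ x) * (ψ₀ x : ℂ) ^ 2 := by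
  have h : IsHamiltonianValue Γ α (fun x => (ψ₀ x : ℂ)) (fun x => (E₀ : ℂ) * (ψ₀ x : ℂ)) := hψ₀.2
  have hw := h.1
  have hwm : AEMeasurable ψ₀ volume := by
    have := Complex.measurable_re.comp_aemeasurable hw.memLp.1.aemeasurable
    exact this
  have hwl : LocallyIntegrable ψ₀ volume := fun x => by
    obtain ⟨V, hV, hint⟩ := hw.hasWeakGradient.locallyIntegrable x
    exact ⟨V, hV, hint.re⟩
  -- The positive eigenfunction is a supersolution with constant `|E₀|`. The lower bound serves the
  -- passage from `W^{1,2}` to the weighted space, where one divides by `ψ₀`.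
  have hb : LocallyBoundedBelow ψ₀ :=
    (h.isSupersolution hd hΓ hα (hpos.mono fun _ hx => hx.le)).exists_pos_le (abs_nonneg E₀)
      hwl hpos
  have hac : weightedMeasure ψ₀ ≪ volume := withDensity_absolutelyContinuous _ _
  obtain ⟨U, hU⟩ := exists_unitary_div hwm hpos
  have hUinv : ∀ ψ : Lp ℂ 2 (weightedMeasure ψ₀),
      U.symm ψ =ᵐ[volume] fun x => (ψ₀ x : ℂ) * ψ x := fun ψ => by
    have h1 := hU (U.symm ψ)
    rw [U.apply_symm_apply] at h1
    filter_upwards [h1, hpos] with x h2 h3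
    rw [h2, mul_inv_cancel_left₀ (by exact_mod_cast h3.ne')]
  have hL : ∀ {ψ : Space d → ℂ}, MemLp ψ 2 (weightedMeasure ψ₀) →
      MemLp (fun x => (ψ₀ x : ℂ) * ψ x) 2 volume := fun hψ =>
    (memLp_weightedMeasure_iff hwm hpos).1 hψ
  refine ⟨U, hU, fun ψ => ⟨fun hψ => ?_, fun hu => ?_⟩, fun ψ φ hψ hφ => ?_⟩
  · exact (h.memW12_mul hd hΓ hα hψ.hasWeakGradient (hL hψ.memLp)
      ((memLp_weightedMeasure_iff hwm hpos).1 (hψ.memLp_weakGrad hac))).1.congr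
      Measure.AbsolutelyContinuous.rfl (hUinv ψ).symm
  -- The class `ψ` is the quotient of `U.symm ψ` by `ψ₀`, so the quotient rule supplies its weak
  -- gradient, and `memLp_div` the square integrability of that gradient against the weight.
  · have h1 : (fun x => (ψ₀ x : ℂ)⁻¹ * U.symm ψ x) =ᵐ[volume] ψ := by
      have := hU (U.symm ψ)
      rw [U.apply_symm_apply] at this
      exact this.symm
    refine ⟨Lp.memLp ψ, _, (hw.hasWeakGradient_div hpos hb hu).congr h1 ae_eq_rfl,
      (memLp_weightedMeasure_iff hwm hpos).2 ?_⟩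
    exact (memLp_congr_ae (smul_weakGrad_div_ae_eq hpos _)).2 (h.memLp_div hd hΓ hα hpos hb hu)
  · rw [singularForm_congr α (hUinv ψ) (hUinv φ), scalarProduct_congr (hUinv ψ) (hUinv φ),
      h.form_mul hd hΓ hα hψ.hasWeakGradient (hL hψ.memLp)
        ((memLp_weightedMeasure_iff hwm hpos).1 (hψ.memLp_weakGrad hac)) hφ.hasWeakGradient
        (hL hφ.memLp) ((memLp_weightedMeasure_iff hwm hpos).1 (hφ.memLp_weakGrad hac))]
    refine integral_congr_ae (Eventually.of_forall fun x => ?_)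
    simp only [inner_smul_left, inner_smul_right, Complex.conj_ofReal]
    ring
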